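/- **Setting.** $\mathcal B=\mathbb C^2$. For a state $\rho$ (density operator) on $\bigotimes_{i=1}^r\mathcal H_i$ put $\mathrm{tr}_\rho(T)=\mathrm{tr}(T\rho)$; an operator on $\mathcal H_i$ is extended by the identity. A reflection is a self-adjoint operator $R$ with $R^2=I$; it describes the measurement $R^a=\frac{I+(-1)^aR}2$, $a\in\{0,1\}$. Put $d_\rho(R_0,R_1)=[1-\mathrm{Re}\,\mathrm{tr}_\rho(R_0R_1)]^{1/2}$ for two-outcome measurements given by (compressed) reflections, and $d_\rho(M_0,M_1)=[2-2\,\mathrm{Re}\sum_b\mathrm{tr}_\rho(M_0^bM_1^b)]^{1/2}$ for measurements with outcomes $b$. **Stabilizer game.** A non-trivial $r$-qubit stabilizer with $XZ$-form generators is an abelian subgroup of the $r$-qubit Pauli group not containing $-I$, together with a finite set of generators $g_1,\dots,g_l$ of it, each of the form $g_j=(-1)^{s_j}\bigotimes_{i=1}^rP_{j,i}$ with $P_{j,i}\in\{I,X,Z\}$, and, for each qubit $t\in[r]$, a choice of generators $g^{(t)}_X,g^{(t)}_Z$ among them that have $X$, resp. $Z$, at qubit $t$. Let $h^{(t)}_1=g^{(t)}_X$,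 let $h^{(t)}_2$ be $g^{(t)}_X$ with the $X$ at qubit $t$ changed to $Z$, let $h^{(t)}_3$ be $g^{(t)}_Z$ with the $Z$ at qubit $t$ changed to $X$, and let $h^{(t)}_4=-g^{(t)}_Z$. In the stabilizer game with $r$ players the verifier, with equal probability, either (a) picks $j\in[l]$ uniformly and uses the operator $g_j$, or (b) picks $t\in[r]$ and $j\in[4]$ uniformly and uses the operator $h^{(t)}_j$. From the chosen signed Pauli operator, player $i$ gets the null question if the $i$-th factor is $I$; otherwise she gets $0$ or $1$ if the factor is $X$ or $Z$, except that the special player $i=t$ in (b) gets $2$ or $3$ instead. Every player answers a bit; the verifier accepts iff the sum modulo $2$ of the answers to non-null questions is $0$ for sign $+$ and $1$ for sign $-$. A null question is replaced by $1$ with a fixed probability $p\in[0,1]$ and by $0$ otherwise (independently), and its answer is ignored. The non-local value of this game is $\omega^*_S=\frac{6+\sqrt2}8$. **The $(k,n)$-stabilizer game** ($2\le k\le n$). With equal probability the verifier performs one of two tests. (1) Pick uniformly $J\subset[n]$ with $|J|=k$, $u\in J$ and a player $t\in[r]$; for each $v\in J$ sample independently questions $w_v=(w_{v,i})_{i\in[r]}$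 as in the stabilizer game. Send $(u,w_{u,i})$ to each player $i\ne t$ and receive a bit $a_i$; send $\mathbf q=((v,w_{v,t}))_{v\in J}$ to player $t$, receive $b\in\{0,1\}^J$ and put $a_t=b_u$. Accept iff the stabilizer game accepts the answers $a$ for the questions $w_u$. (2) Pick $u\in[n]$ uniformly, sample $w$ as in the stabilizer game, send $(u,w_i)$ to player $i$, and accept iff the stabilizer game accepts. A strategy $\mathcal S=(\rho,\{R^{(i)}_q\},\{M^{(i)}_{\mathbf q}\})$ consists of Hilbert spaces $\mathcal H_i$, a state $\rho$ on $\bigotimes_i\mathcal H_i$, reflections $R^{(i)}_q$ on $\mathcal H_i$ for $q=(u,w)\in[n]\times\{0,1,2,3\}$, and projective measurements $M^{(i)}_{\mathbf q}$ on $\mathcal H_i$ with outcomes in $\{0,1\}^J$ for $\mathbf q=((v,w_v))_{v\in J}$, $|J|=k$, $w_v\in\{0,1,2,3\}$. Its value is its probability of acceptance. **Theorem (partial rigidity).** For every $k\ge2$ there is $\kappa>0$, depending only on $k$, and for every $r\ge1$ there is a constant $C>0$, depending only on $k$ and $r$, such that the following holds for every non-trivial $r$-qubit stabilizer with $XZ$-form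 generators, every $n\ge k$, every $p\in[0,1]$ and every $\varepsilon\ge0$. If a strategy for the $(k,n)$-stabilizer game has value at least $\omega^*_S-\varepsilon$, then there are Hilbert spaces $\hat{\mathcal H}_i$ and isometries $V_i:\mathcal H_i\to\mathcal B^{\otimes n}\otimes\hat{\mathcal H}_i$, $i\in[r]$, such that: 1. For all $i\in[r]$, $u\in[n]$ and $w\in\{0,1\}$, with $q=(u,w)$ and $D_q$ the operator $X$ (if $w=0$) or $Z$ (if $w=1$) on the $u$-th qubit, $$d_\rho\bigl(R^{(i)}_q,\;V_i^\dagger D_qV_i\bigr)\le C\,n^\kappa\varepsilon^{1/\kappa}.$$ 2. For all $i\in[r]$, all $J\subset[n]$ with $|J|=k$ and all $\mathbf q=((v,w_v))_{v\in J}$ with $w_v\in\{0,1\}$, $$d_\rho\bigl(M^{(i)}_{\mathbf q},\;N^{(i)}_{\mathbf q}\bigr)\le C\,n^\kappa\varepsilon^{1/\kappa},\qquad N^{(i),b}_{\mathbf q}=V_i^\dagger\Bigl(\prod_{v\in J}\frac{I+(-1)^{b_v}D_{(v,w_v)}}2\Bigr)V_i .$$ 3. Let $\Pi$ be the projection onto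 the code space of the stabilizer and $V=\bigotimes_iV_i$. Then $$\mathrm{tr}\bigl((\Pi^{\otimes n}\otimes I)\,V\rho V^\dagger\bigr)\ge1-C\,n^\kappa\varepsilon^{1/\kappa},$$ where the $t$-th factor of $\Pi^{\otimes n}$ acts on the $t$-th qubits of the $r$ players. -/

import Mathlib

open scoped BigOperators

universe u

namespace StabilizerGame

noncomputable section

/-! ### Hilbert spaces and their tensor products

Every complex Hilbert space is `ℓ²(α)` for some index type `α`, up to a choice of an orthonormal
basis, and the Hilbert space tensor product of the spaces `ℓ²(α i)` is `ℓ²(∏ i, α i)`. No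
finiteness of the index types is assumed. -/

/-- The complex Hilbert space `ℓ²(α)`. -/
abbrev Ell2 (α : Type*) : Type _ := lp (fun _ : α => ℂ) 2

theorem memℓp_two_iff {α : Type*} (f : α → ℂ) :
    Memℓp f 2 ↔ Summable fun a => ‖f a‖ ^ 2 := by
  rw [memℓp_gen_iff (by norm_num)]
  simp

theorem Ell2.summable {α : Type*} (f : Ell2 α) : Summable fun a => ‖f a‖ ^ 2 :=
  (memℓp_two_iff _).1 (lp.memℓp f)

theorem Ell2.norm_sq {α : Type*} (f : Ell2 α) : ‖f‖ ^ 2 = ∑' a, ‖f a‖ ^ 2 := by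
  have h := lp.norm_rpow_eq_tsum (p := 2) (by norm_num) f
  simpa using h

/-- Relabelling the standard basis. -/
def reindex {α β : Type*} (e : α ≃ β) : Ell2 α →L[ℂ] Ell2 β :=
  LinearMap.mkContinuous
    { toFun := fun f => ⟨fun b => f (e.symm b), (memℓp_two_iff _).2
        (((Ell2.summable f).comp_injective e.symm.injective :))⟩
      map_add' := fun _ _ => rfl
      map_smul' := fun _ _ => rfl } 1 (fun f => by
        rw [one_mul]
        refine le_of_eq ((sq_eq_sq₀ (norm_nonneg _) (norm_nonneg _)).1 ?_)
        rw [Ell2.norm_sq, Ell2.norm_sq]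
        exact e.symm.tsum_eq fun a => ‖f a‖ ^ 2)

/-- The vector `f(·, c)` of `ℓ²(α)`, for `f` in `ℓ²(α × γ)`. -/
def slice {α γ : Type*} (f : Ell2 (α × γ)) (c : γ) : Ell2 α :=
  ⟨fun a => f (a, c), (memℓp_two_iff _).2
    ((Ell2.summable f).comp_injective (Prod.mk_left_injective c) :)⟩

theorem summable_slice {α γ : Type*} (f : Ell2 (α × γ)) :
    Summable fun c => ‖slice f c‖ ^ 2 := by
  have h := (((Equiv.prodComm γ α).summable_iff).2 (Ell2.summable f)).prod
  refine h.congr fun c => ?_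
  rw [Ell2.norm_sq]
  rfl

theorem tsum_slice {α γ : Type*} (f : Ell2 (α × γ)) :
    ∑' c, ‖slice f c‖ ^ 2 = ‖f‖ ^ 2 := by
  have h := ((Equiv.prodComm γ α).summable_iff).2 (Ell2.summable f)
  rw [Ell2.norm_sq, ← (Equiv.prodComm γ α).tsum_eq]
  refine Eq.trans (tsum_congr fun c => ?_) (Summable.tsum_prod h).symm
  rw [Ell2.norm_sq]
  rfl

theorem summable_ampl {α β γ : Type*} (A : Ell2 α →L[ℂ] Ell2 β) (f : Ell2 (α × γ)) :
    Summable fun x : β × γ => ‖A (slice f x.2) x.1‖ ^ 2 := by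
  rw [← (Equiv.prodComm γ β).summable_iff]
  refine (summable_prod_of_nonneg fun _ => sq_nonneg _).2 ⟨fun c => ?_, ?_⟩
  · exact Ell2.summable (A (slice f c))
  · refine Summable.of_nonneg_of_le (fun c => tsum_nonneg fun _ => sq_nonneg _) (fun c => ?_)
      ((summable_slice f).mul_left (‖A‖ ^ 2))
    have h := A.le_opNorm (slice f c)
    calc _ = ‖A (slice f c)‖ ^ 2 := (Ell2.norm_sq _).symm
      _ ≤ (‖A‖ * ‖slice f c‖) ^ 2 := by gcongr
      _ = _ := by ring

/-- The operator `A ⊗ 1` from `ℓ²(α) ⊗ ℓ²(γ)` to `ℓ²(β) ⊗ ℓ²(γ)`. -/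
def ampl {α β : Type*} (γ : Type*) (A : Ell2 α →L[ℂ] Ell2 β) :
    Ell2 (α × γ) →L[ℂ] Ell2 (β × γ) :=
  LinearMap.mkContinuous
    { toFun := fun f => ⟨fun x => A (slice f x.2) x.1, (memℓp_two_iff _).2 (summable_ampl A f)⟩
      map_add' := fun f g => by
        ext x
        have h : slice (f + g) x.2 = slice f x.2 + slice g x.2 := rfl
        simp only [h, map_add]
        rfl
      map_smul' := fun z f => by
        ext x
        have h : slice (z • f) x.2 = z • slice f x.2 := rfl
        simp only [h, map_smul]
        rfl } ‖A‖ (fun f => by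
      refine (sq_le_sq₀ (norm_nonneg _) (by positivity)).1 ?_
      have hs := ((Equiv.prodComm γ β).summable_iff).2 (summable_ampl A f)
      rw [Ell2.norm_sq, mul_pow, ← tsum_slice f, ← tsum_mul_left,
        ← (Equiv.prodComm γ β).tsum_eq]
      refine (Summable.tsum_prod hs).le.trans (Summable.tsum_le_tsum (fun c => ?_) hs.prod
        ((summable_slice f).mul_left _))
      have h := A.le_opNorm (slice f c)
      calc _ = ‖A (slice f c)‖ ^ 2 := (Ell2.norm_sq _).symm
        _ ≤ (‖A‖ * ‖slice f c‖) ^ 2 := by gcongr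
        _ = _ := by ring)

/-- The operator `A ⊗ B` from `ℓ²(α) ⊗ ℓ²(γ)` to `ℓ²(β) ⊗ ℓ²(δ)`. -/
def tensorPair {α β γ δ : Type*} (A : Ell2 α →L[ℂ] Ell2 β) (B : Ell2 γ →L[ℂ] Ell2 δ) :
    Ell2 (α × γ) →L[ℂ] Ell2 (β × δ) :=
  reindex (Equiv.prodComm δ β) ∘L ampl β B ∘L reindex (Equiv.prodComm β γ) ∘L ampl γ A

/-- The operator `⨂ i, A i` from `⨂ i, ℓ²(α i)` to `⨂ i, ℓ²(β i)`. -/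
def tensorOp : {r : ℕ} → {α β : Fin r → Type u} → (∀ i, Ell2 (α i) →L[ℂ] Ell2 (β i)) →
    (Ell2 (∀ i, α i) →L[ℂ] Ell2 (∀ i, β i))
  | 0, _, _, _ => reindex (Equiv.ofUnique _ _)
  | r + 1, α, β, A =>
      reindex (Fin.consEquiv β) ∘L
        tensorPair (A 0) (tensorOp fun i : Fin r => A i.succ) ∘L
          reindex (Fin.consEquiv α).symm

open Classical in
/-- The standard basis vector of `ℓ²(α)` at `x`. -/
def ket {α : Type*} (x : α) : Ell2 α := lp.single 2 x (1 : ℂ)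

open Classical in
theorem ket_apply {α : Type*} (x y : α) : ket x y = if y = x then 1 else 0 := by
  rw [ket, lp.single_apply]
  by_cases h : y = x
  · subst h; simp
  · simp [h]

/-- The matrix entries of a tensor product of operators are the products of the matrix entries. -/
theorem tensorOp_ket : ∀ {r : ℕ} {α β : Fin r → Type u} (A : ∀ i, Ell2 (α i) →L[ℂ] Ell2 (β i))
    (x : ∀ i, α i) (y : ∀ i, β i), tensorOp A (ket x) y = ∏ i, A i (ket (x i)) (y i) := by
  intro r
  induction r with
  | zero =>
    intro α β A x y
    change ket x _ = _
    rw [ket_apply]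
    simp [Subsingleton.elim _ x]
  | succ r ih =>
    intro α β A x y
    rw [Fin.prod_univ_succ, ← ih (fun i : Fin r => A i.succ) (fun i : Fin r => x i.succ) (fun i : Fin r => y i.succ)]
    change tensorOp (fun i : Fin r => A i.succ) (slice (reindex (Equiv.prodComm _ _)
      (ampl _ (A 0) (reindex (Fin.consEquiv α).symm (ket x)))) (y 0)) (Fin.tail y) = _
    have h : slice (reindex (Equiv.prodComm _ _)
        (ampl _ (A 0) (reindex (Fin.consEquiv α).symm (ket x)))) (y 0) =
        (A 0 (ket (x 0)) (y 0)) • ket (fun i : Fin r => x i.succ) := by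
      ext c
      change A 0 (slice (reindex (Fin.consEquiv α).symm (ket x)) c) (y 0) = _
      have h2 : slice (reindex (Fin.consEquiv α).symm (ket x)) c =
          (ket (fun i : Fin r => x i.succ) c) • ket (x 0) := by
        ext a
        change ket x (Fin.cons a c) = ket (fun i : Fin r => x i.succ) c * ket (x 0) a
        simp only [ket_apply]
        have h3 : ((Fin.cons a c : ∀ i, α i) = x) ↔ a = x 0 ∧ c = fun i : Fin r => x i.succ := by
          constructor
          · rintro rfl
            exact ⟨rfl, rfl⟩
          · rintro ⟨rfl, rfl⟩
            exact Fin.cons_self_tail x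
        rw [h3]
        by_cases ha : a = x 0 <;> by_cases hc : c = fun i : Fin r => x i.succ <;> simp [ha, hc]
      rw [h2, map_smul]
      change ket (fun i : Fin r => x i.succ) c * A 0 (ket (x 0)) (y 0) = _ * _
      ring
    rw [h, map_smul]
    rfl

/-- The operator that acts as `A` on the `i`-th tensor factor and trivially on the others. -/
def onPlayer {r : ℕ} {α : Fin r → Type u} (i : Fin r) (A : Ell2 (α i) →L[ℂ] Ell2 (α i)) :
    Ell2 (∀ j, α j) →L[ℂ] Ell2 (∀ j, α j) :=
  tensorOp (Function.update (fun _ => 1) i A)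

/-- The operator on `ℂ^α`, `α` finite, given by a matrix. -/
def matrixOp {α : Type*} [Fintype α] [DecidableEq α] (M : Matrix α α ℂ) :
    Ell2 α →L[ℂ] Ell2 α :=
  (lpPiLpₗᵢ (fun _ : α => ℂ) ℂ (p := 2)).symm.toLinearIsometry.toContinuousLinearMap ∘L
    Matrix.toEuclideanCLM (n := α) (𝕜 := ℂ) M ∘L
      (lpPiLpₗᵢ (fun _ : α => ℂ) ℂ (p := 2)).toLinearIsometry.toContinuousLinearMap

/-- The trace, computed in the standard basis. It is used for trace class operators only. -/
def trace {α : Type*} (T : Ell2 α →L[ℂ] Ell2 α) : ℂ := ∑' x, T (ket x) x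

/-- Density operators: positive operators with trace one. -/
def IsDensity {α : Type*} (ρ : Ell2 α →L[ℂ] Ell2 α) : Prop :=
  ρ.IsPositive ∧ HasSum (fun x => ρ (ket x) x) 1

/-- `tr_ρ(T) = tr(T ρ)`. -/
def trAt {α : Type*} (ρ T : Ell2 α →L[ℂ] Ell2 α) : ℂ := trace (T ∘L ρ)

/-! ### Reflections, measurements and their distances -/

/-- Reflections: self-adjoint operators that square to the identity. -/
def IsReflection {α : Type*} (R : Ell2 α →L[ℂ] Ell2 α) : Prop :=
  IsSelfAdjoint R ∧ R * R = 1

/-- The measurement operator `R^a = (1 + (-1)^a R) / 2` of a reflection. -/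
def effect {α : Type*} (R : Ell2 α →L[ℂ] Ell2 α) (a : ZMod 2) : Ell2 α →L[ℂ] Ell2 α :=
  (1 / 2 : ℂ) • (1 + ((-1 : ℂ) ^ a.val) • R)

/-- The distance of two-outcome measurements given by reflections,
`d_ρ(R₀, R₁) = [1 - Re tr_ρ(R₀ R₁)]^{1/2}` for operators `R₀`, `R₁` of player `i`. If `R₀ = R` is
a reflection and `R₁ = V† D V` with an isometry `V` and a reflection `D`, then the square of it is
half of the squared `ρ`-seminorm of `V R - D V`. -/
def distRefl {r : ℕ} {α : Fin r → Type u} (ρ : Ell2 (∀ j, α j) →L[ℂ] Ell2 (∀ j, α j))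
    (i : Fin r) (R₀ R₁ : Ell2 (α i) →L[ℂ] Ell2 (α i)) : ℝ :=
  √(1 - (trAt ρ (onPlayer i (R₀ * R₁))).re)

/-- `d_ρ(M₀, M₁) = [2 - 2 Re ∑ b, tr_ρ(M₀^b M₁^b)]^{1/2}` for two measurements of player `i`.
If `M₀ = M` is a projective measurement and `M₁^b = V† P^b V` with an isometry `V` and a projective
measurement `P`, then the square of it is the sum over `b` of the squared `ρ`-seminorms of
`V M^b - P^b V`. -/
def distMeas {r : ℕ} {α : Fin r → Type u} (ρ : Ell2 (∀ j, α j) →L[ℂ] Ell2 (∀ j, α j))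
    (i : Fin r) {B : Type*} [Fintype B] (M₀ M₁ : B → Ell2 (α i) →L[ℂ] Ell2 (α i)) : ℝ :=
  √(2 - 2 * (∑ b, trAt ρ (onPlayer i (M₀ b * M₁ b))).re)

/-- `V† T V`. -/
def pullback {α β : Type*} (V : Ell2 α →ₗᵢ[ℂ] Ell2 β) (T : Ell2 β →L[ℂ] Ell2 β) :
    Ell2 α →L[ℂ] Ell2 α :=
  ContinuousLinearMap.adjoint V.toContinuousLinearMap ∘L T ∘L V.toContinuousLinearMap

/-! ### Pauli operators and stabilizers -/

/-- Labels of the basis vectors of `m` qubits. -/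
abbrev Bits (m : ℕ) : Type := Fin m → Fin 2

inductive Pauli
  | I | X | Y | Z
  deriving DecidableEq

def Pauli.matrix : Pauli → Matrix (Fin 2) (Fin 2) ℂ
  | .I => 1
  | .X => !![0, 1; 1, 0]
  | .Y => !![0, -Complex.I; Complex.I, 0]
  | .Z => !![1, 0; 0, -1]

/-- The tensor product of one-qubit matrices, as a matrix on `m` qubits. -/
def qubitTensor {m : ℕ} (A : Fin m → Matrix (Fin 2) (Fin 2) ℂ) : Matrix (Bits m) (Bits m) ℂ :=
  fun x y => ∏ v, A v (x v) (y v)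

/-- The tensor product of Pauli operators. -/
def pauliString {m : ℕ} (P : Fin m → Pauli) : Matrix (Bits m) (Bits m) ℂ :=
  qubitTensor fun v => (P v).matrix

/-- The group of the operators `e^{iφ} ⨂ j, P j` with `φ` a multiple of `π/2`, as the group
generated by them. -/
def pauliGroup (r : ℕ) : Subgroup (Matrix (Bits r) (Bits r) ℂ)ˣ :=
  Subgroup.closure {U | ∃ (c : ℕ) (P : Fin r → Pauli),
    (U : Matrix (Bits r) (Bits r) ℂ) = Complex.I ^ c • pauliString P}

/-- A non-trivial `r`-qubit stabilizer: an abelian subgroup of the Pauli group that does not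
contain `-1`, with a finite set of generators `± ⨂ i, P i`, `P i ∈ {I, X, Z}`, and, for every
qubit `t`, a choice of a generator with `X` and of a generator with `Z` at the qubit `t`. -/
structure XZStabilizer (r : ℕ) where
  group : Subgroup (Matrix (Bits r) (Bits r) ℂ)ˣ
  le_pauliGroup : group ≤ pauliGroup r
  comm : ∀ U ∈ group, ∀ U' ∈ group, U * U' = U' * U
  neg_one_notMem : -1 ∉ group
  /-- the number of generators -/
  l : ℕ
  /-- the sign of the `j`-th generator is `(-1)^(sign j)` -/
  sign : Fin l → ZMod 2
  /-- the tensor factors of the `j`-th generator -/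
  pauli : Fin l → Fin r → Pauli
  xz_form : ∀ j i, pauli j i ≠ Pauli.Y
  gen_injective : Function.Injective fun j => (sign j, pauli j)
  closure_eq : Subgroup.closure {U : (Matrix (Bits r) (Bits r) ℂ)ˣ | ∃ j,
    (U : Matrix (Bits r) (Bits r) ℂ) = (-1 : ℂ) ^ (sign j).val • pauliString (pauli j)} = group
  /-- the chosen generator with `X` at the qubit `t` -/
  gX : Fin r → Fin l
  /-- the chosen generator with `Z` at the qubit `t` -/
  gZ : Fin r → Fin l
  gX_spec : ∀ t, pauli (gX t) t = Pauli.X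
  gZ_spec : ∀ t, pauli (gZ t) t = Pauli.Z

/-- The code space: the simultaneous `+1` eigenspace of the operators in the stabilizer. -/
def codeSpace {r : ℕ} (S : XZStabilizer r) : Submodule ℂ (EuclideanSpace ℂ (Bits r)) where
  carrier := {ψ | ∀ U ∈ S.group,
    Matrix.toEuclideanCLM (n := Bits r) (𝕜 := ℂ) (U : Matrix (Bits r) (Bits r) ℂ) ψ = ψ}
  add_mem' := fun ha hb U hU => by rw [map_add, ha U hU, hb U hU]
  zero_mem' := fun _ _ => map_zero _
  smul_mem' := fun c _ ha U hU => by rw [map_smul, ha U hU]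

/-- The matrix `Π` of the orthogonal projection onto the code space. -/
def codeProj {r : ℕ} (S : XZStabilizer r) : Matrix (Bits r) (Bits r) ℂ :=
  (Matrix.toEuclideanCLM (n := Bits r) (𝕜 := ℂ)).symm (codeSpace S).starProjection

/-- The matrix of `Π^{⊗ n}` on `r` players with `n` qubits each; the `t`-th factor `Π` acts on the
`t`-th qubits of the players. -/
def codeProjPow {r : ℕ} (S : XZStabilizer r) (n : ℕ) :
    Matrix (Fin r → Bits n) (Fin r → Bits n) ℂ :=
  fun x y => ∏ t, codeProj S (fun i => x i t) (fun i => y i t)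

/-- Collecting the qubits of the players. -/
def splitQubits {r : ℕ} (n : ℕ) (γ : Fin r → Type u) :
    (∀ i, Bits n × γ i) ≃ (Fin r → Bits n) × (∀ i, γ i) where
  toFun x := (fun i => (x i).1, fun i => (x i).2)
  invFun y := fun i => (y.1 i, y.2 i)
  left_inv _ := rfl
  right_inv _ := rfl

/-- The operator `Π^{⊗ n} ⊗ 1` on `⨂ i, (B^{⊗ n} ⊗ ℓ²(γ i))`. -/
def codeOp {r : ℕ} (S : XZStabilizer r) (n : ℕ) (γ : Fin r → Type u) :
    Ell2 (∀ i, Bits n × γ i) →L[ℂ] Ell2 (∀ i, Bits n × γ i) :=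
  reindex (splitQubits n γ).symm ∘L ampl (∀ i, γ i) (matrixOp (codeProjPow S n)) ∘L
    reindex (splitQubits n γ)

/-! ### The stabilizer game -/

/-- The rounds of the stabilizer game: a generator `j` for the first test; a special player `t`
and one of the four operators `h_1 = g_X`, `h_2` = `g_X` with `X` replaced by `Z` at the qubit `t`,
`h_3` = `g_Z` with `Z` replaced by `X` at the qubit `t`, `h_4 = -g_Z` (numbered from `0`) for the
second test. -/
abbrev Round {r : ℕ} (S : XZStabilizer r) : Type := Fin S.l ⊕ (Fin r × Fin 4)

/-- The two tests have equal probability, and everything in a test is uniform. -/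
def roundProb {r : ℕ} (S : XZStabilizer r) : Round S → ℝ
  | .inl _ => 1 / 2 * (1 / (S.l : ℝ))
  | .inr _ => 1 / 2 * (1 / (r : ℝ) * (1 / 4))

/-- The question for a tensor factor `I`, `X`, `Z`; `none` is the null question. -/
def ask : Pauli → Option (Fin 4)
  | .X => some 0
  | .Z => some 1
  | _ => none

/-- The generator that `h_j` comes from: `h_1`, `h_2` from `g_X`, and `h_3`, `h_4` from `g_Z`. -/
def specialGen {r : ℕ} (S : XZStabilizer r) (t : Fin r) (j : Fin 4) : Fin S.l :=
  ![S.gX t, S.gX t, S.gZ t, S.gZ t] j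

/-- The question of player `i` in a round. The factors of `h_1`, …, `h_4` at the special player
are `X`, `Z`, `X`, `Z`, and they are asked as `2`, `3`, `2`, `3`. -/
def query {r : ℕ} (S : XZStabilizer r) : Round S → Fin r → Option (Fin 4)
  | .inl j, i => ask (S.pauli j i)
  | .inr (t, j), i =>
      if i = t then some (![2, 3, 2, 3] j) else ask (S.pauli (specialGen S t j) i)

/-- The parity that is accepted in a round; `h_4 = -g_Z` has the flipped sign. -/
def parity {r : ℕ} (S : XZStabilizer r) : Round S → ZMod 2
  | .inl j => S.sign j
  | .inr (t, j) => S.sign (specialGen S t j) + ![0, 0, 0, 1] j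

/-- The verifier accepts the answers if those to the non-null questions have the right parity. -/
def Accepts {r : ℕ} (S : XZStabilizer r) (s : Round S) (a : Fin r → ZMod 2) : Prop :=
  (∑ i, if (query S s i).isSome then a i else 0) = parity S s

/-- A round together with the replacements `0` or `1` for possible null questions. -/
abbrev Sample {r : ℕ} (S : XZStabilizer r) : Type := Round S × (Fin r → Fin 2)

/-- A null question is replaced by `1` with probability `p` and by `0` otherwise. -/
def sampleProb {r : ℕ} (S : XZStabilizer r) (p : ℝ) (s : Sample S) : ℝ :=
  roundProb S s.1 * ∏ i, if s.2 i = 1 then p else 1 - p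

/-- The question `w_i` that player `i` sees. -/
def question {r : ℕ} (S : XZStabilizer r) (s : Sample S) (i : Fin r) : Fin 4 :=
  (query S s.1 i).getD (if s.2 i = 1 then 1 else 0)

/-- `ω*_S = (1 + (2 + √2) / 4) / 2`, the non-local value of the stabilizer game. -/
def omegaS : ℝ := (6 + √2) / 8

/-! ### The multi-qubit stabilizer game -/

/-- The subsets of the `n` qubits of size `k`. -/
abbrev KSubset (n k : ℕ) : Type := {J : Finset (Fin n) // J.card = k}

/-- A strategy for the `(k,n)`-stabilizer game with `r` players; `α i` indexes an orthonormal
basis of the space of player `i`. -/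
structure Strategy {r : ℕ} (k n : ℕ) (α : Fin r → Type u) where
  /-- the shared state -/
  ρ : Ell2 (∀ i, α i) →L[ℂ] Ell2 (∀ i, α i)
  isDensity : IsDensity ρ
  /-- the reflection of player `i` for the question `(u, w)` -/
  R : ∀ i : Fin r, Fin n × Fin 4 → (Ell2 (α i) →L[ℂ] Ell2 (α i))
  isReflection : ∀ i q, IsReflection (R i q)
  /-- the measurement operator with outcome `b` of player `i` for the question
  `((v, w v))_{v ∈ J}` -/
  M : ∀ (i : Fin r) (J : KSubset n k), (J.1 → Fin 4) → (J.1 → ZMod 2) →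
    (Ell2 (α i) →L[ℂ] Ell2 (α i))
  isProj : ∀ i J w b, IsStarProjection (M i J w b)
  sum_M : ∀ i J w, ∑ b, M i J w b = 1

open Classical in
/-- The probability of acceptance in the first test. The player `t` gets the questions for all the
qubits of `J`, and her answer `b` counts through its bit `b u`. -/
def multiTest {r k n : ℕ} {α : Fin r → Type u} (S : XZStabilizer r) (p : ℝ)
    (s : Strategy k n α) : ℝ :=
  𝔼 J : KSubset n k, 𝔼 u : J.1, 𝔼 t : Fin r, ∑ σ : J.1 → Sample S,
    (∏ v, sampleProb S p (σ v)) *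
      ∑ a : Fin r → ZMod 2, ∑ b : J.1 → ZMod 2,
        if b u = a t ∧ Accepts S (σ u).1 a then
          (trAt s.ρ (tensorOp fun i =>
            if i = t then s.M i J (fun v => question S (σ v) i) b
            else effect (s.R i (u, question S (σ u) i)) (a i))).re
        else 0

open Classical in
/-- The probability of acceptance in the second test, the stabilizer game on a random qubit. -/
def singleTest {r k n : ℕ} {α : Fin r → Type u} (S : XZStabilizer r) (p : ℝ)
    (s : Strategy k n α) : ℝ :=
  𝔼 u : Fin n, ∑ σ : Sample S, sampleProb S p σ *
    ∑ a : Fin r → ZMod 2,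
      if Accepts S σ.1 a then
        (trAt s.ρ (tensorOp fun i => effect (s.R i (u, question S σ i)) (a i))).re
      else 0

/-- The value of a strategy for the `(k,n)`-stabilizer game. -/
def value {r k n : ℕ} {α : Fin r → Type u} (S : XZStabilizer r) (p : ℝ)
    (s : Strategy k n α) : ℝ :=
  1 / 2 * multiTest S p s + 1 / 2 * singleTest S p s

/-! ### Honest measurements -/

/-- `X`, `Z` for `w = 0, 1`. -/
def honestPauli (w : Fin 2) : Pauli := if w = 0 then .X else .Z

/-- The operator `D_q ⊗ 1` on `B^{⊗ n} ⊗ ℓ²(γ)` for `q = (u, w)`: `X` or `Z` on qubit `u`. -/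
def honestRefl (n : ℕ) (γ : Type*) (q : Fin n × Fin 2) :
    Ell2 (Bits n × γ) →L[ℂ] Ell2 (Bits n × γ) :=
  ampl γ (matrixOp (pauliString (Function.update (fun _ => Pauli.I) q.1 (honestPauli q.2))))

/-- The joint measurement of the commuting reflections `D_{(v, w v)}`, `v ∈ J`, on
`B^{⊗ n} ⊗ ℓ²(γ)`: the operator of the outcome `b` is the product over `v ∈ J` of the projections
`(1 + (-1)^{b v} D_{(v, w v)}) / 2`. -/
def honestMeas (n : ℕ) (γ : Type*) (J : Finset (Fin n)) (w : J → Fin 2) (b : J → ZMod 2) :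
    Ell2 (Bits n × γ) →L[ℂ] Ell2 (Bits n × γ) :=
  ampl γ (matrixOp (qubitTensor fun v =>
    if h : v ∈ J then
      (1 / 2 : ℂ) • (1 + (-1 : ℂ) ^ (b ⟨v, h⟩).val • (honestPauli (w ⟨v, h⟩)).matrix)
    else 1))

end

end StabilizerGame

namespace StabilizerGame

open scoped ComplexConjugate InnerProductSpace

noncomputable section

/-! ### Operators and their matrix entries -/

section Entries

variable {α β γ δ : Type*}

/-! A density operator is replaced by a unit vector `Ψ`, its purification, so that every trace
becomes an inner product and every approximate identity a norm estimate on `Ψ`.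

Rigidity of the one-qubit game. For a strategy by reflections, `omegaS` minus its value is exactly a
weighted sum of deficits: `1 - corr` for each generator, and `2√2` minus a CHSH expression for each
player (`omegaS_sub_gameValue`). The first kind is nonnegative because all operators are
contractions, the second by the sum of squares `chsh_sos`. Near-optimality thus makes every deficit
small. A small generator deficit says that player `t`'s `X` or `Z` acts on `Ψ` like the other
players' part of a generator (`stDist_shadow_le`). A small CHSH deficit says that these parts act
like `(B ± C)/√2` for reflections `B`, `C` of player `t`. Since `B + C` and `B - C` anticommute
exactly, `X` and `Z` anticommute approximately on `Ψ` (`stDist_anti_of_chsh`).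

Many qubits. Undoing the averages over `J`, `u`, `t` and the questions costs only a factor
polynomial in `n`, so every single-qubit strategy and every strategy with one answer bit of a joint
measurement is near-optimal. The answer bits of one projective measurement commute exactly, and each
agrees on `Ψ` with the same operator of the other players as the single-qubit reflection. Hence
reflections for different qubits commute approximately. Agreement with an operator elsewhere
(`Movable`) is also what allows a relation valid on `Ψ` to be multiplied on the right.

The isometry. For `c` in `(𝔽₂²)ⁿ` let `P_c` be the ordered product of the `Z^b X^a`, and let `φ_c`
be the product of Bell states with the same exponents. The isometry is the normalized sum of `φ_c ⊗
P_c`. Multiplying `P_c` on the right by Pauli letters changes `c` by the same shift and sign as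
letting them act on `φ_c`, except that for `P_c` this is only approximate and costs `O(n³)`
elementary errors (`ApproxPauli.word_shift`). So `tr_ρ(W V†DV)`, with `W` the strategy's version of
`D`, averages terms close to `1` (`NearOptimal.re_trAt_letters`). Single letters give the claim on
reflections; expanding the honest projections in characters gives the claim on measurements. For the
code space, the generators on the extracted qubits are compared player by player with the measured
reflections, which pass the generator test; a vector nearly fixed by all generators is nearly in the
code space (`code_deficit`). -/

theorem inner_ket_left (x : α) (f : Ell2 α) : inner ℂ (ket x) f = f x := by
  classical
  have h := lp.inner_single_left (𝕜 := ℂ) (G := fun _ : α => ℂ) x (1 : ℂ) f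
  rw [ket]
  convert h using 1
  simp

theorem inner_ket_right (x : α) (f : Ell2 α) : inner ℂ f (ket x) = conj (f x) := by
  rw [← inner_conj_symm, inner_ket_left]

theorem hasSum_ket (f : Ell2 α) : HasSum (fun x => f x • ket x) f := by
  classical
  have h := lp.hasSum_single (E := fun _ : α => ℂ) (p := 2) (by norm_num) f
  refine h.congr_fun fun x => ?_
  ext y
  change f x * ket x y = _
  rw [ket_apply, lp.single_apply]
  by_cases hxy : y = x
  · subst hxy; simp
  · simp [hxy]

/-- Bounded operators are determined by their matrix entries. -/
theorem ext_entries {A B : Ell2 α →L[ℂ] Ell2 β} (h : ∀ x y, A (ket x) y = B (ket x) y) :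
    A = B := by
  ext1 f
  have hA := (hasSum_ket f).mapL A
  have hB := (hasSum_ket f).mapL B
  have hk : ∀ x, A (ket x) = B (ket x) := fun x => by
    ext y
    exact h x y
  simp only [map_smul, hk] at hA hB
  exact hA.unique hB

theorem adjoint_ket_apply (A : Ell2 α →L[ℂ] Ell2 β) (x : β) (y : α) :
    ContinuousLinearMap.adjoint A (ket x) y = conj (A (ket y) x) := by
  rw [← inner_ket_left, ContinuousLinearMap.adjoint_inner_right, inner_ket_right]

theorem reindex_apply (e : α ≃ β) (f : Ell2 α) (b : β) : reindex e f b = f (e.symm b) := rfl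

theorem reindex_ket (e : α ≃ β) (x : α) : reindex e (ket x) = ket (e x) := by
  ext b
  rw [reindex_apply, ket_apply, ket_apply]
  congr 1
  exact propext e.symm_apply_eq

theorem reindex_symm_comp (e : α ≃ β) : reindex e.symm ∘L reindex e = 1 := by
  ext f a
  simp [reindex_apply]

theorem reindex_comp_symm (e : α ≃ β) : reindex e ∘L reindex e.symm = 1 :=
  reindex_symm_comp e.symm

theorem adjoint_reindex (e : α ≃ β) :
    ContinuousLinearMap.adjoint (reindex e) = reindex e.symm := by
  classical
  refine ext_entries fun x y => ?_
  rw [adjoint_ket_apply, reindex_ket, reindex_ket, ket_apply, ket_apply]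
  simp only [Equiv.eq_symm_apply, eq_comm (a := x)]
  split_ifs <;> simp

theorem norm_reindex_le (e : α ≃ β) : ‖reindex e‖ ≤ 1 :=
  LinearMap.mkContinuous_norm_le _ zero_le_one _

theorem ampl_apply (A : Ell2 α →L[ℂ] Ell2 β) (f : Ell2 (α × γ)) (x : β × γ) :
    ampl γ A f x = A (slice f x.2) x.1 := rfl

open Classical in
theorem slice_ket (x : α × γ) (c : γ) :
    slice (ket x) c = if c = x.2 then ket x.1 else 0 := by
  ext a
  change ket x (a, c) = _
  rw [ket_apply, Prod.ext_iff]
  split_ifs with h1 h2 h2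
  · rw [ket_apply, if_pos h1.1]
  · exact absurd h1.2 h2
  · rw [ket_apply, if_neg fun h => h1 ⟨h, h2⟩]
  · rfl

open Classical in
theorem ampl_ket (A : Ell2 α →L[ℂ] Ell2 β) (x : α × γ) (y : β × γ) :
    ampl γ A (ket x) y = A (ket x.1) y.1 * if y.2 = x.2 then 1 else 0 := by
  rw [ampl_apply, slice_ket]
  split_ifs <;> simp

theorem norm_ampl_le (A : Ell2 α →L[ℂ] Ell2 β) : ‖ampl γ A‖ ≤ ‖A‖ :=
  LinearMap.mkContinuous_norm_le _ (norm_nonneg _) _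

theorem ampl_comp (A : Ell2 β →L[ℂ] Ell2 δ) (B : Ell2 α →L[ℂ] Ell2 β) :
    ampl γ (A ∘L B) = ampl γ A ∘L ampl γ B := rfl

theorem ampl_one : ampl γ (1 : Ell2 α →L[ℂ] Ell2 α) = 1 := rfl

theorem adjoint_ampl (A : Ell2 α →L[ℂ] Ell2 β) :
    ContinuousLinearMap.adjoint (ampl γ A) = ampl γ (ContinuousLinearMap.adjoint A) := by
  classical
  refine ext_entries fun x y => ?_
  rw [adjoint_ket_apply, ampl_ket, ampl_ket, adjoint_ket_apply, map_mul]
  simp only [eq_comm (a := y.2)]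
  split_ifs <;> simp

/-- `A ↦ A ⊗ 1` as a homomorphism. -/
def amplHom (α γ : Type*) :
    (Ell2 α →L[ℂ] Ell2 α) →⋆ₐ[ℂ] (Ell2 (α × γ) →L[ℂ] Ell2 (α × γ)) where
  toFun := ampl γ
  map_one' := rfl
  map_mul' _ _ := rfl
  map_zero' := rfl
  map_add' _ _ := rfl
  commutes' _ := rfl
  map_star' A := (adjoint_ampl A).symm

theorem amplHom_apply (A : Ell2 α →L[ℂ] Ell2 α) : amplHom α γ A = ampl γ A := rfl

open Classical in
theorem swap_ampl_ket (B : Ell2 γ →L[ℂ] Ell2 δ) (x : α × γ) (y : α × δ) :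
    (reindex (Equiv.prodComm δ α) ∘L ampl α B ∘L reindex (Equiv.prodComm α γ)) (ket x) y =
      B (ket x.2) y.2 * if y.1 = x.1 then 1 else 0 := by
  simp only [ContinuousLinearMap.comp_apply, reindex_apply, reindex_ket, ampl_ket]
  rfl

/-- Operators on different tensor factors commute. On a basis vector both slices involved are scalar
multiples of basis vectors, so both orders give the product of the two matrix entries. -/
theorem ampl_swap_comm (A : Ell2 α →L[ℂ] Ell2 β) (B : Ell2 γ →L[ℂ] Ell2 δ) :
    ampl δ A ∘L (reindex (Equiv.prodComm δ α) ∘L ampl α B ∘L reindex (Equiv.prodComm α γ)) =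
      (reindex (Equiv.prodComm δ β) ∘L ampl β B ∘L reindex (Equiv.prodComm β γ)) ∘L ampl γ A := by
  classical
  refine ext_entries fun x y => ?_
  have h1 : slice ((reindex (Equiv.prodComm δ α) ∘L ampl α B ∘L reindex (Equiv.prodComm α γ))
      (ket x)) y.2 = B (ket x.2) y.2 • ket x.1 := by
    ext a
    change (reindex (Equiv.prodComm δ α) ∘L ampl α B ∘L reindex (Equiv.prodComm α γ))
      (ket x) (a, y.2) = B (ket x.2) y.2 * ket x.1 a
    rw [swap_ampl_ket, ket_apply x.1]
  have h2 : slice (reindex (Equiv.prodComm β γ) (ampl γ A (ket x))) y.1 =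
      A (ket x.1) y.1 • ket x.2 := by
    ext c
    change ampl γ A (ket x) (y.1, c) = A (ket x.1) y.1 * ket x.2 c
    rw [ampl_ket, ket_apply x.2]
  change A (slice ((reindex (Equiv.prodComm δ α) ∘L ampl α B ∘L reindex (Equiv.prodComm α γ))
      (ket x)) y.2) y.1 = B (slice (reindex (Equiv.prodComm β γ) (ampl γ A (ket x))) y.1) y.2
  rw [h1, h2, map_smul, map_smul]
  exact mul_comm _ _

theorem tensorPair_comp {α' γ' : Type*} (A : Ell2 α →L[ℂ] Ell2 β) (B : Ell2 γ →L[ℂ] Ell2 δ)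
    (A' : Ell2 α' →L[ℂ] Ell2 α) (B' : Ell2 γ' →L[ℂ] Ell2 γ) :
    tensorPair (A ∘L A') (B ∘L B') = tensorPair A B ∘L tensorPair A' B' := by
  have h := ampl_swap_comm A B'
  calc tensorPair (A ∘L A') (B ∘L B')
      = (reindex (Equiv.prodComm δ β) ∘L ampl β B ∘L reindex (Equiv.prodComm β γ)) ∘L
        ((reindex (Equiv.prodComm γ β) ∘L ampl β B' ∘L reindex (Equiv.prodComm β γ')) ∘L
          ampl γ' A) ∘L ampl γ' A' := rfl
    _ = _ := by rw [← h]; rfl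

theorem norm_comp_le_mul {E F G : Type*} [NormedAddCommGroup E] [NormedSpace ℂ E]
    [NormedAddCommGroup F] [NormedSpace ℂ F] [NormedAddCommGroup G] [NormedSpace ℂ G]
    {A : F →L[ℂ] G} {B : E →L[ℂ] F} {a b : ℝ} (hA : ‖A‖ ≤ a) (hB : ‖B‖ ≤ b) :
    ‖A ∘L B‖ ≤ a * b :=
  (A.opNorm_comp_le B).trans (mul_le_mul hA hB (norm_nonneg _) ((norm_nonneg _).trans hA))

theorem norm_tensorPair_le {A : Ell2 α →L[ℂ] Ell2 β} {B : Ell2 γ →L[ℂ] Ell2 δ}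
    (hA : ‖A‖ ≤ 1) (hB : ‖B‖ ≤ 1) : ‖tensorPair A B‖ ≤ 1 := by
  have h := norm_comp_le_mul (norm_reindex_le (Equiv.prodComm δ β))
    (norm_comp_le_mul ((norm_ampl_le (γ := β) B).trans hB)
    (norm_comp_le_mul (norm_reindex_le (Equiv.prodComm β γ)) ((norm_ampl_le (γ := γ) A).trans hA)))
  exact h.trans (by norm_num)

end Entries

/-! ### Functoriality, norms and multilinearity of tensor products of operators -/

section TensorOp

variable {r : ℕ} {α β γ : Fin r → Type u}

theorem tensorOp_comp : ∀ {r : ℕ} {α β γ : Fin r → Type u} (A : ∀ i, Ell2 (β i) →L[ℂ] Ell2 (γ i))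
    (B : ∀ i, Ell2 (α i) →L[ℂ] Ell2 (β i)),
    tensorOp (fun i => A i ∘L B i) = tensorOp A ∘L tensorOp B := by
  intro r
  induction r with
  | zero => intros; rfl
  | succ r ih =>
    intro α β γ A B
    calc tensorOp (fun i => A i ∘L B i)
        = reindex (Fin.consEquiv γ) ∘L tensorPair (A 0 ∘L B 0)
          (tensorOp fun i : Fin r => A i.succ ∘L B i.succ) ∘L
            reindex (Fin.consEquiv α).symm := rfl
      _ = reindex (Fin.consEquiv γ) ∘L (tensorPair (A 0) (tensorOp fun i : Fin r => A i.succ) ∘L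
          (reindex (Fin.consEquiv β).symm ∘L reindex (Fin.consEquiv β)) ∘L
          tensorPair (B 0) (tensorOp fun i : Fin r => B i.succ)) ∘L
            reindex (Fin.consEquiv α).symm := by
          rw [ih, tensorPair_comp, reindex_symm_comp]
          rfl
      _ = _ := rfl

theorem tensorOp_one : tensorOp (fun i => (1 : Ell2 (α i) →L[ℂ] Ell2 (α i))) = 1 := by
  classical
  refine ext_entries fun x y => ?_
  rw [tensorOp_ket]
  simp only [one_apply_eq_self, ket_apply, Finset.prod_ite_zero, funext_iff]
  simp

theorem tensorOp_mul (A B : ∀ i, Ell2 (α i) →L[ℂ] Ell2 (α i)) :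
    tensorOp (fun i => A i * B i) = tensorOp A * tensorOp B :=
  tensorOp_comp A B

theorem adjoint_tensorOp (A : ∀ i, Ell2 (α i) →L[ℂ] Ell2 (β i)) :
    ContinuousLinearMap.adjoint (tensorOp A) =
      tensorOp fun i => ContinuousLinearMap.adjoint (A i) := by
  refine ext_entries fun x y => ?_
  simp only [adjoint_ket_apply, tensorOp_ket, map_prod]

theorem norm_tensorOp_le : ∀ {r : ℕ} {α β : Fin r → Type u}
    (A : ∀ i, Ell2 (α i) →L[ℂ] Ell2 (β i)), (∀ i, ‖A i‖ ≤ 1) → ‖tensorOp A‖ ≤ 1 := by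
  intro r
  induction r with
  | zero =>
    intro α β A _
    exact norm_reindex_le _
  | succ r ih =>
    intro α β A hA
    have h := norm_comp_le_mul (norm_reindex_le (Fin.consEquiv β))
      (norm_comp_le_mul (norm_tensorPair_le (hA 0) (ih (fun i : Fin r => A i.succ)
        fun i => hA i.succ)) (norm_reindex_le (Fin.consEquiv α).symm))
    exact h.trans (by norm_num)

/-- Multilinearity of the tensor product. -/
theorem tensorOp_sum {B : Type*} [Fintype B] (c : Fin r → B → ℂ)
    (A : ∀ i, B → (Ell2 (α i) →L[ℂ] Ell2 (β i))) :
    tensorOp (fun i => ∑ b, c i b • A i b) =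
      ∑ a : Fin r → B, (∏ i, c i (a i)) • tensorOp fun i => A i (a i) := by
  classical
  refine ext_entries fun x y => ?_
  rw [tensorOp_ket]
  have h1 : ∀ (γ δ : Type u) (s : Finset B) (F : B → Ell2 γ →L[ℂ] Ell2 δ) (f : Ell2 γ) (d : δ),
      (∑ b ∈ s, F b) f d = ∑ b ∈ s, F b f d := by
    intro γ δ s F f d
    induction s using Finset.induction_on with
    | empty => simp
    | insert b s hb ih => rw [Finset.sum_insert hb, Finset.sum_insert hb, ← ih]; rfl
  have h2 : ∀ (s : Finset (Fin r → B)) (F : (Fin r → B) → Ell2 (∀ i, α i) →L[ℂ] Ell2 (∀ i, β i)),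
      (∑ b ∈ s, F b) (ket x) y = ∑ b ∈ s, F b (ket x) y := by
    intro s F
    induction s using Finset.induction_on with
    | empty => simp
    | insert b s hb ih => rw [Finset.sum_insert hb, Finset.sum_insert hb, ← ih]; rfl
  rw [h2]
  simp only [h1]
  rw [Finset.prod_univ_sum, Fintype.piFinset_univ]
  refine Finset.sum_congr rfl fun a _ => ?_
  change ∏ i, (c i (a i) * A i (a i) (ket (x i)) (y i)) =
    (∏ i, c i (a i)) * tensorOp (fun i => A i (a i)) (ket x) y
  rw [tensorOp_ket, Finset.prod_mul_distrib]

theorem tensorOp_update_mul (A : ∀ i, Ell2 (α i) →L[ℂ] Ell2 (α i)) (i : Fin r) :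
    tensorOp A = tensorOp (Function.update A i 1) * onPlayer i (A i) := by
  rw [onPlayer, ← tensorOp_mul]
  congr 1
  funext j
  by_cases h : j = i
  · subst h; simp
  · simp [h]

theorem tensorOp_update_comm (A : ∀ i, Ell2 (α i) →L[ℂ] Ell2 (α i)) (i : Fin r)
    (T : Ell2 (α i) →L[ℂ] Ell2 (α i)) :
    Commute (tensorOp (Function.update A i 1)) (onPlayer i T) := by
  rw [commute_iff_eq, onPlayer, ← tensorOp_mul, ← tensorOp_mul]
  congr 1
  funext j
  by_cases h : j = i
  · subst h; simp
  · simp [h]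

/-- `T ↦ onPlayer i T` as a homomorphism. -/
def onPlayerHom (α : Fin r → Type u) (i : Fin r) :
    (Ell2 (α i) →L[ℂ] Ell2 (α i)) →⋆ₐ[ℂ]
      (Ell2 (∀ j, α j) →L[ℂ] Ell2 (∀ j, α j)) where
  toFun := onPlayer i
  map_one' := by
    rw [onPlayer, Function.update_eq_self_iff.2 rfl, tensorOp_one]
  map_mul' A B := by
    rw [onPlayer, onPlayer, onPlayer, ← tensorOp_mul]
    congr 1
    funext j
    by_cases h : j = i
    · subst h; simp
    · simp [h]
  map_zero' := by
    refine ext_entries fun x y => ?_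
    rw [onPlayer, tensorOp_ket, Finset.prod_eq_zero (Finset.mem_univ i)]
    · rfl
    · simp
  map_add' A B := by
    refine ext_entries fun x y => ?_
    change _ = onPlayer i A (ket x) y + onPlayer i B (ket x) y
    simp only [onPlayer, tensorOp_ket]
    rw [Fintype.prod_eq_mul_prod_compl i, Fintype.prod_eq_mul_prod_compl i,
      Fintype.prod_eq_mul_prod_compl i]
    have h : ∀ C : Ell2 (α i) →L[ℂ] Ell2 (α i), ∏ j ∈ {i}ᶜ,
        (Function.update (fun j => (1 : Ell2 (α j) →L[ℂ] Ell2 (α j))) i C j) (ket (x j)) (y j) =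
        ∏ j ∈ {i}ᶜ, (ket (x j) : Ell2 (α j)) (y j) := fun C =>
      Finset.prod_congr rfl fun j hj => by
        rw [Function.update_of_ne (by simpa using hj)]; rfl
    rw [h, h, h, ← add_mul]
    simp
  commutes' c := by
    refine ext_entries fun x y => ?_
    change _ = c • (ket x : Ell2 (∀ j, α j)) y
    have h1 : (ket x : Ell2 (∀ j, α j)) y = ∏ j, (ket (x j) : Ell2 (α j)) (y j) := by
      have := tensorOp_ket (fun j => (1 : Ell2 (α j) →L[ℂ] Ell2 (α j))) x y
      rw [tensorOp_one] at this
      exact this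
    rw [onPlayer, tensorOp_ket, h1, Fintype.prod_eq_mul_prod_compl i,
      Fintype.prod_eq_mul_prod_compl i]
    have h : ∏ j ∈ {i}ᶜ, (Function.update (fun j => (1 : Ell2 (α j) →L[ℂ] Ell2 (α j))) i
        (algebraMap ℂ _ c) j) (ket (x j)) (y j) =
        ∏ j ∈ {i}ᶜ, (ket (x j) : Ell2 (α j)) (y j) :=
      Finset.prod_congr rfl fun j hj => by
        rw [Function.update_of_ne (by simpa using hj)]; rfl
    rw [h, Function.update_self]
    exact mul_assoc _ _ _
  map_star' A := by
    change _ = ContinuousLinearMap.adjoint _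
    rw [onPlayer, onPlayer, adjoint_tensorOp]
    congr 1
    funext j
    by_cases h : j = i
    · subst h; simp [ContinuousLinearMap.star_eq_adjoint]
    · simp [h, ← ContinuousLinearMap.star_eq_adjoint]

theorem onPlayerHom_apply (i : Fin r) (T : Ell2 (α i) →L[ℂ] Ell2 (α i)) :
    onPlayerHom α i T = onPlayer i T := rfl

end TensorOp

/-! ### Purification of density operators -/

section Purification

variable {α β : Type*} {ρ : Ell2 α →L[ℂ] Ell2 α}

/-- A positive operator is the square of a self-adjoint operator. -/
theorem exists_sqrt_of_isPositive {H : Type*} [NormedAddCommGroup H] [InnerProductSpace ℂ H]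
    [CompleteSpace H] {T : H →L[ℂ] H} (h : T.IsPositive) :
    ∃ Q : H →L[ℂ] H, IsSelfAdjoint Q ∧ Q ∘L Q = T := by
  have h0 : 0 ≤ T := (ContinuousLinearMap.nonneg_iff_isPositive T).2 h
  exact ⟨CFC.sqrt T, (CFC.sqrt_nonneg T).isSelfAdjoint, CFC.sqrt_mul_sqrt_self T h0⟩

theorem IsDensity.exists_sqrt (h : IsDensity ρ) :
    ∃ Q : Ell2 α →L[ℂ] Ell2 α, IsSelfAdjoint Q ∧ Q ∘L Q = ρ :=
  exists_sqrt_of_isPositive h.1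

/-- The square root of a density operator. -/
def sqrtDensity (h : IsDensity ρ) : Ell2 α →L[ℂ] Ell2 α := h.exists_sqrt.choose

theorem adjoint_sqrtDensity (h : IsDensity ρ) :
    ContinuousLinearMap.adjoint (sqrtDensity h) = sqrtDensity h :=
  h.exists_sqrt.choose_spec.1

theorem sqrtDensity_comp (h : IsDensity ρ) : sqrtDensity h ∘L sqrtDensity h = ρ :=
  h.exists_sqrt.choose_spec.2

theorem hasSum_sqrtDensity (h : IsDensity ρ) :
    HasSum (fun x => ‖sqrtDensity h (ket x)‖ ^ 2) 1 := by
  have h1 := Complex.hasSum_re h.2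
  refine h1.congr_fun fun x => ?_
  rw [← inner_ket_left, ← congrArg (fun T => T (ket x)) (sqrtDensity_comp h)]
  change _ = (inner ℂ (ket x) (sqrtDensity h (sqrtDensity h (ket x)))).re
  rw [← ContinuousLinearMap.adjoint_inner_left, adjoint_sqrtDensity]
  exact (inner_self_eq_norm_sq (𝕜 := ℂ) _).symm

/-- A purification of a density operator. -/
def purify (h : IsDensity ρ) : Ell2 (α × α) :=
  ⟨fun x => sqrtDensity h (ket x.2) x.1, (memℓp_two_iff _).2 (by
    rw [← (Equiv.prodComm α α).summable_iff]
    refine (summable_prod_of_nonneg fun _ => sq_nonneg _).2 ⟨fun y => ?_, ?_⟩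
    · exact Ell2.summable (sqrtDensity h (ket y))
    · refine (hasSum_sqrtDensity h).summable.congr fun y => ?_
      rw [Ell2.norm_sq]
      rfl)⟩

theorem slice_purify (h : IsDensity ρ) (y : α) : slice (purify h) y = sqrtDensity h (ket y) := rfl

theorem norm_purify (h : IsDensity ρ) : ‖purify h‖ = 1 := by
  have h1 := tsum_slice (purify h)
  simp only [slice_purify, (hasSum_sqrtDensity h).tsum_eq] at h1
  nlinarith [norm_nonneg (purify h)]

/-- Traces against a density operator are inner products in the purification. -/
theorem trace_density (h : IsDensity ρ) (S W : Ell2 α →L[ℂ] Ell2 β) :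
    trace (S ∘L ρ ∘L ContinuousLinearMap.adjoint W) =
      inner ℂ (ampl α W (purify h)) (ampl α S (purify h)) := by
  have hs := lp.summable_inner (𝕜 := ℂ) (ampl α W (purify h)) (ampl α S (purify h))
  rw [lp.inner_eq_tsum, hs.tsum_prod, trace]
  refine tsum_congr fun x => ?_
  rw [← inner_ket_left]
  change inner ℂ (ket x) (S (ρ (ContinuousLinearMap.adjoint W (ket x)))) = _
  rw [← ContinuousLinearMap.adjoint_inner_left,
    ← congrArg (fun T => T (ContinuousLinearMap.adjoint W (ket x))) (sqrtDensity_comp h)]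
  change inner ℂ _ (sqrtDensity h (sqrtDensity h _)) = _
  rw [← ContinuousLinearMap.adjoint_inner_left, adjoint_sqrtDensity, lp.inner_eq_tsum]
  refine tsum_congr fun y => ?_
  have key : ∀ T : Ell2 α →L[ℂ] Ell2 β,
      sqrtDensity h (ContinuousLinearMap.adjoint T (ket x)) y =
        conj (ampl α T (purify h) (x, y)) := by
    intro T
    rw [← inner_ket_left, ← ContinuousLinearMap.adjoint_inner_left, adjoint_sqrtDensity,
      ContinuousLinearMap.adjoint_inner_right, inner_ket_right]
    rfl
  rw [key, key]
  simp only [RCLike.inner_apply, Complex.conj_conj]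
  exact mul_comm _ _

/-- This is the passage from states to vectors: from here on traces against `ρ` are treated as inner
products at `purify h`. -/
theorem trAt_eq (h : IsDensity ρ) (T : Ell2 α →L[ℂ] Ell2 α) :
    trAt ρ T = inner ℂ (purify h) (ampl α T (purify h)) := by
  have h1 := trace_density h T 1
  rw [← ContinuousLinearMap.star_eq_adjoint, star_one] at h1
  exact h1

end Purification

/-! ### Approximate Pauli relations on a state -/

section Words

variable {K : Type*} [NormedAddCommGroup K] [NormedSpace ℂ K] {Ψ : K} {δ Δ : ℝ}

/-- The distance of two operators on the vector `Ψ`. -/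
def stDist (Ψ : K) (A B : K →L[ℂ] K) : ℝ := ‖A Ψ - B Ψ‖

theorem stDist_nonneg (A B : K →L[ℂ] K) : 0 ≤ stDist Ψ A B := norm_nonneg _

theorem stDist_self (A : K →L[ℂ] K) : stDist Ψ A A = 0 := by simp [stDist]

theorem stDist_comm (A B : K →L[ℂ] K) : stDist Ψ A B = stDist Ψ B A := norm_sub_rev _ _

theorem stDist_triangle (A B C : K →L[ℂ] K) : stDist Ψ A C ≤ stDist Ψ A B + stDist Ψ B C :=
  norm_sub_le_norm_sub_add_norm_sub _ _ _

theorem stDist_mul_left {U : K →L[ℂ] K} (hU : ‖U‖ ≤ 1) (A B : K →L[ℂ] K) :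
    stDist Ψ (U * A) (U * B) ≤ stDist Ψ A B := by
  have h := U.le_of_opNorm_le hU (A Ψ - B Ψ)
  rwa [map_sub, one_mul] at h

theorem stDist_smul {s : ℂ} (hs : ‖s‖ = 1) (A B : K →L[ℂ] K) :
    stDist Ψ (s • A) (s • B) = stDist Ψ A B := by
  change ‖s • A Ψ - s • B Ψ‖ = _
  rw [← smul_sub, norm_smul, hs, one_mul]
  rfl

/-- On `Ψ` the operator `g` acts up to `δ` like a contraction that commutes with `𝒜`. -/
def Movable (Ψ : K) (𝒜 : Submonoid (K →L[ℂ] K)) (δ : ℝ) (g : K →L[ℂ] K) : Prop :=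
  ∃ T : K →L[ℂ] K, ‖T‖ ≤ 1 ∧ (∀ A ∈ 𝒜, Commute T A) ∧ stDist Ψ g T ≤ δ

variable {𝒜 : Submonoid (K →L[ℂ] K)}

/-- Relations known only on `Ψ` survive left multiplication by contractions but not right
multiplication in general. When `g` is movable, `g Ψ` is replaced by `T Ψ`, and `T` commutes past
`A` and `B` to the outside, where it is harmless. The replacement happens twice, hence `2 * δ`. -/
theorem stDist_mul_right (h𝒜 : ∀ A ∈ 𝒜, ‖A‖ ≤ 1) {g A B : K →L[ℂ] K} (hg : Movable Ψ 𝒜 δ g)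
    (hA : A ∈ 𝒜) (hB : B ∈ 𝒜) : stDist Ψ (A * g) (B * g) ≤ stDist Ψ A B + 2 * δ := by
  obtain ⟨T, hT, hcomm, hd⟩ := hg
  have hA' : A (T Ψ) = T (A Ψ) := (congrArg (fun S => S Ψ) (hcomm A hA)).symm
  have hB' : B (T Ψ) = T (B Ψ) := (congrArg (fun S => S Ψ) (hcomm B hB)).symm
  have h1 : (A * g) Ψ - (B * g) Ψ = A (g Ψ - T Ψ) + T (A Ψ - B Ψ) - B (g Ψ - T Ψ) := by
    simp only [map_sub, hA', hB']
    change A (g Ψ) - B (g Ψ) = _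
    abel
  have h2 := A.le_of_opNorm_le (h𝒜 A hA) (g Ψ - T Ψ)
  have h3 := B.le_of_opNorm_le (h𝒜 B hB) (g Ψ - T Ψ)
  have h4 := T.le_of_opNorm_le hT (A Ψ - B Ψ)
  rw [one_mul] at h2 h3 h4
  rw [stDist, h1]
  refine (norm_sub_le _ _).trans ?_
  have h5 := norm_add_le (A (g Ψ - T Ψ)) (T (A Ψ - B Ψ))
  simp only [stDist] at hd ⊢
  linarith

theorem Movable.one (hδ : 0 ≤ δ) : Movable Ψ 𝒜 δ 1 :=
  ⟨1, ContinuousLinearMap.norm_id_le, fun _ _ => Commute.one_left _, by rwa [stDist_self]⟩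

variable {ι : Type*} {R : ι → Fin 2 → (K →L[ℂ] K)}

/-- The operator `Z ^ b * X ^ a` for `c = (a, b)`, where `X = R 0` and `Z = R 1`. -/
def cell (R : Fin 2 → (K →L[ℂ] K)) (c : Fin 2 × Fin 2) : K →L[ℂ] K :=
  R 1 ^ c.2.val * R 0 ^ c.1.val

/-- The identity, `X` or `Z`. -/
def letter (R : Fin 2 → (K →L[ℂ] K)) (D : Option (Fin 2)) : K →L[ℂ] K := D.elim 1 R

/-- The effect of multiplication by a letter on the exponents of a cell. -/
def shift : Option (Fin 2) → Fin 2 × Fin 2 → Fin 2 × Fin 2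
  | none, c => c
  | some 0, c => (c.1 + 1, c.2)
  | some 1, c => (c.1, c.2 + 1)

/-- The sign that arises from multiplication of a cell by a letter. -/
def shiftSign : Option (Fin 2) → Fin 2 × Fin 2 → ℂ
  | some 1, c => (-1) ^ c.1.val
  | _, _ => 1

theorem norm_shiftSign (D : Option (Fin 2)) (c : Fin 2 × Fin 2) : ‖shiftSign D c‖ = 1 := by
  match D with
  | none => simp [shiftSign]
  | some 0 => simp [shiftSign]
  | some 1 => simp [shiftSign]

/-- Approximate Pauli relations on the vector `Ψ` for reflections `R v 0`, `R v 1`, `v ∈ ι`, in a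
monoid `𝒜` of contractions. -/
structure ApproxPauli (Ψ : K) (𝒜 : Submonoid (K →L[ℂ] K)) (Δ : ℝ)
    (R : ι → Fin 2 → (K →L[ℂ] K)) : Prop where
  nonneg : 0 ≤ Δ
  norm_le : ∀ A ∈ 𝒜, ‖A‖ ≤ 1
  smul_mem : ∀ s : ℂ, ‖s‖ = 1 → ∀ A ∈ 𝒜, s • A ∈ 𝒜
  mem : ∀ v w, R v w ∈ 𝒜
  sq : ∀ v w, R v w * R v w = 1
  movable : ∀ v w, Movable Ψ 𝒜 Δ (R v w)
  anti : ∀ v, stDist Ψ (R v 0 * R v 1) (-(R v 1 * R v 0)) ≤ Δ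
  comm : ∀ u v, u ≠ v → ∀ w w', stDist Ψ (R u w * R v w') (R v w' * R u w) ≤ Δ

namespace ApproxPauli

variable (h : ApproxPauli Ψ 𝒜 Δ R)
include h

theorem letter_mem (v : ι) (D : Option (Fin 2)) : letter (R v) D ∈ 𝒜 := by
  cases D with
  | none => exact 𝒜.one_mem
  | some w => exact h.mem v w

theorem cell_mem (v : ι) (c : Fin 2 × Fin 2) : cell (R v) c ∈ 𝒜 :=
  𝒜.mul_mem (𝒜.pow_mem (h.mem v 1) _) (𝒜.pow_mem (h.mem v 0) _)

theorem movable_letter (v : ι) (D : Option (Fin 2)) : Movable Ψ 𝒜 Δ (letter (R v) D) := by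
  cases D with
  | none => exact Movable.one h.nonneg
  | some w => exact h.movable v w

theorem movable_pow (v : ι) (w a : Fin 2) : Movable Ψ 𝒜 Δ (R v w ^ a.val) := by
  match a with
  | 0 => simpa using Movable.one h.nonneg
  | 1 => simpa using h.movable v w

theorem comm_pow {u v : ι} (huv : u ≠ v) (w a : Fin 2) (D : Option (Fin 2)) :
    stDist Ψ (R u w ^ a.val * letter (R v) D) (letter (R v) D * R u w ^ a.val) ≤ Δ := by
  have h0 : ∀ A : K →L[ℂ] K, stDist Ψ A A ≤ Δ := fun A => by rw [stDist_self]; exact h.nonneg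
  match a, D with
  | 0, _ => simpa using h0 _
  | 1, none => simpa [letter] using h0 _
  | 1, some w' => simpa [letter] using h.comm u v huv w w'

theorem mul_cell {A B : K →L[ℂ] K} (hA : A ∈ 𝒜) (hB : B ∈ 𝒜) (v : ι) (c : Fin 2 × Fin 2) :
    stDist Ψ (A * cell (R v) c) (B * cell (R v) c) ≤ stDist Ψ A B + 4 * Δ := by
  have h1 := stDist_mul_right h.norm_le (h.movable_pow v 1 c.2) hA hB
  have h2 := stDist_mul_right h.norm_le (h.movable_pow v 0 c.1)
    (𝒜.mul_mem hA (𝒜.pow_mem (h.mem v 1) c.2.val)) (𝒜.mul_mem hB (𝒜.pow_mem (h.mem v 1) c.2.val))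
  rw [mul_assoc, mul_assoc] at h2
  change stDist Ψ (A * cell (R v) c) (B * cell (R v) c) ≤ _ at h2
  linarith

theorem word_mem (c : ι → Fin 2 × Fin 2) (L : List ι) :
    (L.map fun v => cell (R v) (c v)).prod ∈ 𝒜 :=
  𝒜.list_prod_mem fun _ hx => by
    obtain ⟨v, -, rfl⟩ := List.mem_map.1 hx
    exact h.cell_mem v _

theorem mul_word (c : ι → Fin 2 × Fin 2) (L : List ι) : ∀ {A B : K →L[ℂ] K}, A ∈ 𝒜 → B ∈ 𝒜 →
    stDist Ψ (A * (L.map fun v => cell (R v) (c v)).prod)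
      (B * (L.map fun v => cell (R v) (c v)).prod) ≤ stDist Ψ A B + 4 * L.length * Δ := by
  induction L with
  | nil => intros; simp
  | cons v L ih =>
    intro A B hA hB
    have h1 := ih (𝒜.mul_mem hA (h.cell_mem v (c v))) (𝒜.mul_mem hB (h.cell_mem v (c v)))
    have h2 := h.mul_cell hA hB v (c v)
    simp only [List.map_cons, List.prod_cons, List.length_cons, ← mul_assoc]
    push_cast
    linarith

theorem cell_comm {u v : ι} (huv : u ≠ v) (c : Fin 2 × Fin 2) (D : Option (Fin 2)) :
    stDist Ψ (cell (R u) c * letter (R v) D) (letter (R v) D * cell (R u) c) ≤ 4 * Δ := by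
  have h1 := (stDist_mul_left (h.norm_le _ (𝒜.pow_mem (h.mem u 1) c.2.val)) _ _).trans
    (h.comm_pow huv 0 c.1 D)
  have h2 := stDist_mul_right h.norm_le (h.movable_pow u 0 c.1)
    (𝒜.mul_mem (𝒜.pow_mem (h.mem u 1) c.2.val) (h.letter_mem v D))
    (𝒜.mul_mem (h.letter_mem v D) (𝒜.pow_mem (h.mem u 1) c.2.val))
  have h3 := h.comm_pow huv 1 c.2 D
  have h4 := stDist_triangle (Ψ := Ψ) (R u 1 ^ c.2.val * (R u 0 ^ c.1.val * letter (R v) D))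
    (R u 1 ^ c.2.val * (letter (R v) D * R u 0 ^ c.1.val))
    (letter (R v) D * (R u 1 ^ c.2.val * R u 0 ^ c.1.val))
  rw [cell, mul_assoc]
  simp only [mul_assoc] at h2
  linarith

/-- The letter is carried through one cell at a time. Exchanging it with the cell `u` costs `4Δ`,
and right multiplication by the remaining word costs `4Δ` for each of its cells, which adds up to a
quadratic bound. -/
theorem word_comm (c : ι → Fin 2 × Fin 2) (D : Option (Fin 2)) {v : ι} (L : List ι)
    (hv : v ∉ L) :
    stDist Ψ ((L.map fun v => cell (R v) (c v)).prod * letter (R v) D)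
      (letter (R v) D * (L.map fun v => cell (R v) (c v)).prod) ≤
        2 * L.length * (L.length + 1) * Δ := by
  induction L with
  | nil => simp [stDist_self]
  | cons u L ih =>
    rw [List.mem_cons, not_or] at hv
    have h1 := (stDist_mul_left (h.norm_le _ (h.cell_mem u (c u))) _ _).trans (ih hv.2)
    have h2 := (h.mul_word c L (𝒜.mul_mem (h.cell_mem u (c u)) (h.letter_mem v D))
      (𝒜.mul_mem (h.letter_mem v D) (h.cell_mem u (c u))))
    have h3 := h.cell_comm (Ne.symm hv.1) (c u) D
    simp only [List.map_cons, List.prod_cons, List.length_cons]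
    push_cast
    simp only [mul_assoc] at h2 ⊢
    refine (stDist_triangle _ _ _).trans ((add_le_add h1 (h2.trans (add_le_add_left h3 _))).trans
      (le_of_eq ?_))
    ring

/-- In the order `Z^b X^a` a factor `X` on the right is absorbed exactly, since `X² = 1`. A factor
`Z` has to pass `X^a`; this uses the anticommutation once if `a = 1` and produces the sign `(-1)^a`.
-/
theorem cell_letter (v : ι) (c : Fin 2 × Fin 2) (D : Option (Fin 2)) :
    stDist Ψ (cell (R v) c * letter (R v) D)
      (shiftSign D c • cell (R v) (shift D c)) ≤ Δ := by
  have h0 : ∀ A B : K →L[ℂ] K, A = B → stDist Ψ A B ≤ Δ := fun A B hAB => by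
    rw [hAB, stDist_self]; exact h.nonneg
  have hp : ∀ w a : Fin 2, R v w ^ a.val * R v w = R v w ^ (a + 1).val := by
    intro w a
    match a with
    | 0 => simp
    | 1 => simp [h.sq]
  obtain ⟨a, b⟩ := c
  match D with
  | none => exact h0 _ _ (by simp [letter, shiftSign, shift])
  | some 0 =>
    refine h0 _ _ ?_
    simp [letter, shiftSign, shift, cell, mul_assoc, hp]
  | some 1 =>
    match a with
    | 0 =>
      refine h0 _ _ ?_
      simp [letter, shiftSign, shift, cell, hp]
    | 1 =>
      have h1 := (stDist_mul_left (h.norm_le _ (𝒜.pow_mem (h.mem v 1) b.val)) _ _).trans (h.anti v)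
      simpa [letter, shiftSign, shift, cell, ← hp, mul_assoc] using h1

/-- The engine of the rigidity. The factors `m v` stand in reverse order so that the one belonging
to the head of the list is rightmost, next to `Ψ`: `m v` is known to act like its letter on `Ψ`
only, so it is replaced there before being moved to its cell. The cubic bound is the sum of the
quadratic costs of these moves. -/
theorem word_shift (c : ι → Fin 2 × Fin 2) (D : ι → Option (Fin 2)) {m : ι → (K →L[ℂ] K)}
    (hm : ∀ v, m v ∈ 𝒜) (hmD : ∀ v, stDist Ψ (m v) (letter (R v) (D v)) ≤ Δ) (L : List ι)
    (hL : L.Nodup) :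
    stDist Ψ ((L.map fun v => cell (R v) (c v)).prod * (L.reverse.map m).prod)
      ((L.map fun v => shiftSign (D v) (c v)).prod •
        (L.map fun v => cell (R v) (shift (D v) (c v))).prod) ≤ 4 * L.length ^ 3 * Δ := by
  induction L with
  | nil => simp [stDist_self]
  | cons v L ih =>
    rw [List.nodup_cons] at hL
    have hs : ∀ L : List ι, ‖(L.map fun v => shiftSign (D v) (c v)).prod‖ = 1 := by
      intro L
      induction L with
      | nil => simp
      | cons v L ih => rw [List.map_cons, List.prod_cons, norm_mul, ih, norm_shiftSign, one_mul]
    have hmm : (L.reverse.map m).prod ∈ 𝒜 := 𝒜.list_prod_mem fun _ hx => by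
      obtain ⟨v, -, rfl⟩ := List.mem_map.1 hx
      exact hm v
    set s := (L.map fun v => shiftSign (D v) (c v)).prod
    set W := (L.map fun v => cell (R v) (c v)).prod with hW
    set W' := (L.map fun v => cell (R v) (shift (D v) (c v))).prod with hW'
    have hWm : W ∈ 𝒜 := h.word_mem c L
    have hWm' : W' ∈ 𝒜 := h.word_mem _ L
    set U := cell (R v) (c v)
    set U' := cell (R v) (shift (D v) (c v))
    have hU : U ∈ 𝒜 := h.cell_mem v (c v)
    have hU' : U' ∈ 𝒜 := h.cell_mem v _
    set l := letter (R v) (D v)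
    have hl : l ∈ 𝒜 := h.letter_mem v _
    set P := (L.reverse.map m).prod
    -- The four moves: replace `m v` by its letter at `Ψ`; apply the induction hypothesis to the
    -- left of the letter, which is movable; carry the letter past `W'`; absorb it into the cell
    -- `U`.
    have h1 : stDist Ψ (U * (W * P * m v)) (U * (W * P * l)) ≤ Δ :=
      (stDist_mul_left (h.norm_le _ hU) _ _).trans
        ((stDist_mul_left (h.norm_le _ (𝒜.mul_mem hWm hmm)) _ _).trans (hmD v))
    have h2 : stDist Ψ (U * (W * P * l)) (U * ((s • W') * l)) ≤ 4 * L.length ^ 3 * Δ + 2 * Δ :=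
      (stDist_mul_left (h.norm_le _ hU) _ _).trans
        ((stDist_mul_right h.norm_le (h.movable_letter v (D v)) (𝒜.mul_mem hWm hmm)
          (h.smul_mem s (hs L) _ hWm')).trans (by linarith [ih hL.2]))
    have h3 : stDist Ψ (s • (U * (W' * l))) (s • (U * (l * W'))) ≤
        2 * L.length * (L.length + 1) * Δ := by
      rw [stDist_smul (hs L)]
      exact (stDist_mul_left (h.norm_le _ hU) _ _).trans (h.word_comm _ (D v) L hL.1)
    have h4 : stDist Ψ (s • (U * l * W')) (s • ((shiftSign (D v) (c v) • U') * W')) ≤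
        Δ + 4 * L.length * Δ := by
      rw [stDist_smul (hs L)]
      exact (h.mul_word _ L (𝒜.mul_mem hU hl)
        (h.smul_mem _ (norm_shiftSign _ _) _ hU')).trans
          (by linarith [h.cell_letter v (c v) (D v)])
    have e1 : ((v :: L).map fun v => cell (R v) (c v)).prod * ((v :: L).reverse.map m).prod =
        U * (W * P * m v) := by
      simp only [List.map_cons, List.prod_cons, List.reverse_cons, List.map_append, List.map_nil,
        List.prod_append, List.prod_nil, mul_one, mul_assoc, U, W, P]
    have e2 : ((v :: L).map fun v => shiftSign (D v) (c v)).prod •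
        ((v :: L).map fun v => cell (R v) (shift (D v) (c v))).prod =
          s • ((shiftSign (D v) (c v) • U') * W') := by
      simp only [List.map_cons, List.prod_cons, smul_mul_assoc, smul_smul, s, U', W']
      rw [mul_comm]
    have e3 : U * ((s • W') * l) = s • (U * (W' * l)) := by
      rw [smul_mul_assoc, mul_smul_comm]
    rw [e1, e2]
    rw [e3] at h2
    rw [← mul_assoc U l W'] at h3
    have t1 := stDist_triangle (Ψ := Ψ) (U * (W * P * m v)) (U * (W * P * l)) (s • (U * (W' * l)))
    have t2 := stDist_triangle (Ψ := Ψ) (U * (W * P * m v)) (s • (U * (W' * l)))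
      (s • (U * l * W'))
    have t3 := stDist_triangle (Ψ := Ψ) (U * (W * P * m v)) (s • (U * l * W'))
      (s • ((shiftSign (D v) (c v) • U') * W'))
    have hlen : (((v :: L).length : ℕ) : ℝ) = L.length + 1 := by simp
    rw [hlen]
    have h0 := h.nonneg
    have hl0 : (0 : ℝ) ≤ L.length := Nat.cast_nonneg _
    -- The errors sum to `4L³ + 2L² + 6L + 4` times `Δ`, which falls short of `4(L+1)³Δ` by `(10L² +
    -- 6L)Δ`.
    have hfin : 4 * (L.length : ℝ) ^ 3 * Δ + 2 * Δ + Δ + 2 * L.length * (L.length + 1) * Δ +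
        (Δ + 4 * L.length * Δ) ≤ 4 * ((L.length : ℝ) + 1) ^ 3 * Δ := by
      have : 0 ≤ (10 * (L.length : ℝ) ^ 2 + 6 * L.length) * Δ := by positivity
      nlinarith
    linarith

end ApproxPauli

end Words

/-! ### The isometry -/

section Isometry

theorem matrixOp_apply {α : Type*} [Fintype α] [DecidableEq α] (M : Matrix α α ℂ) (f : Ell2 α)
    (x : α) : matrixOp M f x = ∑ y, M x y * f y := rfl

/-- The vector `φ ⊗ ψ`, as an operator in `ψ`. -/
def attach {β : Type*} (α : Type*) (φ : Ell2 β) : Ell2 α →L[ℂ] Ell2 (β × α) :=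
  ampl α ((innerSL ℂ (ket PUnit.unit.{1})).smulRight φ) ∘L reindex (Equiv.punitProd α).symm

theorem attach_apply {α β : Type*} (φ : Ell2 β) (ψ : Ell2 α) (x : β × α) :
    attach α φ ψ x = φ x.1 * ψ x.2 := by
  change (inner ℂ (ket PUnit.unit.{1}) (slice (reindex (Equiv.punitProd α).symm ψ) x.2) • φ) x.1 = _
  rw [inner_ket_left]
  exact mul_comm _ _

theorem inner_attach {α β : Type*} [Fintype β] (φ φ' : Ell2 β) (ψ ψ' : Ell2 α) :
    inner ℂ (attach α φ ψ) (attach α φ' ψ') = (∑ b, conj (φ b) * φ' b) * inner ℂ ψ ψ' := by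
  have hs := lp.summable_inner (𝕜 := ℂ) (attach α φ ψ) (attach α φ' ψ')
  rw [lp.inner_eq_tsum, hs.tsum_prod, tsum_fintype, lp.inner_eq_tsum, Finset.sum_mul]
  refine Finset.sum_congr rfl fun b _ => ?_
  rw [← tsum_mul_left]
  refine tsum_congr fun a => ?_
  simp only [attach_apply, RCLike.inner_apply, map_mul]
  ring

/-- A vector of a finite dimensional space `ℂ^β`. -/
def finVec {β : Type*} [Fintype β] (f : β → ℂ) : Ell2 β :=
  ⟨f, (memℓp_two_iff _).2 (Summable.of_finite)⟩

/-- The identity, `X` or `Z` as a matrix. -/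
def letterMatrix (D : Option (Fin 2)) : Matrix (Fin 2) (Fin 2) ℂ :=
  D.elim 1 fun w => (honestPauli w).matrix

/-- Up to normalization, the amplitude at `(x, y)` of the Bell state with index `c`. -/
def bellEntry (c : Fin 2 × Fin 2) (x y : Fin 2) : ℂ :=
  if c.1 = x + y then (-1) ^ (c.2.val * y.val) else 0

/-- The Bell vectors are orthogonal with squared norm `2`, and a letter on the first qubit permutes
them by `shift` with the sign `shiftSign`. These are the rules by which a letter multiplies a cell
on the right in `ApproxPauli.cell_letter`, but here they hold exactly. -/
theorem bellEntry_sum (D : Option (Fin 2)) (c c' : Fin 2 × Fin 2) :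
    ∑ x, ∑ y, ∑ x', conj (bellEntry c x y) * (letterMatrix D x x' * bellEntry c' x' y) =
      2 * if c' = shift D c then shiftSign D c else 0 := by
  obtain ⟨a, b⟩ := c
  obtain ⟨a', b'⟩ := c'
  rcases D with _ | w
  · fin_cases a <;> fin_cases b <;> fin_cases a' <;> fin_cases b' <;>
      simp [Fin.sum_univ_two, bellEntry, letterMatrix, shift, shiftSign, Matrix.one_apply] <;>
      norm_num
  · fin_cases w <;> fin_cases a <;> fin_cases b <;> fin_cases a' <;> fin_cases b' <;>
      simp [Fin.sum_univ_two, bellEntry, letterMatrix, shift, shiftSign, honestPauli,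
        Pauli.matrix] <;>
      norm_num

variable {α : Type*} {n : ℕ}

/-- The tensor product of unnormalized Bell states. -/
def bellVec (c : Fin n → Fin 2 × Fin 2) : Ell2 (Bits n × Bits n) :=
  finVec fun z => ∏ v, bellEntry (c v) (z.1 v) (z.2 v)

/-- The product of the cells `c v` over all `v`. -/
def word {A : Type*} [NormedAddCommGroup A] [NormedSpace ℂ A] (R : Fin n → Fin 2 → (A →L[ℂ] A))
    (c : Fin n → Fin 2 × Fin 2) : A →L[ℂ] A :=
  ((List.finRange n).map fun v => cell (R v) (c v)).prod

/-- The operator `∑ c, φ_c ⊗ P_c`, with Bell states `φ_c` and words `P_c`. -/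
def dilation (R : Fin n → Fin 2 → (Ell2 α →L[ℂ] Ell2 α)) :
    Ell2 α →L[ℂ] Ell2 (Bits n × (Bits n × α)) :=
  reindex (Equiv.prodAssoc _ _ _) ∘L
    (((((√8) ^ n)⁻¹ : ℝ) : ℂ) • ∑ c : Fin n → Fin 2 × Fin 2, attach α (bellVec c) ∘L word R c)

theorem ampl_matrixOp_attach (M : Matrix (Bits n) (Bits n) ℂ) (f : Bits n × Bits n → ℂ)
    (ψ : Ell2 α) :
    ampl (Bits n × α) (matrixOp M) (reindex (Equiv.prodAssoc _ _ _) (attach α (finVec f) ψ)) =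
      reindex (Equiv.prodAssoc _ _ _)
        (attach α (finVec fun z => ∑ x', M z.1 x' * f (x', z.2)) ψ) := by
  ext ⟨x, y, a⟩
  rw [ampl_apply, matrixOp_apply, reindex_apply, attach_apply]
  change ∑ x', M x x' * attach α (finVec f) ψ ((x', y), a) =
    (∑ x', M x x' * f (x', y)) * ψ a
  rw [Finset.sum_mul]
  refine Finset.sum_congr rfl fun x' _ => ?_
  rw [attach_apply, mul_assoc]
  rfl

theorem bellVec_sum (D : Fin n → Option (Fin 2)) (c c' : Fin n → Fin 2 × Fin 2) :
    ∑ z : Bits n × Bits n, conj (bellVec c z) *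
      ∑ x', qubitTensor (fun v => letterMatrix (D v)) z.1 x' * bellVec c' (x', z.2) =
      2 ^ n * if c' = (fun v => shift (D v) (c v)) then ∏ v, shiftSign (D v) (c v) else 0 := by
  have h1 : (2 ^ n * if c' = (fun v => shift (D v) (c v)) then ∏ v, shiftSign (D v) (c v) else 0) =
      ∏ v, ∑ x, ∑ y, ∑ x', conj (bellEntry (c v) x y) *
        (letterMatrix (D v) x x' * bellEntry (c' v) x' y) := by
    simp only [bellEntry_sum, Finset.prod_mul_distrib, Finset.prod_const, Finset.card_univ,
      Fintype.card_fin, Finset.prod_ite_zero, funext_iff, Finset.mem_univ, true_implies]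
  rw [h1, Finset.prod_univ_sum, Fintype.piFinset_univ, Fintype.sum_prod_type]
  refine Finset.sum_congr rfl fun x _ => ?_
  rw [Finset.prod_univ_sum, Fintype.piFinset_univ]
  refine Finset.sum_congr rfl fun y _ => ?_
  rw [Finset.prod_univ_sum, Fintype.piFinset_univ, Finset.mul_sum]
  refine Finset.sum_congr rfl fun x' _ => ?_
  change conj (∏ v, bellEntry (c v) (x v) (y v)) * ((∏ v, letterMatrix (D v) (x v) (x' v)) *
    ∏ v, bellEntry (c' v) (x' v) (y v)) = _
  rw [map_prod, ← Finset.prod_mul_distrib, ← Finset.prod_mul_distrib]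

/-- By orthogonality of the Bell vectors only the pairs of words whose exponents differ by the shift
survive. A Pauli string on the extracted qubits thus turns into an average of overlaps of words of
the strategy. -/
theorem inner_dilation (R : Fin n → Fin 2 → (Ell2 α →L[ℂ] Ell2 α)) (D : Fin n → Option (Fin 2))
    (ψ ψ' : Ell2 α) :
    inner ℂ (dilation R ψ) (ampl (Bits n × α)
      (matrixOp (qubitTensor fun v => letterMatrix (D v))) (dilation R ψ')) =
      (1 / 4 ^ n : ℂ) * ∑ c : Fin n → Fin 2 × Fin 2, (∏ v, shiftSign (D v) (c v)) *
        inner ℂ (word R c ψ) (word R (fun v => shift (D v) (c v)) ψ') := by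
  have hri : ∀ f g : Ell2 ((Bits n × Bits n) × α),
      inner ℂ (reindex (Equiv.prodAssoc _ _ _) f) (reindex (Equiv.prodAssoc _ _ _) g) =
        inner ℂ f g := by
    intro f g
    rw [← ContinuousLinearMap.adjoint_inner_right, adjoint_reindex]
    exact congrArg (inner ℂ f) (congrArg (fun T => T g) (reindex_symm_comp _))
  have hV : ∀ ψ, dilation R ψ = ((((√8) ^ n)⁻¹ : ℝ) : ℂ) • ∑ c : Fin n → Fin 2 × Fin 2,
      reindex (Equiv.prodAssoc _ _ _) (attach α (bellVec c) (word R c ψ)) := by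
    intro ψ
    simp only [dilation, ContinuousLinearMap.comp_apply, smul_apply,
      sum_apply, map_smul, map_sum]
  rw [hV, hV, map_smul, map_sum, inner_smul_left, inner_smul_right, sum_inner]
  simp only [inner_sum]
  have key : ∀ c c' : Fin n → Fin 2 × Fin 2,
      inner ℂ (reindex (Equiv.prodAssoc _ _ _) (attach α (bellVec c) (word R c ψ)))
        (ampl (Bits n × α) (matrixOp (qubitTensor fun v => letterMatrix (D v)))
          (reindex (Equiv.prodAssoc _ _ _) (attach α (bellVec c') (word R c' ψ')))) =
      (2 ^ n * if c' = (fun v => shift (D v) (c v)) then ∏ v, shiftSign (D v) (c v) else 0) *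
        inner ℂ (word R c ψ) (word R c' ψ') := by
    intro c c'
    rw [← bellVec_sum, bellVec, bellVec, ampl_matrixOp_attach, hri, inner_attach]
    rfl
  simp only [key, mul_ite, mul_zero, ite_mul, zero_mul, Finset.sum_ite_eq', Finset.mem_univ,
    if_true, ← mul_assoc]
  rw [Complex.conj_ofReal, ← Complex.ofReal_mul, ← mul_inv, ← mul_pow,
    Real.mul_self_sqrt (by norm_num), Finset.mul_sum, Finset.mul_sum]
  refine Finset.sum_congr rfl fun c _ => ?_
  -- Per qubit, `8` is the squared norm `2` of a Bell vector times the number `4` of cells;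
  -- cancelling the `2` leaves the average over the `4 ^ n` words.
  have h8 : (((8 : ℝ) ^ n)⁻¹ : ℝ) * (2 : ℂ) ^ n = 1 / 4 ^ n := by
    push_cast
    rw [show (8 : ℂ) = 4 * 2 by norm_num, mul_pow]
    field_simp
  rw [← h8]
  ring

variable {R : Fin n → Fin 2 → (Ell2 α →L[ℂ] Ell2 α)}

theorem IsReflection.star_pow_mul {A : Ell2 α →L[ℂ] Ell2 α} (h : IsReflection A) (m : ℕ) :
    star (A ^ m) * A ^ m = 1 := by
  rw [star_pow, h.1.star_eq, ← (Commute.refl A).mul_pow, h.2, one_pow]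

theorem star_word_mul (hR : ∀ v w, IsReflection (R v w)) (c : Fin n → Fin 2 × Fin 2) :
    star (word R c) * word R c = 1 := by
  rw [word]
  induction List.finRange n with
  | nil => simp
  | cons v L ih =>
    have h1 : star (cell (R v) (c v)) * cell (R v) (c v) = 1 := by
      rw [cell, star_mul, mul_assoc, ← mul_assoc (star (R v 1 ^ (c v).2.val)),
        (hR v 1).star_pow_mul, one_mul, (hR v 0).star_pow_mul]
    rw [List.map_cons, List.prod_cons, star_mul, mul_assoc, ← mul_assoc (star (cell _ _)), h1,
      one_mul, ih]

theorem inner_word (hR : ∀ v w, IsReflection (R v w)) (c : Fin n → Fin 2 × Fin 2) (ψ : Ell2 α) :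
    inner ℂ (word R c ψ) (word R c ψ) = inner ℂ ψ ψ := by
  rw [← ContinuousLinearMap.adjoint_inner_right]
  exact congrArg (inner ℂ ψ) (congrArg (fun T => T ψ) (star_word_mul hR c))

/-- The isometry `dilation`. -/
def dilationIso (hR : ∀ v w, IsReflection (R v w)) :
    Ell2 α →ₗᵢ[ℂ] Ell2 (Bits n × (Bits n × α)) where
  toLinearMap := (dilation R).toLinearMap
  norm_map' ψ := by
    have h := inner_dilation R (fun _ => none) ψ ψ
    have h1 : qubitTensor (fun _ : Fin n => letterMatrix none) = 1 := by
      ext x y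
      change ∏ v, (1 : Matrix (Fin 2) (Fin 2) ℂ) (x v) (y v) = _
      simp only [Matrix.one_apply, Finset.prod_ite_zero, funext_iff]
      simp
    have h2 : matrixOp (1 : Matrix (Bits n) (Bits n) ℂ) = 1 := by
      ext f x
      simp [matrixOp_apply, Matrix.one_apply]
    simp only [h1, h2, ampl_one, one_apply_eq_self, shift, shiftSign, inner_word hR,
      Finset.prod_const_one, one_mul, Finset.sum_const, Finset.card_univ, nsmul_eq_mul] at h
    rw [inner_self_eq_norm_sq_to_K, inner_self_eq_norm_sq_to_K] at h
    have h3 : (1 / 4 ^ n : ℂ) * (Fintype.card (Fin n → Fin 2 × Fin 2) : ℂ) = 1 := by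
      simp
    rw [← mul_assoc, h3, one_mul] at h
    have h4 : ‖dilation R ψ‖ ^ 2 = ‖ψ‖ ^ 2 := by exact_mod_cast h
    exact (sq_eq_sq₀ (norm_nonneg _) (norm_nonneg _)).1 h4

theorem pullback_dilationIso (hR : ∀ v w, IsReflection (R v w)) (D : Fin n → Option (Fin 2)) :
    pullback (dilationIso hR)
      (ampl (Bits n × α) (matrixOp (qubitTensor fun v => letterMatrix (D v)))) =
    (1 / 4 ^ n : ℂ) • ∑ c : Fin n → Fin 2 × Fin 2, (∏ v, shiftSign (D v) (c v)) •
      (star (word R c) * word R fun v => shift (D v) (c v)) := by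
  refine ContinuousLinearMap.ext fun ψ' => ext_inner_left ℂ fun ψ => ?_
  have h := inner_dilation R D ψ ψ'
  rw [← ContinuousLinearMap.adjoint_inner_right] at h
  refine Eq.trans h ?_
  simp only [smul_apply, sum_apply, inner_smul_right,
    inner_sum]
  congr 1
  refine Finset.sum_congr rfl fun c _ => ?_
  congr 1
  exact (ContinuousLinearMap.adjoint_inner_right _ _ _).symm

end Isometry

/-! ### The value of the stabilizer game -/

section Reflection

variable {α β : Type*}

theorem IsReflection.one : IsReflection (1 : Ell2 α →L[ℂ] Ell2 α) :=
  ⟨IsSelfAdjoint.one _, one_mul 1⟩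

theorem norm_le_one_of_star_mul {H : Type*} [NormedAddCommGroup H] [InnerProductSpace ℂ H]
    [CompleteSpace H] {T : H →L[ℂ] H} (h : star T * T = 1) : ‖T‖ ≤ 1 := by
  refine T.opNorm_le_bound zero_le_one fun x => ?_
  rw [one_mul]
  refine le_of_eq ((sq_eq_sq₀ (norm_nonneg _) (norm_nonneg _)).1 ?_)
  have h1 : inner ℂ (T x) (T x) = inner ℂ x x := by
    rw [← ContinuousLinearMap.adjoint_inner_right]
    exact congrArg (inner ℂ x) (congrArg (fun S => S x) h)
  rw [inner_self_eq_norm_sq_to_K, inner_self_eq_norm_sq_to_K] at h1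
  exact_mod_cast h1

theorem IsReflection.norm_le {A : Ell2 α →L[ℂ] Ell2 α} (h : IsReflection A) : ‖A‖ ≤ 1 :=
  norm_le_one_of_star_mul (by rw [h.1.star_eq, h.2])

theorem IsReflection.map {A : Ell2 α →L[ℂ] Ell2 α} (h : IsReflection A)
    (φ : (Ell2 α →L[ℂ] Ell2 α) →⋆ₐ[ℂ] (Ell2 β →L[ℂ] Ell2 β)) : IsReflection (φ A) :=
  ⟨h.1.map φ, by rw [← map_mul, h.2, map_one]⟩

theorem sum_zmod_two {A : Type*} [AddCommMonoid A] (f : ZMod 2 → A) : ∑ a, f a = f 0 + f 1 :=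
  Fin.sum_univ_two f

theorem sum_effect (A : Ell2 α →L[ℂ] Ell2 α) : ∑ a, effect A a = 1 := by
  rw [sum_zmod_two, effect, effect, ← smul_add]
  simp only [ZMod.val_zero, ZMod.val_one, pow_zero, pow_one, one_smul, neg_smul]
  rw [show (1 + A + (1 + -A)) = (2 : ℂ) • (1 : Ell2 α →L[ℂ] Ell2 α) by rw [two_smul]; abel,
    smul_smul]
  norm_num

theorem sum_sign_effect (A : Ell2 α →L[ℂ] Ell2 α) :
    ∑ a : ZMod 2, (-1 : ℂ) ^ a.val • effect A a = A := by
  rw [sum_zmod_two, effect, effect]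
  simp only [ZMod.val_zero, ZMod.val_one, pow_zero, pow_one, one_smul, neg_smul]
  rw [← smul_neg, ← smul_add, show (1 + A + -(1 + -A)) = (2 : ℂ) • A by rw [two_smul]; abel,
    smul_smul]
  norm_num

end Reflection

/-! ### Acceptance probabilities as expectations of signed tensor products -/

section Game

variable {r : ℕ} {α : Fin r → Type u} (S : XZStabilizer r)
  {ρ : Ell2 (∀ i, α i) →L[ℂ] Ell2 (∀ i, α i)}

/-- The action of the operators of a player on the purification of a state. -/
def playerHom (α : Fin r → Type u) (t : Fin r) :
    (Ell2 (α t) →L[ℂ] Ell2 (α t)) →⋆ₐ[ℂ]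
      (Ell2 ((∀ i, α i) × (∀ i, α i)) →L[ℂ] Ell2 ((∀ i, α i) × (∀ i, α i))) :=
  (amplHom (∀ i, α i) (∀ i, α i)).comp (onPlayerHom α t)

theorem trAt_sum (hρ : IsDensity ρ) {ι : Type*} (s : Finset ι) (T : ι → Ell2 (∀ i, α i) →L[ℂ] Ell2 (∀ i, α i)) :
    trAt ρ (∑ x ∈ s, T x) = ∑ x ∈ s, trAt ρ (T x) := by
  simp only [trAt_eq hρ, ← amplHom_apply, map_sum, sum_apply, inner_sum]

theorem trAt_smul (hρ : IsDensity ρ) (c : ℂ) (T : Ell2 (∀ i, α i) →L[ℂ] Ell2 (∀ i, α i)) :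
    trAt ρ (c • T) = c * trAt ρ T := by
  simp only [trAt_eq hρ, ← amplHom_apply, map_smul, smul_apply, inner_smul_right]

theorem trAt_one (hρ : IsDensity ρ) : trAt ρ (1 : Ell2 (∀ i, α i) →L[ℂ] Ell2 (∀ i, α i)) = 1 := by
  rw [trAt_eq hρ, ampl_one, one_apply_eq_self, inner_self_eq_norm_sq_to_K, norm_purify hρ]
  simp

theorem norm_trAt_le (hρ : IsDensity ρ) {T : Ell2 (∀ i, α i) →L[ℂ] Ell2 (∀ i, α i)} (hT : ‖T‖ ≤ 1) :
    ‖trAt ρ T‖ ≤ 1 := by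
  rw [trAt_eq hρ]
  refine (norm_inner_le_norm _ _).trans ?_
  have h := (ampl (∀ i, α i) T).le_of_opNorm_le ((norm_ampl_le T).trans hT) (purify hρ)
  rw [norm_purify] at h ⊢
  linarith

/-- The signed tensor product of reflections that is measured in a round. -/
def roundOp (B : ∀ i, Fin 4 → (Ell2 (α i) →L[ℂ] Ell2 (α i))) (s : Round S) :
    Ell2 (∀ i, α i) →L[ℂ] Ell2 (∀ i, α i) :=
  (-1 : ℂ) ^ (parity S s).val • tensorOp fun i => (query S s i).elim 1 (B i)

theorem neg_one_pow_zmod_add (a b : ZMod 2) :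
    (-1 : ℂ) ^ (a + b).val = (-1) ^ a.val * (-1) ^ b.val := by
  rw [ZMod.val_add, ← neg_one_pow_eq_pow_mod_two, pow_add]

theorem neg_one_pow_zmod_sum {ι : Type*} (s : Finset ι) (f : ι → ZMod 2) :
    (-1 : ℂ) ^ (∑ i ∈ s, f i).val = ∏ i ∈ s, (-1) ^ (f i).val := by
  classical
  induction s using Finset.induction_on with
  | empty => simp
  | insert i s hi ih => rw [Finset.sum_insert hi, Finset.prod_insert hi, neg_one_pow_zmod_add, ih]

theorem zmod_two_cases (a : ZMod 2) : a = 0 ∨ a = 1 := by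
  fin_cases a
  · exact Or.inl rfl
  · exact Or.inr rfl

theorem ite_eq_zmod (a b : ZMod 2) [Decidable (a = b)] :
    (if a = b then (1 : ℂ) else 0) = 1 / 2 * (1 + (-1) ^ b.val * (-1) ^ a.val) := by
  rcases zmod_two_cases a with rfl | rfl <;> rcases zmod_two_cases b with rfl | rfl <;>
    simp [ZMod.val_one] <;> norm_num

open Classical in
-- The acceptance indicator is half of one plus a product of characters of the answers. Summing
-- against the effects, a character turns the effect of a player into her reflection; a null
-- question carries the trivial character and gives the identity. The replacement of a null question
-- therefore has no influence.
theorem sum_accepts (hρ : IsDensity ρ) (B : ∀ i, Fin 4 → (Ell2 (α i) →L[ℂ] Ell2 (α i))) (σ : Sample S) :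
    (∑ a : Fin r → ZMod 2, if Accepts S σ.1 a then
      (trAt ρ (tensorOp fun i => effect (B i (question S σ i)) (a i))).re else 0) =
      (1 + (trAt ρ (roundOp S B σ.1)).re) / 2 := by
  set E : (Fin r → ZMod 2) → (Ell2 (∀ i, α i) →L[ℂ] Ell2 (∀ i, α i)) := fun a =>
    tensorOp fun i => effect (B i (question S σ i)) (a i) with hE
  set χ : Fin r → ZMod 2 → ℂ := fun i a =>
    if (query S σ.1 i).isSome then (-1) ^ a.val else 1 with hχ
  have h1 : ∀ a, (if Accepts S σ.1 a then (1 : ℂ) else 0) =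
      1 / 2 * (1 + (-1) ^ (parity S σ.1).val * ∏ i, χ i (a i)) := by
    intro a
    rw [Accepts, ite_eq_zmod, neg_one_pow_zmod_sum]
    congr 4
    funext i
    simp only [hχ]
    split_ifs <;> simp
  have h2 : ∑ a, E a = 1 := by
    have := tensorOp_sum (fun (_ : Fin r) (_ : ZMod 2) => (1 : ℂ))
      (fun i a => effect (B i (question S σ i)) a)
    simp only [one_smul, Finset.prod_const_one, sum_effect, tensorOp_one] at this
    exact this.symm
  have h3 : ∑ a, (∏ i, χ i (a i)) • E a =
      tensorOp fun i => (query S σ.1 i).elim 1 (B i) := by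
    rw [← tensorOp_sum]
    congr 1
    funext i
    simp only [hχ, question]
    cases query S σ.1 i with
    | none => simp [sum_effect]
    | some q => simpa using sum_sign_effect _
  have h4 : ∑ a, (if Accepts S σ.1 a then (1 : ℂ) else 0) • E a =
      (1 / 2 : ℂ) • (1 + roundOp S B σ.1) := by
    simp only [h1, mul_smul, add_smul, one_smul, ← Finset.smul_sum, Finset.sum_add_distrib, h2, h3]
    rfl
  have h5 := congrArg (fun T => (trAt ρ T).re) h4
  simp only [trAt_sum hρ, trAt_smul hρ, Complex.re_sum] at h5
  have h6 : trAt ρ (1 + roundOp S B σ.1) = 1 + trAt ρ (roundOp S B σ.1) := by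
    rw [← trAt_one hρ]
    simp only [trAt_eq hρ, ← amplHom_apply, map_add, add_apply, inner_add_right]
  rw [h6] at h5
  have h7 : ∀ a, ((if Accepts S σ.1 a then (1 : ℂ) else 0) * trAt ρ (E a)).re =
      if Accepts S σ.1 a then (trAt ρ (E a)).re else 0 := by
    intro a
    split_ifs <;> simp
  simp only [h7] at h5
  rw [h5]
  simp
  ring

open Classical in
/-- The value of the strategy for the stabilizer game given by reflections. -/
def gameValue (p : ℝ) (ρ : Ell2 (∀ i, α i) →L[ℂ] Ell2 (∀ i, α i))
    (B : ∀ i, Fin 4 → (Ell2 (α i) →L[ℂ] Ell2 (α i))) : ℝ :=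
  ∑ σ : Sample S, sampleProb S p σ * ∑ a : Fin r → ZMod 2, if Accepts S σ.1 a then
      (trAt ρ (tensorOp fun i => effect (B i (question S σ i)) (a i))).re else 0

theorem sum_null (p : ℝ) : ∑ x : Fin r → Fin 2, ∏ i, (if x i = 1 then p else 1 - p) = 1 := by
  have h := Finset.prod_univ_sum (fun _ : Fin r => (Finset.univ : Finset (Fin 2)))
    (fun _ x => if x = 1 then p else 1 - p)
  rw [Fintype.piFinset_univ] at h
  rw [← h]
  simp [Fin.sum_univ_two]

theorem gameValue_eq (hρ : IsDensity ρ) (p : ℝ) (B : ∀ i, Fin 4 → (Ell2 (α i) →L[ℂ] Ell2 (α i))) :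
    gameValue S p ρ B = ∑ s, roundProb S s * ((1 + (trAt ρ (roundOp S B s)).re) / 2) := by
  simp only [gameValue, sum_accepts S hρ, Fintype.sum_prod_type (γ := ℝ) (α₁ := Round S), sampleProb]
  refine Finset.sum_congr rfl fun s _ => ?_
  rw [← Finset.sum_mul, ← Finset.mul_sum, sum_null, mul_one]

/-- The part of the `j`-th generator, measured with the reflections `B`, that belongs to the
players other than `t`. -/
def shadow (B : ∀ i, Fin 4 → (Ell2 (α i) →L[ℂ] Ell2 (α i))) (j : Fin S.l) (t : Fin r) :
    Ell2 (∀ i, α i) →L[ℂ] Ell2 (∀ i, α i) :=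
  (-1 : ℂ) ^ (S.sign j).val •
    tensorOp (Function.update (fun i => (ask (S.pauli j i)).elim 1 (B i)) t 1)

variable {S} {B : ∀ i, Fin 4 → (Ell2 (α i) →L[ℂ] Ell2 (α i))}

theorem roundOp_inl (j : Fin S.l) (t : Fin r) :
    roundOp S B (.inl j) = shadow S B j t * onPlayer t ((ask (S.pauli j t)).elim 1 (B t)) := by
  rw [roundOp, tensorOp_update_mul _ t, ← smul_mul_assoc]
  rfl

theorem roundOp_inr (t : Fin r) (j : Fin 4) :
    roundOp S B (.inr (t, j)) = (-1 : ℂ) ^ (![0, 0, 0, 1] j : ZMod 2).val •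
      (shadow S B (specialGen S t j) t * onPlayer t (B t (![2, 3, 2, 3] j))) := by
  rw [roundOp, tensorOp_update_mul _ t, shadow, smul_mul_assoc, smul_smul]
  congr 1
  · rw [mul_comm, ← neg_one_pow_zmod_add]
    rfl
  · have h1 : Function.update (fun i => (query S (.inr (t, j)) i).elim 1 (B i)) t 1 =
        Function.update (fun i => (ask (S.pauli (specialGen S t j) i)).elim 1 (B i)) t 1 := by
      funext i
      by_cases h : i = t
      · subst h; simp
      · simp [h, query]
    have h2 : (query S (.inr (t, j)) t).elim 1 (B t) = B t (![2, 3, 2, 3] j) := by simp [query]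
    rw [h1, h2]

theorem shadow_comm (j : Fin S.l) (t : Fin r) (T : Ell2 (α t) →L[ℂ] Ell2 (α t)) :
    Commute (shadow S B j t) (onPlayer t T) :=
  (tensorOp_update_comm _ t T).smul_left _

theorem norm_sign_smul {β γ : Type*} (m : ℕ) (T : Ell2 β →L[ℂ] Ell2 γ) :
    ‖(-1 : ℂ) ^ m • T‖ = ‖T‖ := by
  rw [norm_smul, norm_pow, norm_neg, norm_one, one_pow, one_mul]

theorem norm_shadow_le (hB : ∀ i q, IsReflection (B i q)) (j : Fin S.l) (t : Fin r) :
    ‖shadow S B j t‖ ≤ 1 := by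
  rw [shadow, norm_sign_smul]
  refine norm_tensorOp_le _ fun i => ?_
  by_cases h : i = t
  · subst h
    rw [Function.update_self]
    exact IsReflection.one.norm_le
  · rw [Function.update_of_ne h]
    cases ask (S.pauli j i) with
    | none => exact IsReflection.one.norm_le
    | some q => exact (hB i q).norm_le

theorem isSelfAdjoint_shadow (hB : ∀ i q, IsReflection (B i q)) (j : Fin S.l) (t : Fin r) :
    IsSelfAdjoint (shadow S B j t) := by
  have h : star (tensorOp (Function.update (fun i => (ask (S.pauli j i)).elim 1 (B i)) t 1)) =
      tensorOp (Function.update (fun i => (ask (S.pauli j i)).elim 1 (B i)) t 1) := by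
    rw [ContinuousLinearMap.star_eq_adjoint, adjoint_tensorOp]
    congr 1
    funext i
    rw [← ContinuousLinearMap.star_eq_adjoint]
    by_cases h : i = t
    · subst h
      rw [Function.update_self, star_one]
    · rw [Function.update_of_ne h]
      cases ask (S.pauli j i) with
      | none => exact star_one _
      | some q => exact (hB i q).1
  rw [isSelfAdjoint_iff, shadow, star_smul, h]
  simp

theorem norm_roundOp_le (hB : ∀ i q, IsReflection (B i q)) (s : Round S) :
    ‖roundOp S B s‖ ≤ 1 := by
  rw [roundOp, norm_sign_smul]
  refine norm_tensorOp_le _ fun i => ?_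
  cases query S s i with
  | none => exact IsReflection.one.norm_le
  | some q => exact (hB i q).norm_le

/-- Moving the self-adjoint shadow to the other side writes the correlation as an overlap of a
vector produced by player `t` with one produced by the others. -/
theorem re_trAt_shadow (hρ : IsDensity ρ) (hB : ∀ i q, IsReflection (B i q)) (j : Fin S.l) (t : Fin r)
    (T : Ell2 (α t) →L[ℂ] Ell2 (α t)) :
    (trAt ρ (shadow S B j t * onPlayer t T)).re =
      (inner ℂ (ampl _ (shadow S B j t) (purify hρ)) (playerHom α t T (purify hρ))).re := by
  rw [trAt_eq hρ]
  change (inner ℂ (purify hρ) (ampl _ (shadow S B j t) (playerHom α t T (purify hρ)))).re = _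
  rw [← ContinuousLinearMap.adjoint_inner_left, adjoint_ampl,
    ← ContinuousLinearMap.star_eq_adjoint, (isSelfAdjoint_shadow hB j t).star_eq]

end Game

/-! ### The CHSH inequality and approximate anticommutation -/

section CHSH

variable {K : Type*} [NormedAddCommGroup K] [InnerProductSpace ℂ K]

theorem norm_sub_sq_le {a b : K} (ha : ‖a‖ ≤ 1) (hb : ‖b‖ ≤ 1) :
    ‖a - b‖ ^ 2 ≤ 2 * (1 - (inner ℂ a b).re) := by
  have h := norm_sub_sq (𝕜 := ℂ) a b
  have h2 : RCLike.re (inner ℂ a b) = (inner ℂ a b).re := rfl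
  rw [h2] at h
  nlinarith [norm_nonneg a, norm_nonneg b]

/-- The sum of squares decomposition for the CHSH inequality. -/
theorem chsh_sos {a z b c : K} (ha : ‖a‖ ≤ 1) (hz : ‖z‖ ≤ 1) (hb : ‖b‖ ≤ 1) (hc : ‖c‖ ≤ 1) :
    ‖((√2 / 2 : ℝ) : ℂ) • (b + c) - a‖ ^ 2 + ‖((√2 / 2 : ℝ) : ℂ) • (b - c) - z‖ ^ 2 ≤
      √2 * (2 * √2 - ((inner ℂ a b).re + (inner ℂ a c).re + (inner ℂ z b).re -
        (inner ℂ z c).re)) := by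
  have h2 : √2 ^ 2 = 2 := Real.sq_sqrt (by norm_num)
  have e : ∀ x y : K, RCLike.re (inner ℂ x y) = (inner ℂ x y).re := fun _ _ => rfl
  have hp := parallelogram_law_with_norm ℂ b c
  have hsm : ∀ x : K, ‖((√2 / 2 : ℝ) : ℂ) • x‖ ^ 2 = ‖x‖ ^ 2 / 2 := by
    intro x
    rw [norm_smul, mul_pow, Complex.norm_real, Real.norm_eq_abs, sq_abs, div_pow, h2]
    ring
  have hi : ∀ x y : K, (inner ℂ (((√2 / 2 : ℝ) : ℂ) • x) y).re = √2 / 2 * (inner ℂ y x).re := by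
    intro x y
    rw [inner_smul_left, Complex.conj_ofReal, Complex.re_ofReal_mul, ← inner_conj_symm,
      Complex.conj_re]
  rw [norm_sub_sq (𝕜 := ℂ), norm_sub_sq (𝕜 := ℂ), hsm, hsm, e, e, hi, hi, inner_add_right,
    inner_sub_right, Complex.add_re, Complex.sub_re]
  -- After expanding both squares, the parallelogram law leaves the squared norms of the four
  -- vectors, at most `4 = √2 * (2 * √2)`, minus `√2` times the CHSH expression.
  have h1 : ‖b + c‖ ^ 2 / 2 + ‖b - c‖ ^ 2 / 2 = ‖b‖ ^ 2 + ‖c‖ ^ 2 := by nlinarith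
  have hn : ∀ {x : K}, ‖x‖ ≤ 1 → ‖x‖ ^ 2 ≤ 1 := fun h => pow_le_one₀ (norm_nonneg _) h
  nlinarith [hn ha, hn hz, hn hb, hn hc]

/-- Operators that agree on `Ψ` with operators elsewhere which are CHSH-optimal anticommute
approximately. -/
theorem stDist_anti_of_chsh {Ψ : K} {R₀ R₁ B C A Z : K →L[ℂ] K} {e : ℝ}
    (hR₀ : ‖R₀‖ ≤ 1) (hR₁ : ‖R₁‖ ≤ 1) (hB : ‖B‖ ≤ 1) (hC : ‖C‖ ≤ 1) (hA : ‖A‖ ≤ 1) (hZ : ‖Z‖ ≤ 1)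
    (hB2 : B * B = 1) (hC2 : C * C = 1)
    (hAR : Commute A R₁) (hAB : Commute A B) (hAC : Commute A C)
    (hZR : Commute Z R₀) (hZB : Commute Z B) (hZC : Commute Z C)
    (h0 : stDist Ψ R₀ A ≤ e) (h1 : stDist Ψ R₁ Z ≤ e)
    (hP : stDist Ψ (((√2 / 2 : ℝ) : ℂ) • (B + C)) A ≤ e)
    (hQ : stDist Ψ (((√2 / 2 : ℝ) : ℂ) • (B - C)) Z ≤ e) :
    stDist Ψ (R₀ * R₁) (-(R₁ * R₀)) ≤ 10 * e := by
  have he : 0 ≤ e := (stDist_nonneg _ _).trans h0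
  have hs : ‖((√2 / 2 : ℝ) : ℂ)‖ ≤ 1 := by
    rw [Complex.norm_real, Real.norm_eq_abs, abs_of_nonneg (by positivity)]
    have : √2 ≤ 2 := Real.sqrt_le_iff.2 ⟨by norm_num, by norm_num⟩
    linarith
  set P := ((√2 / 2 : ℝ) : ℂ) • (B + C) with hPdef
  set Q := ((√2 / 2 : ℝ) : ℂ) • (B - C) with hQdef
  have hPn : ‖P‖ ≤ 2 := by
    rw [hPdef, norm_smul]
    have := norm_add_le B C
    nlinarith [norm_nonneg (B + C), norm_nonneg ((√2 / 2 : ℝ) : ℂ)]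
  have hQn : ‖Q‖ ≤ 2 := by
    rw [hQdef, norm_smul]
    have := norm_sub_le B C
    nlinarith [norm_nonneg (B - C), norm_nonneg ((√2 / 2 : ℝ) : ℂ)]
  -- The only exact anticommutation in the argument: it needs just `B² = C² = 1`.
  have hPQ : P * Q = -(Q * P) := by
    rw [hPdef, hQdef, smul_mul_smul_comm, smul_mul_smul_comm, ← smul_neg]
    congr 1
    simp only [add_mul, mul_sub, mul_add, sub_mul, hB2, hC2]
    abel
  have hZP : Commute Z P := (hZB.add_right hZC).smul_right _
  have hAQ : Commute A Q := (hAB.sub_right hAC).smul_right _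
  -- The chain is `XY ≈ XG = GX ≈ GF ≈ GX' = X'G ≈ X'Y'` on `Ψ`, with `F`, `G` the operators
  -- elsewhere. The last step loses a factor `2` because `X'` need not be a contraction, so the
  -- total is `5 * e`.
  have gen : ∀ {X Y X' Y' F G : K →L[ℂ] K}, ‖X‖ ≤ 1 → ‖G‖ ≤ 1 → ‖X'‖ ≤ 2 → Commute G X →
      Commute G X' → stDist Ψ X F ≤ e → stDist Ψ Y G ≤ e → stDist Ψ X' F ≤ e →
      stDist Ψ Y' G ≤ e → stDist Ψ (X * Y) (X' * Y') ≤ 5 * e := by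
    intro X Y X' Y' F G hX hG hX' c1 c2 d1 d2 d3 d4
    have t1 : stDist Ψ (X * Y) (X * G) ≤ e := (stDist_mul_left hX _ _).trans d2
    have t2 : stDist Ψ (G * X) (G * F) ≤ e := (stDist_mul_left hG _ _).trans d1
    have t3 : stDist Ψ (G * F) (G * X') ≤ e :=
      (stDist_mul_left hG _ _).trans ((stDist_comm _ _).trans_le d3)
    have t4 : stDist Ψ (X' * G) (X' * Y') ≤ 2 * e := by
      have := X'.le_of_opNorm_le hX' (G Ψ - Y' Ψ)
      rw [map_sub] at this
      refine this.trans ?_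
      have h5 := (stDist_comm (Ψ := Ψ) G Y').trans_le d4
      rw [stDist] at h5
      linarith
    rw [← c1.eq] at t1
    rw [← c2.eq] at t4
    have s1 := stDist_triangle (Ψ := Ψ) (X * Y) (G * X) (G * F)
    have s2 := stDist_triangle (Ψ := Ψ) (X * Y) (G * F) (G * X')
    have s3 := stDist_triangle (Ψ := Ψ) (X * Y) (G * X') (X' * Y')
    linarith
  have k1 := gen hR₀ hZ hPn hZR hZP h0 h1 hP hQ
  have k2 := gen hR₁ hA hQn hAR hAQ h1 h0 hQ hP
  have k3 : stDist Ψ (P * Q) (-(R₁ * R₀)) ≤ 5 * e := by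
    rw [hPQ, stDist_comm]
    refine le_trans (le_of_eq ?_) k2
    change ‖-((R₁ * R₀) Ψ) - -((Q * P) Ψ)‖ = ‖(R₁ * R₀) Ψ - (Q * P) Ψ‖
    rw [neg_sub_neg, norm_sub_rev]
  linarith [stDist_triangle (Ψ := Ψ) (R₀ * R₁) (P * Q) (-(R₁ * R₀))]

end CHSH

/-! ### Rigidity of the stabilizer game -/

section Rigidity

variable {r : ℕ} {α : Fin r → Type u} {S : XZStabilizer r}
  {ρ : Ell2 (∀ i, α i) →L[ℂ] Ell2 (∀ i, α i)}
  {B : ∀ i, Fin 4 → (Ell2 (α i) →L[ℂ] Ell2 (α i))}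

instance : Fintype Pauli := ⟨{.I, .X, .Y, .Z}, fun x => by cases x <;> simp⟩

/-- The generators are distinct signed Pauli strings. This bound lets the final constant depend on
`r` alone and not on the stabilizer. -/
theorem card_generators_le (S : XZStabilizer r) : S.l ≤ 2 * 4 ^ r := by
  have h := Fintype.card_le_of_injective _ S.gen_injective
  have h4 : Fintype.card Pauli = 4 := rfl
  simpa [ZMod.card, h4] using h

theorem generators_pos (S : XZStabilizer r) (hr : 0 < r) : 0 < S.l :=
  (S.gX ⟨0, hr⟩).pos

/-- The expectation of the operator of a round. -/
def corr (S : XZStabilizer r) (ρ : Ell2 (∀ i, α i) →L[ℂ] Ell2 (∀ i, α i))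
    (B : ∀ i, Fin 4 → (Ell2 (α i) →L[ℂ] Ell2 (α i))) (s : Round S) : ℝ :=
  (trAt ρ (roundOp S B s)).re

theorem abs_corr_le (hρ : IsDensity ρ) (hB : ∀ i q, IsReflection (B i q)) (s : Round S) :
    |corr S ρ B s| ≤ 1 :=
  (Complex.abs_re_le_norm _).trans (norm_trAt_le hρ (norm_roundOp_le hB s))

theorem norm_player_le (hρ : IsDensity ρ) (t : Fin r) {A : Ell2 (α t) →L[ℂ] Ell2 (α t)}
    (hA : IsReflection A) : ‖playerHom α t A (purify hρ)‖ ≤ 1 := by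
  have h := (playerHom α t A).le_of_opNorm_le (hA.map (playerHom α t)).norm_le (purify hρ)
  rwa [norm_purify, one_mul] at h

/-- The shadow of a generator on the purification. -/
def shadowHat (S : XZStabilizer r) (B : ∀ i, Fin 4 → (Ell2 (α i) →L[ℂ] Ell2 (α i)))
    (j : Fin S.l) (t : Fin r) :
    Ell2 ((∀ i, α i) × (∀ i, α i)) →L[ℂ] Ell2 ((∀ i, α i) × (∀ i, α i)) :=
  ampl (∀ i, α i) (shadow S B j t)

theorem norm_shadowHat_le (hB : ∀ i q, IsReflection (B i q)) (j : Fin S.l) (t : Fin r) :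
    ‖shadowHat S B j t‖ ≤ 1 :=
  (norm_ampl_le _).trans (norm_shadow_le hB j t)

theorem norm_shadowHat_apply_le (hρ : IsDensity ρ) (hB : ∀ i q, IsReflection (B i q))
    (j : Fin S.l) (t : Fin r) : ‖shadowHat S B j t (purify hρ)‖ ≤ 1 := by
  have h := (shadowHat S B j t).le_of_opNorm_le (norm_shadowHat_le hB j t) (purify hρ)
  rwa [norm_purify, one_mul] at h

theorem shadowHat_comm (j : Fin S.l) (t : Fin r) (T : Ell2 (α t) →L[ℂ] Ell2 (α t)) :
    Commute (shadowHat S B j t) (playerHom α t T) :=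
  (shadow_comm j t T).map (amplHom (∀ i, α i) (∀ i, α i))

theorem corr_inl (hρ : IsDensity ρ) (hB : ∀ i q, IsReflection (B i q)) {j : Fin S.l} {t : Fin r}
    {q : Fin 4} (hq : ask (S.pauli j t) = some q) :
    corr S ρ B (.inl j) =
      (inner ℂ (playerHom α t (B t q) (purify hρ)) (shadowHat S B j t (purify hρ))).re := by
  rw [corr, roundOp_inl j t, re_trAt_shadow hρ hB, hq, ← inner_conj_symm, Complex.conj_re]
  rfl

/-- The operators `h_1`, …, `h_4` of one player are the four terms of a CHSH expression: her
questions `2`, `3` against the two shadows of `g_X` and `g_Z`, with the minus sign coming from `h_4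
= -g_Z`. -/
theorem chsh_le (hρ : IsDensity ρ) (hB : ∀ i q, IsReflection (B i q)) (t : Fin r) :
    ‖((√2 / 2 : ℝ) : ℂ) • (playerHom α t (B t 2) (purify hρ) + playerHom α t (B t 3) (purify hρ)) -
        shadowHat S B (S.gX t) t (purify hρ)‖ ^ 2 +
      ‖((√2 / 2 : ℝ) : ℂ) • (playerHom α t (B t 2) (purify hρ) -
        playerHom α t (B t 3) (purify hρ)) - shadowHat S B (S.gZ t) t (purify hρ)‖ ^ 2 ≤
      √2 * (2 * √2 - ∑ j, corr S ρ B (.inr (t, j))) := by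
  have h := chsh_sos (norm_shadowHat_apply_le hρ hB (S.gX t) t)
    (norm_shadowHat_apply_le hρ hB (S.gZ t) t) (norm_player_le hρ t (hB t 2))
    (norm_player_le hρ t (hB t 3))
  refine h.trans (le_of_eq ?_)
  rw [Fin.sum_univ_four]
  simp only [corr, roundOp_inr, trAt_smul hρ]
  simp [specialGen, re_trAt_shadow hρ hB, ZMod.val_one, shadowHat]
  ring

/-- An identity and not merely a bound. The weights are the probabilities of a round, `1/(2l)` or
`1/(8r)`, times the `1/2` from the acceptance probability. Once each deficit is known to be
nonnegative, it yields both the optimality of `omegaS` and a bound on each deficit separately. -/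
theorem omegaS_sub_gameValue (hρ : IsDensity ρ) (hr : 0 < r) (p : ℝ) :
    omegaS - gameValue S p ρ B = ∑ j, (1 - corr S ρ B (.inl j)) / (4 * S.l) +
      ∑ t, (2 * √2 - ∑ j, corr S ρ B (.inr (t, j))) / (16 * r) := by
  have hl : (S.l : ℝ) ≠ 0 := Nat.cast_ne_zero.2 (generators_pos S hr).ne'
  have hr' : (r : ℝ) ≠ 0 := Nat.cast_ne_zero.2 hr.ne'
  rw [gameValue_eq S hρ, Fintype.sum_sum_type, Fintype.sum_prod_type]
  have h1 : ∑ j : Fin S.l, (1 - corr S ρ B (.inl j)) / (4 * S.l) +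
      ∑ j : Fin S.l, roundProb S (.inl j) * ((1 + (trAt ρ (roundOp S B (.inl j))).re) / 2) =
        1 / 2 := by
    rw [← Finset.sum_add_distrib]
    have : ∀ j : Fin S.l, (1 - corr S ρ B (.inl j)) / (4 * S.l) +
        roundProb S (.inl j) * ((1 + (trAt ρ (roundOp S B (.inl j))).re) / 2) =
          1 / (2 * S.l) := by
      intro j
      simp only [roundProb, corr]
      field_simp
      ring
    simp only [this, Finset.sum_const, Finset.card_univ, Fintype.card_fin, nsmul_eq_mul]
    field_simp
  have h2 : ∑ t : Fin r, (2 * √2 - ∑ j, corr S ρ B (.inr (t, j))) / (16 * r) +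
      ∑ t : Fin r, ∑ j, roundProb S (.inr (t, j)) *
        ((1 + (trAt ρ (roundOp S B (.inr (t, j)))).re) / 2) = (2 + √2) / 8 := by
    rw [← Finset.sum_add_distrib]
    have : ∀ t : Fin r, (2 * √2 - ∑ j, corr S ρ B (.inr (t, j))) / (16 * r) +
        ∑ j, roundProb S (.inr (t, j)) * ((1 + (trAt ρ (roundOp S B (.inr (t, j)))).re) / 2) =
          (2 + √2) / (8 * r) := by
      intro t
      simp only [roundProb, corr, Fin.sum_univ_four]
      field_simp
      ring
    simp only [this, Finset.sum_const, Finset.card_univ, Fintype.card_fin, nsmul_eq_mul]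
    field_simp
  rw [omegaS]
  linarith

theorem chsh_deficit_nonneg (hρ : IsDensity ρ) (hB : ∀ i q, IsReflection (B i q)) (t : Fin r) :
    0 ≤ 2 * √2 - ∑ j, corr S ρ B (.inr (t, j)) := by
  have h := (add_nonneg (sq_nonneg _) (sq_nonneg _)).trans (chsh_le (S := S) hρ hB t)
  exact nonneg_of_mul_nonneg_right h (by positivity)

theorem gameValue_le (hρ : IsDensity ρ) (hB : ∀ i q, IsReflection (B i q)) (hr : 0 < r) (p : ℝ) :
    gameValue S p ρ B ≤ omegaS := by
  rw [← sub_nonneg, omegaS_sub_gameValue hρ hr]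
  refine add_nonneg (Finset.sum_nonneg fun j _ => div_nonneg ?_ (by positivity))
    (Finset.sum_nonneg fun t _ => div_nonneg (chsh_deficit_nonneg hρ hB t) (by positivity))
  linarith [(abs_le.1 (abs_corr_le hρ hB (.inl j))).2]

theorem gameValue_nonneg (hρ : IsDensity ρ) (hB : ∀ i q, IsReflection (B i q)) (p : ℝ) :
    0 ≤ gameValue S p ρ B := by
  rw [gameValue_eq S hρ]
  refine Finset.sum_nonneg fun s _ => mul_nonneg ?_ ?_
  · cases s <;> simp only [roundProb] <;> positivity
  · have := (abs_le.1 (abs_corr_le hρ hB s)).1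
    rw [corr] at this
    linarith

theorem deficit_inl_le (hρ : IsDensity ρ) (hB : ∀ i q, IsReflection (B i q)) (hr : 0 < r) {p η : ℝ}
    (hη : omegaS - η ≤ gameValue S p ρ B) (j : Fin S.l) :
    1 - corr S ρ B (.inl j) ≤ 4 * S.l * η := by
  have hl : (0 : ℝ) < S.l := Nat.cast_pos.2 (generators_pos S hr)
  have h := omegaS_sub_gameValue (B := B) (S := S) hρ hr p
  have h0 : ∀ j ∈ (Finset.univ : Finset (Fin S.l)), 0 ≤ (1 - corr S ρ B (.inl j)) / (4 * S.l) :=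
    fun j _ => div_nonneg (by linarith [(abs_le.1 (abs_corr_le hρ hB (.inl j))).2])
      (by positivity)
  have h1 := Finset.single_le_sum h0 (Finset.mem_univ j)
  have h2 : 0 ≤ ∑ t, (2 * √2 - ∑ j, corr S ρ B (.inr (t, j))) / (16 * r) :=
    Finset.sum_nonneg fun t _ => div_nonneg (chsh_deficit_nonneg hρ hB t) (by positivity)
  have h3 : (1 - corr S ρ B (.inl j)) / (4 * S.l) ≤ η := by linarith
  rw [div_le_iff₀ (by positivity)] at h3
  linarith

theorem deficit_inr_le (hρ : IsDensity ρ) (hB : ∀ i q, IsReflection (B i q)) (hr : 0 < r) {p η : ℝ}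
    (hη : omegaS - η ≤ gameValue S p ρ B) (t : Fin r) :
    2 * √2 - ∑ j, corr S ρ B (.inr (t, j)) ≤ 16 * r * η := by
  have hr' : (0 : ℝ) < r := Nat.cast_pos.2 hr
  have h := omegaS_sub_gameValue (B := B) (S := S) hρ hr p
  have h0 : ∀ t ∈ (Finset.univ : Finset (Fin r)),
      0 ≤ (2 * √2 - ∑ j, corr S ρ B (.inr (t, j))) / (16 * r) :=
    fun t _ => div_nonneg (chsh_deficit_nonneg hρ hB t) (by positivity)
  have h1 := Finset.single_le_sum h0 (Finset.mem_univ t)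
  have h2 : 0 ≤ ∑ j, (1 - corr S ρ B (.inl j)) / (4 * S.l) :=
    Finset.sum_nonneg fun j _ => div_nonneg
      (by linarith [(abs_le.1 (abs_corr_le hρ hB (.inl j))).2]) (by positivity)
  have h3 : (2 * √2 - ∑ j, corr S ρ B (.inr (t, j))) / (16 * r) ≤ η := by linarith
  rw [div_le_iff₀ (by positivity)] at h3
  linarith

/-- The loss factor in the rigidity of the stabilizer game. -/
def lossFactor (r : ℕ) : ℝ := 16 * 4 ^ r + 32 * r

theorem lossFactor_bound (S : XZStabilizer r) : (8 : ℝ) * S.l + 32 * r ≤ lossFactor r := by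
  have h : (S.l : ℝ) ≤ 2 * 4 ^ r := by exact_mod_cast card_generators_le S
  rw [lossFactor]
  linarith

/-- In a nearly optimal strategy the reflections for the questions `0`, `1` act like the other
players' parts of the generators. -/
theorem stDist_shadow_le (hρ : IsDensity ρ) (hB : ∀ i q, IsReflection (B i q)) (hr : 0 < r)
    {p η : ℝ} (hη0 : 0 ≤ η) (hη : omegaS - η ≤ gameValue S p ρ B) {j : Fin S.l} {t : Fin r}
    {q : Fin 4} (hq : ask (S.pauli j t) = some q) :
    stDist (purify hρ) (playerHom α t (B t q)) (shadowHat S B j t) ≤ √(lossFactor r * η) := by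
  refine Real.le_sqrt_of_sq_le ?_
  have h := norm_sub_sq_le (norm_player_le hρ t (hB t q)) (norm_shadowHat_apply_le hρ hB j t)
  rw [← corr_inl hρ hB hq] at h
  have h1 := deficit_inl_le hρ hB hr hη j
  have h2 := mul_le_mul_of_nonneg_right (lossFactor_bound S) hη0
  have h3 : 0 ≤ 32 * r * η := by positivity
  rw [stDist]
  linarith

/-- The four hypotheses of `stDist_anti_of_chsh` come from the two generator deficits of `g_X`,
`g_Z` and from the two squares in the CHSH deficit of player `t`. -/
theorem stDist_anti_le (hρ : IsDensity ρ) (hB : ∀ i q, IsReflection (B i q)) (hr : 0 < r)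
    {p η : ℝ} (hη0 : 0 ≤ η) (hη : omegaS - η ≤ gameValue S p ρ B) (t : Fin r) :
    stDist (purify hρ) (playerHom α t (B t 0) * playerHom α t (B t 1))
      (-(playerHom α t (B t 1) * playerHom α t (B t 0))) ≤ 10 * √(lossFactor r * η) := by
  have hR := fun q => (hB t q).map (playerHom α t)
  have hsq : ∀ x y : ℝ, x ^ 2 + y ^ 2 ≤ lossFactor r * η →
      x ≤ √(lossFactor r * η) ∧ y ≤ √(lossFactor r * η) := fun x y h =>
    ⟨Real.le_sqrt_of_sq_le (by nlinarith [sq_nonneg y]),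
      Real.le_sqrt_of_sq_le (by nlinarith [sq_nonneg x])⟩
  have h1 := chsh_le (S := S) hρ hB t
  have h2 := deficit_inr_le hρ hB hr hη t
  have h3 : √2 * (2 * √2 - ∑ j, corr S ρ B (.inr (t, j))) ≤ lossFactor r * η := by
    have h4 : √2 ≤ 2 := Real.sqrt_le_iff.2 ⟨by norm_num, by norm_num⟩
    have h5 := mul_le_mul_of_nonneg_right (lossFactor_bound S) hη0
    have h6 : 0 ≤ (8 : ℝ) * S.l * η := by positivity
    have h7 := chsh_deficit_nonneg (S := S) hρ hB t
    nlinarith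
  obtain ⟨h4, h5⟩ := hsq _ _ (h1.trans h3)
  exact stDist_anti_of_chsh (hR 0).norm_le (hR 1).norm_le (hR 2).norm_le (hR 3).norm_le
    (norm_shadowHat_le hB (S.gX t) t) (norm_shadowHat_le hB (S.gZ t) t) (hR 2).2 (hR 3).2
    (shadowHat_comm _ _ _) (shadowHat_comm _ _ _) (shadowHat_comm _ _ _)
    (shadowHat_comm _ _ _) (shadowHat_comm _ _ _) (shadowHat_comm _ _ _)
    (stDist_shadow_le hρ hB hr hη0 hη (by rw [S.gX_spec]; rfl))
    (stDist_shadow_le hρ hB hr hη0 hη (by rw [S.gZ_spec]; rfl)) h4 h5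

end Rigidity

/-! ### Projective measurements -/

section PVM

variable {α β : Type*} [Fintype β] {M : β → (Ell2 α →L[ℂ] Ell2 α)}

theorem norm_sq_starProjection {P : Ell2 α →L[ℂ] Ell2 α} (hP : IsStarProjection P) (φ : Ell2 α) :
    (inner ℂ φ (P φ)).re = ‖P φ‖ ^ 2 := by
  have h1 : star P * P = P := by rw [hP.isSelfAdjoint.star_eq, hP.isIdempotentElem.eq]
  have h2 : inner ℂ (P φ) (P φ) = inner ℂ φ (P φ) := by
    rw [← ContinuousLinearMap.adjoint_inner_right]
    exact congrArg (inner ℂ φ) (congrArg (fun S => S φ) h1)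
  rw [← h2]
  exact inner_self_eq_norm_sq (𝕜 := ℂ) _

/-- For `φ` in the range of `M c`, the numbers `‖M d φ‖²` add up to `‖φ‖²`, and the term `d = c`
already accounts for all of it. -/
theorem pvm_mul_eq_zero (hM : ∀ b, IsStarProjection (M b)) (hsum : ∑ b, M b = 1) {b c : β}
    (hbc : b ≠ c) : M b * M c = 0 := by
  classical
  refine ContinuousLinearMap.ext fun ψ => ?_
  change M b (M c ψ) = 0
  set φ := M c ψ
  have hφ : M c φ = φ := congrArg (fun S => S ψ) (hM c).isIdempotentElem.eq
  have h1 : ∑ d, ‖M d φ‖ ^ 2 = ‖φ‖ ^ 2 := by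
    have h2 := congrArg (fun S => (inner ℂ φ (S φ)).re) hsum
    simp only [sum_apply, inner_sum, Complex.re_sum, norm_sq_starProjection (hM _),
      one_apply_eq_self] at h2
    rw [h2]
    exact inner_self_eq_norm_sq (𝕜 := ℂ) _
  rw [Fintype.sum_eq_add_sum_compl c, hφ] at h1
  have h3 : ‖M b φ‖ ^ 2 ≤ ∑ d ∈ {c}ᶜ, ‖M d φ‖ ^ 2 :=
    Finset.single_le_sum (f := fun d => ‖M d φ‖ ^ 2) (fun _ _ => sq_nonneg _) (by simpa using hbc)
  have h4 : ‖M b φ‖ ^ 2 = 0 := le_antisymm (by linarith) (sq_nonneg _)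
  simpa using h4

/-- The functional calculus of a projective measurement. -/
def pvmHom (hM : ∀ b, IsStarProjection (M b)) (hsum : ∑ b, M b = 1) :
    (β → ℂ) →⋆ₐ[ℂ] (Ell2 α →L[ℂ] Ell2 α) where
  toFun f := ∑ b, f b • M b
  map_one' := by simpa using hsum
  map_mul' f g := by
    classical
    rw [Finset.sum_mul]
    refine Finset.sum_congr rfl fun b _ => ?_
    rw [Finset.mul_sum, Finset.sum_eq_single b]
    · rw [smul_mul_smul_comm, (hM b).isIdempotentElem.eq]
      rfl
    · intro c _ hc
      rw [smul_mul_smul_comm, pvm_mul_eq_zero hM hsum hc.symm, smul_zero]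
    · simp
  map_zero' := by simp
  map_add' f g := by simp [add_smul, Finset.sum_add_distrib]
  commutes' c := by
    simp only [Pi.algebraMap_apply, Algebra.algebraMap_self, RingHom.id_apply, ← Finset.smul_sum,
      hsum]
    rfl
  map_star' f := by
    rw [star_sum]
    refine Finset.sum_congr rfl fun b _ => ?_
    rw [star_smul, (hM b).isSelfAdjoint.star_eq]
    rfl

theorem pvmHom_apply (hM : ∀ b, IsStarProjection (M b)) (hsum : ∑ b, M b = 1) (f : β → ℂ) :
    pvmHom hM hsum f = ∑ b, f b • M b := rfl

theorem isReflection_pvmHom (hM : ∀ b, IsStarProjection (M b)) (hsum : ∑ b, M b = 1) {f : β → ℂ}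
    (hf : ∀ b, f b = 1 ∨ f b = -1) : IsReflection (pvmHom hM hsum f) := by
  constructor
  · rw [isSelfAdjoint_iff, ← map_star]
    congr 1
    funext b
    rcases hf b with h | h <;> simp [h]
  · rw [← map_mul, ← map_one (pvmHom hM hsum)]
    congr 1
    funext b
    rcases hf b with h | h <;> simp [h]

end PVM

/-! ### From averages to individual terms -/

section Averages

variable {ι : Type*} [Fintype ι]

/-- All the deficits `ω - f i` are nonnegative, so a single weighted one is at most their weighted
sum. -/
theorem weighted_deficit {q f : ι → ℝ} {ω ε : ℝ} (hq : ∀ i, 0 ≤ q i) (hq1 : ∑ i, q i = 1)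
    (hf : ∀ i, f i ≤ ω) (h : ω - ε ≤ ∑ i, q i * f i) (i : ι) : q i * (ω - f i) ≤ ε := by
  have h1 : ∑ i, q i * (ω - f i) = ω - ∑ i, q i * f i := by
    simp only [mul_sub, Finset.sum_sub_distrib, ← Finset.sum_mul, hq1, one_mul]
  have h2 := Finset.single_le_sum (f := fun i => q i * (ω - f i))
    (fun i _ => mul_nonneg (hq i) (sub_nonneg.2 (hf i))) (Finset.mem_univ i)
  linarith

theorem weighted_le {q f : ι → ℝ} {ω : ℝ} (hq : ∀ i, 0 ≤ q i) (hq1 : ∑ i, q i = 1)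
    (hf : ∀ i, f i ≤ ω) : ∑ i, q i * f i ≤ ω := by
  calc ∑ i, q i * f i ≤ ∑ i, q i * ω :=
        Finset.sum_le_sum fun i _ => mul_le_mul_of_nonneg_left (hf i) (hq i)
    _ = ω := by rw [← Finset.sum_mul, hq1, one_mul]

theorem expect_eq_weighted (f : ι → ℝ) :
    (𝔼 i, f i) = ∑ i, (Fintype.card ι : ℝ)⁻¹ * f i := by
  rw [Fintype.expect_eq_sum_div_card, div_eq_inv_mul, Finset.mul_sum]

variable [Nonempty ι]

theorem sum_inv_card : ∑ _i : ι, (Fintype.card ι : ℝ)⁻¹ = 1 := by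
  simp

theorem expect_le_of_le {f : ι → ℝ} {ω : ℝ} (hf : ∀ i, f i ≤ ω) : (𝔼 i, f i) ≤ ω := by
  rw [expect_eq_weighted]
  exact weighted_le (fun _ => by positivity) sum_inv_card hf

theorem expect_deficit {f : ι → ℝ} {ω ε : ℝ} (hf : ∀ i, f i ≤ ω) (h : ω - ε ≤ 𝔼 i, f i) (i : ι) :
    ω - Fintype.card ι * ε ≤ f i := by
  rw [expect_eq_weighted] at h
  have h1 := weighted_deficit (fun _ => by positivity) sum_inv_card hf h i
  have hc : (0 : ℝ) < Fintype.card ι := Nat.cast_pos.2 Fintype.card_pos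
  rw [inv_mul_le_iff₀ hc] at h1
  linarith

/-- Resampling one coordinate does not change an average over independent samples. -/
theorem sum_resample {ι X : Type*} [Fintype ι] [DecidableEq ι] [Fintype X] {q : X → ℝ}
    (hq : ∑ x, q x = 1) (u : ι) (F : (ι → X) → ℝ) :
    ∑ σ : ι → X, (∏ v, q (σ v)) * F σ =
      ∑ σ : ι → X, (∏ v, q (σ v)) * ∑ x, q x * F (Function.update σ u x) := by
  have h1 : ∀ (σ : ι → X) (x : X), (∏ v, q (Function.update σ u x v)) * q (σ u) =
      (∏ v, q (σ v)) * q x := by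
    intro σ x
    have h2 : ∀ τ : ι → X, ∏ v, q (τ v) = q (τ u) * ∏ v ∈ {u}ᶜ, q (τ v) := fun τ =>
      Fintype.prod_eq_mul_prod_compl u _
    have h3 : ∏ v ∈ {u}ᶜ, q (Function.update σ u x v) = ∏ v ∈ {u}ᶜ, q (σ v) :=
      Finset.prod_congr rfl fun v hv => by rw [Function.update_of_ne (by simpa using hv)]
    rw [h2 (Function.update σ u x), h2 σ, h3, Function.update_self]
    ring
  -- Exchanging the coordinate `u` with the fresh sample is an involution that preserves the product
  -- weight.
  let e : (ι → X) × X → (ι → X) × X := fun z => (Function.update z.1 u z.2, z.1 u)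
  have he : Function.Involutive e := by
    rintro ⟨σ, x⟩
    simp [e]
  have h4 := Fintype.sum_equiv he.toPerm
    (fun z : (ι → X) × X => (∏ v, q (z.1 v)) * (q z.2 * F (Function.update z.1 u z.2)))
    (fun z : (ι → X) × X => (∏ v, q (z.1 v)) * q z.2 * F z.1) (fun z => by
      change _ = (∏ v, q (Function.update z.1 u z.2 v)) * q (z.1 u) * F (Function.update z.1 u z.2)
      rw [h1, mul_assoc])
  rw [Fintype.sum_prod_type, Fintype.sum_prod_type] at h4
  simp only [← Finset.mul_sum, ← Finset.sum_mul, hq, mul_one] at h4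
  exact h4.symm

end Averages

/-! ### The two tests of the multi-qubit game -/

section Tests

variable {r k n : ℕ} {α : Fin r → Type u} (S : XZStabilizer r) (s : Strategy k n α)

/-- The reflection for the answer bit of the qubit `u` in a measurement of several qubits. -/
def bitRefl (i : Fin r) (J : KSubset n k) (w : J.1 → Fin 4) (u : J.1) :
    Ell2 (α i) →L[ℂ] Ell2 (α i) :=
  pvmHom (s.isProj i J w) (s.sum_M i J w) fun b => (-1) ^ (b u).val

theorem neg_one_pow_cases (m : ℕ) : (-1 : ℂ) ^ m = 1 ∨ (-1 : ℂ) ^ m = -1 :=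
  neg_one_pow_eq_or ℂ m

theorem isReflection_bitRefl (i : Fin r) (J : KSubset n k) (w : J.1 → Fin 4) (u : J.1) :
    IsReflection (bitRefl s i J w u) :=
  isReflection_pvmHom _ _ fun _ => neg_one_pow_cases _

theorem effect_bitRefl (i : Fin r) (J : KSubset n k) (w : J.1 → Fin 4) (u : J.1) (a : ZMod 2) :
    effect (bitRefl s i J w u) a = ∑ b, if b u = a then s.M i J w b else 0 := by
  have h : ∀ b : J.1 → ZMod 2, (if b u = a then s.M i J w b else 0) =
      (1 / 2 : ℂ) • (s.M i J w b + (-1 : ℂ) ^ a.val • ((-1 : ℂ) ^ (b u).val • s.M i J w b)) := by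
    intro b
    have h1 := congrArg (fun c : ℂ => c • s.M i J w b) (ite_eq_zmod (b u) a)
    simp only [ite_smul, one_smul, zero_smul, mul_smul, add_smul] at h1
    exact h1
  simp only [h, ← Finset.smul_sum, Finset.sum_add_distrib, s.sum_M]
  rfl

/-- The reflections in the first test: those for the qubit `u`, except that player `t` uses her
answer bit for `u` in a measurement of several qubits. -/
def multiFamily (J : KSubset n k) (u : J.1) (t : Fin r) (w : J.1 → Fin 4) (i : Fin r) (q : Fin 4) :
    Ell2 (α i) →L[ℂ] Ell2 (α i) :=
  if i = t then bitRefl s i J (Function.update w u q) u else s.R i (u, q)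

theorem isReflection_multiFamily (J : KSubset n k) (u : J.1) (t : Fin r) (w : J.1 → Fin 4)
    (i : Fin r) (q : Fin 4) : IsReflection (multiFamily s J u t w i q) := by
  rw [multiFamily]
  split_ifs
  · exact isReflection_bitRefl s _ _ _ _
  · exact s.isReflection _ _

theorem tensorOp_update (A : ∀ i, Ell2 (α i) →L[ℂ] Ell2 (α i)) (t : Fin r)
    (T : Ell2 (α t) →L[ℂ] Ell2 (α t)) :
    tensorOp (Function.update A t T) = tensorOp (Function.update A t 1) * onPlayer t T := by
  rw [tensorOp_update_mul _ t, Function.update_idem, Function.update_self]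

open Classical in
-- The sum over the joint outcomes `b` with `b u = a t` assembles the effect of the bit reflection,
-- so the first test becomes an ordinary stabilizer game on the qubit `u` with the family
-- `multiFamily`.
theorem multi_accept (J : KSubset n k) (u : J.1) (t : Fin r) (σ : J.1 → Sample S) :
    (∑ a : Fin r → ZMod 2, ∑ b : J.1 → ZMod 2,
        if b u = a t ∧ Accepts S (σ u).1 a then
          (trAt s.ρ (tensorOp fun i =>
            if i = t then s.M i J (fun v => question S (σ v) i) b
            else effect (s.R i (u, question S (σ u) i)) (a i))).re
        else 0) =
      ∑ a : Fin r → ZMod 2, if Accepts S (σ u).1 a then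
        (trAt s.ρ (tensorOp fun i => effect (multiFamily s J u t (fun v => question S (σ v) t) i
          (question S (σ u) i)) (a i))).re else 0 := by
  refine Finset.sum_congr rfl fun a _ => ?_
  by_cases hacc : Accepts S (σ u).1 a
  swap
  · simp [hacc]
  simp only [hacc, and_true, if_true]
  set E : ∀ i, Ell2 (α i) →L[ℂ] Ell2 (α i) := fun i => effect (multiFamily s J u t
    (fun v => question S (σ v) t) i (question S (σ u) i)) (a i) with hE
  have h1 : ∀ b, (tensorOp fun i =>
      if i = t then s.M i J (fun v => question S (σ v) i) b
      else effect (s.R i (u, question S (σ u) i)) (a i)) =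
        tensorOp (Function.update E t 1) * onPlayer t (s.M t J (fun v => question S (σ v) t) b) := by
    intro b
    rw [← tensorOp_update]
    congr 1
    funext i
    by_cases h : i = t
    · subst h; simp
    · simp [h, hE, multiFamily]
  have h2 : E t = ∑ b, if b u = a t then s.M t J (fun v => question S (σ v) t) b else 0 := by
    rw [← effect_bitRefl]
    simp only [hE, multiFamily, if_true]
    rw [Function.update_eq_self_iff.2 rfl]
  have h3 : tensorOp E = ∑ b, if b u = a t then tensorOp (Function.update E t 1) *
      onPlayer t (s.M t J (fun v => question S (σ v) t) b) else 0 := by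
    rw [tensorOp_update_mul E t, h2, ← onPlayerHom_apply, map_sum, Finset.mul_sum]
    refine Finset.sum_congr rfl fun b _ => ?_
    split_ifs
    · rfl
    · rw [map_zero, mul_zero]
  rw [h3, trAt_sum s.isDensity, Complex.re_sum]
  refine Finset.sum_congr rfl fun b _ => ?_
  rw [h1]
  split_ifs
  · rfl
  · simp [trAt_eq s.isDensity, ← amplHom_apply]

theorem sum_roundProb (hr : 0 < r) : ∑ x, roundProb S x = 1 := by
  have hl : (S.l : ℝ) ≠ 0 := Nat.cast_ne_zero.2 (generators_pos S hr).ne'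
  have hr' : (r : ℝ) ≠ 0 := Nat.cast_ne_zero.2 hr.ne'
  rw [Fintype.sum_sum_type, Fintype.sum_prod_type]
  simp only [roundProb, Finset.sum_const, Finset.card_univ, Fintype.card_fin, nsmul_eq_mul]
  field_simp
  norm_num

theorem sum_sampleProb (hr : 0 < r) (p : ℝ) : ∑ x, sampleProb S p x = 1 := by
  rw [Fintype.sum_prod_type]
  simp only [sampleProb, ← Finset.mul_sum, sum_null, mul_one]
  exact sum_roundProb S hr

theorem sampleProb_nonneg {p : ℝ} (hp : p ∈ Set.Icc (0 : ℝ) 1) (x : Sample S) :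
    0 ≤ sampleProb S p x := by
  refine mul_nonneg ?_ (Finset.prod_nonneg fun i _ => ?_)
  · cases x.1 <;> simp only [roundProb] <;> positivity
  · split_ifs
    · exact hp.1
    · linarith [hp.2]

theorem multiTest_eq (hr : 0 < r) (p : ℝ) :
    multiTest S p s = 𝔼 J : KSubset n k, 𝔼 u : J.1, 𝔼 t : Fin r, ∑ σ : J.1 → Sample S,
      (∏ v, sampleProb S p (σ v)) *
        gameValue S p s.ρ (multiFamily s J u t fun v => question S (σ v) t) := by
  classical
  refine Finset.expect_congr rfl fun J _ => Finset.expect_congr rfl fun u _ =>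
    Finset.expect_congr rfl fun t _ => ?_
  simp only [multi_accept]
  -- The measurement of player `t` depends on her question for `u` as well. Resampling only the
  -- coordinate `u` fixes her questions for the other qubits and leaves a genuine game strategy, in
  -- which her question for `u` is inserted by `Function.update`.
  rw [sum_resample (sum_sampleProb S hr p) u]
  refine Finset.sum_congr rfl fun σ _ => ?_
  congr 1
  refine Finset.sum_congr rfl fun x _ => ?_
  have h1 : ∀ i q, multiFamily s J u t
      (fun v => question S (Function.update σ u x v) t) i q =
        multiFamily s J u t (fun v => question S (σ v) t) i q := by
    intro i q
    have h2 : Function.update (fun v => question S (Function.update σ u x v) t) u q =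
        Function.update (fun v => question S (σ v) t) u q := by
      funext v
      by_cases h : v = u
      · subst h; simp
      · simp [h]
    by_cases h : i = t
    · subst h
      simp only [multiFamily, if_true, h2]
    · simp only [multiFamily, h, if_false]
  simp only [h1, Function.update_self]

theorem singleTest_eq (p : ℝ) :
    singleTest S p s = 𝔼 u : Fin n, gameValue S p s.ρ fun i q => s.R i (u, q) := rfl

variable {S}

theorem prod_sampleProb {p : ℝ} (hp : p ∈ Set.Icc (0 : ℝ) 1) (hr : 0 < r) (J : Finset (Fin n)) :
    (∀ σ : J → Sample S, 0 ≤ ∏ v, sampleProb S p (σ v)) ∧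
      ∑ σ : J → Sample S, ∏ v, sampleProb S p (σ v) = 1 := by
  refine ⟨fun σ => Finset.prod_nonneg fun v _ => sampleProb_nonneg S hp _, ?_⟩
  have h := Finset.prod_univ_sum (fun _ : J => (Finset.univ : Finset (Sample S)))
    (fun _ x => sampleProb S p x)
  rw [Fintype.piFinset_univ] at h
  rw [← h]
  simp [sum_sampleProb S hr p]

/-- A round of the first kind with likely replacements of the null questions. -/
def likelySample (S : XZStabilizer r) (p : ℝ) (j : Fin S.l) : Sample S :=
  (.inl j, fun _ => if 1 / 2 ≤ p then 1 else 0)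

/-- A given generator has probability `1/(2l) ≥ 1/(4 * 4 ^ r)`, and each of the `r` replacements is
the likelier one, of probability at least `1/2`. This makes the bound uniform in `p`, including `p =
0` and `p = 1`. -/
theorem sampleProb_likely (hr : 0 < r) (p : ℝ) (j : Fin S.l) :
    1 / (4 * 8 ^ r) ≤ sampleProb S p (likelySample S p j) := by
  have hl : (0 : ℝ) < S.l := Nat.cast_pos.2 (generators_pos S hr)
  have h1 : (S.l : ℝ) ≤ 2 * 4 ^ r := by exact_mod_cast card_generators_le S
  have h2 : (1 / 2 : ℝ) ≤ if (if 1 / 2 ≤ p then (1 : Fin 2) else 0) = 1 then p else 1 - p := by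
    by_cases h : 1 / 2 ≤ p
    · simp only [h, if_true]
    · simp only [h, if_false, zero_ne_one]
      linarith
  have h3 : (1 / 2 : ℝ) ^ r ≤
      ∏ _i : Fin r, if (if 1 / 2 ≤ p then (1 : Fin 2) else 0) = 1 then p else 1 - p := by
    rw [Finset.prod_const, Finset.card_univ, Fintype.card_fin]
    exact pow_le_pow_left₀ (by norm_num) h2 r
  have h4 : 1 / (4 * 4 ^ r) ≤ (1 / 2 * (1 / (S.l : ℝ))) := by
    rw [← one_div_mul_one_div_rev, one_div_mul_one_div_rev, one_div_mul_one_div_rev]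
    exact one_div_le_one_div_of_le (by positivity) (by linarith)
  calc (1 : ℝ) / (4 * 8 ^ r) = 1 / (4 * 4 ^ r) * (1 / 2) ^ r := by
        rw [show (8 : ℝ) = 4 * 2 by norm_num, mul_pow, one_div_pow]
        field_simp
    _ ≤ _ := mul_le_mul h4 h3 (by positivity) (by positivity)

/-- The loss factor in the first test. -/
def multiLoss (r k : ℕ) : ℝ := 2 * k * r * (4 * 8 ^ r) ^ k

variable {s}

theorem singleTest_le (hr : 0 < r) (hn : 0 < n) (p : ℝ) : singleTest S p s ≤ omegaS := by
  have : Nonempty (Fin n) := ⟨⟨0, hn⟩⟩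
  rw [singleTest_eq]
  exact expect_le_of_le fun u => gameValue_le s.isDensity (fun i q => s.isReflection i _) hr p

theorem multiTest_inner_le (hr : 0 < r) {p : ℝ} (hp : p ∈ Set.Icc (0 : ℝ) 1) (J : KSubset n k)
    (u : J.1) (t : Fin r) : ∑ σ : J.1 → Sample S, (∏ v, sampleProb S p (σ v)) *
        gameValue S p s.ρ (multiFamily s J u t fun v => question S (σ v) t) ≤ omegaS :=
  weighted_le (prod_sampleProb hp hr J.1).1 (prod_sampleProb hp hr J.1).2 fun _ =>
    gameValue_le s.isDensity (isReflection_multiFamily s J u t _) hr p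

theorem nonempty_kSubset (hkn : k ≤ n) : Nonempty (KSubset n k) := by
  obtain ⟨J, -, hJ⟩ := Finset.exists_subset_card_eq (s := (Finset.univ : Finset (Fin n)))
    (by simpa using hkn)
  exact ⟨⟨J, hJ⟩⟩

theorem nonempty_of_kSubset (hk : 0 < k) (J : KSubset n k) : Nonempty J.1 :=
  (Finset.card_pos.1 (hk.trans_eq J.2.symm)).to_subtype

theorem multiTest_le (hr : 0 < r) (hk : 0 < k) (hkn : k ≤ n) {p : ℝ}
    (hp : p ∈ Set.Icc (0 : ℝ) 1) : multiTest S p s ≤ omegaS := by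
  have : Nonempty (Fin r) := ⟨⟨0, hr⟩⟩
  have := nonempty_kSubset hkn
  rw [multiTest_eq S s hr]
  refine expect_le_of_le fun J => ?_
  have := nonempty_of_kSubset hk J
  exact expect_le_of_le fun u => expect_le_of_le fun t => multiTest_inner_le hr hp J u t

theorem value_nonneg (hr : 0 < r) {p : ℝ} (hp : p ∈ Set.Icc (0 : ℝ) 1) : 0 ≤ value S p s := by
  have h1 : 0 ≤ multiTest S p s := by
    rw [multiTest_eq S s hr]
    exact Finset.expect_nonneg fun J _ => Finset.expect_nonneg fun u _ =>
      Finset.expect_nonneg fun t _ => Finset.sum_nonneg fun σ _ =>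
        mul_nonneg ((prod_sampleProb hp hr J.1).1 σ)
          (gameValue_nonneg s.isDensity (isReflection_multiFamily s J u t _) p)
  have h2 : 0 ≤ singleTest S p s :=
    Finset.expect_nonneg fun u _ =>
      gameValue_nonneg s.isDensity (fun i q => s.isReflection i (u, q)) p
  rw [value]
  linarith

theorem single_deficit (hr : 0 < r) (hk : 0 < k) (hkn : k ≤ n) {p ε : ℝ}
    (hp : p ∈ Set.Icc (0 : ℝ) 1) (hε : 0 ≤ ε) (h : omegaS - ε ≤ value S p s) (u : Fin n) :
    omegaS - multiLoss r k * n ^ k * ε ≤ gameValue S p s.ρ fun i q => s.R i (u, q) := by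
  have : Nonempty (Fin n) := ⟨u⟩
  have h1 := multiTest_le (s := s) (S := S) hr hk hkn hp
  have h2 : omegaS - 2 * ε ≤ singleTest S p s := by
    rw [value] at h
    linarith
  rw [singleTest_eq] at h2
  have h3 := expect_deficit
    (fun u => gameValue_le s.isDensity (fun i q => s.isReflection i (u, q)) hr p) h2 u
  refine le_trans ?_ h3
  have hn : (n : ℝ) ≤ n ^ k := by
    exact_mod_cast Nat.le_self_pow hk.ne' n
  have hL : 2 ≤ multiLoss r k := by
    have hk1 : (1 : ℝ) ≤ k := by exact_mod_cast hk
    have hr1 : (1 : ℝ) ≤ r := by exact_mod_cast hr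
    have h8 : (1 : ℝ) ≤ (4 * 8 ^ r) ^ k :=
      one_le_pow₀ (by linarith [one_le_pow₀ (M₀ := ℝ) (a := 8) (n := r) (by norm_num)])
    have h9 : (1 : ℝ) ≤ k * r * (4 * 8 ^ r) ^ k :=
      one_le_mul_of_one_le_of_one_le (one_le_mul_of_one_le_of_one_le hk1 hr1) h8
    rw [multiLoss]
    linarith
  rw [Fintype.card_fin]
  have h10 : 2 * (n : ℝ) ≤ multiLoss r k * n ^ k := mul_le_mul hL hn (by positivity) (by linarith)
  nlinarith

/-- The loss factor collects the weight `1/2` of the test, the choices of `J`, `u` and `t`, and `k`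
independent samples, each of probability at least `1/(4 * 8 ^ r)`. Only the `n.choose k ≤ n ^ k`
sets `J` contribute a dependence on `n`. -/
theorem multi_deficit (hr : 0 < r) (hk : 0 < k) (hkn : k ≤ n) {p ε : ℝ}
    (hp : p ∈ Set.Icc (0 : ℝ) 1) (hε : 0 ≤ ε) (h : omegaS - ε ≤ value S p s) (J : KSubset n k)
    (u : J.1) (t : Fin r) (j : J.1 → Fin S.l) :
    omegaS - multiLoss r k * n ^ k * ε ≤ gameValue S p s.ρ
      (multiFamily s J u t fun v => question S (likelySample S p (j v)) t) := by
  have : Nonempty (Fin r) := ⟨t⟩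
  have : Nonempty (KSubset n k) := ⟨J⟩
  have : ∀ J : KSubset n k, Nonempty J.1 := fun J => nonempty_of_kSubset hk J
  have h1 := singleTest_le (s := s) (S := S) hr (hk.trans_le hkn) p
  -- The single test is at most `omegaS` and has weight `1/2`, so the whole deficit of the other
  -- test is at most `2 * ε`.
  have h2 : omegaS - 2 * ε ≤ multiTest S p s := by
    rw [value] at h
    linarith
  rw [multiTest_eq S s hr] at h2
  have h3 := expect_deficit (fun J => expect_le_of_le fun u => expect_le_of_le fun t =>
    multiTest_inner_le hr hp J u t) h2 J
  have h4 := expect_deficit (fun u => expect_le_of_le fun t =>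
    multiTest_inner_le hr hp J u t) h3 u
  have h5 := expect_deficit (fun t => multiTest_inner_le hr hp J u t) h4 t
  have h6 := weighted_deficit (prod_sampleProb hp hr J.1).1 (prod_sampleProb hp hr J.1).2
    (fun _ => gameValue_le s.isDensity (isReflection_multiFamily s J u t _) hr p) h5
    (fun v => likelySample S p (j v))
  rw [Fintype.card_fin, Fintype.card_coe, J.2, show Fintype.card (KSubset n k) = n.choose k by
    rw [Fintype.card_finset_len, Fintype.card_fin]] at h6
  have h7 : (1 / (4 * 8 ^ r) : ℝ) ^ k ≤ ∏ v, sampleProb S p (likelySample S p (j v)) := by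
    calc (1 / (4 * 8 ^ r) : ℝ) ^ k = ∏ _v : J.1, (1 / (4 * 8 ^ r) : ℝ) := by
          rw [Finset.prod_const, Finset.card_univ, Fintype.card_coe, J.2]
      _ ≤ _ := Finset.prod_le_prod (fun _ _ => by positivity) fun v _ => sampleProb_likely hr p _
  have h8 := gameValue_le s.isDensity (isReflection_multiFamily s J u t
    fun v => question S (likelySample S p (j v)) t) hr p (S := S)
  have h9 : (n.choose k : ℝ) ≤ n ^ k := by exact_mod_cast Nat.choose_le_pow n k
  have h10 := (mul_le_mul_of_nonneg_right h7 (sub_nonneg.2 h8)).trans h6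
  rw [one_div_pow, one_div_mul_eq_div, div_le_iff₀ (by positivity)] at h10
  have h11 : (r : ℝ) * (k * (n.choose k * (2 * ε))) * (4 * 8 ^ r) ^ k ≤
      multiLoss r k * n ^ k * ε := by
    have h12 : 0 ≤ multiLoss r k * ε := by
      rw [multiLoss]
      positivity
    calc (r : ℝ) * (k * (n.choose k * (2 * ε))) * (4 * 8 ^ r) ^ k =
          multiLoss r k * ε * n.choose k := by rw [multiLoss]; ring
      _ ≤ multiLoss r k * ε * n ^ k := mul_le_mul_of_nonneg_left h9 h12
      _ = _ := by ring
  linarith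

end Tests

/-! ### Approximate Pauli relations in a nearly optimal strategy -/

section Relations

variable {r k n : ℕ} {α : Fin r → Type u}

theorem norm_playerHom_le (t : Fin r) {T : Ell2 (α t) →L[ℂ] Ell2 (α t)} (hT : ‖T‖ ≤ 1) :
    ‖playerHom α t T‖ ≤ 1 := by
  refine (norm_ampl_le _).trans (norm_tensorOp_le _ fun i => ?_)
  by_cases h : i = t
  · subst h
    rwa [Function.update_self]
  · rw [Function.update_of_ne h]
    exact IsReflection.one.norm_le

/-- The contractions of player `t`, acting on the purification. -/
def playerMonoid (α : Fin r → Type u) (t : Fin r) :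
    Submonoid (Ell2 ((∀ i, α i) × (∀ i, α i)) →L[ℂ] Ell2 ((∀ i, α i) × (∀ i, α i))) where
  carrier := {A | ∃ T : Ell2 (α t) →L[ℂ] Ell2 (α t), ‖T‖ ≤ 1 ∧ playerHom α t T = A}
  mul_mem' := by
    rintro _ _ ⟨T, hT, rfl⟩ ⟨T', hT', rfl⟩
    exact ⟨T * T', (norm_comp_le_mul hT hT').trans_eq (one_mul 1), map_mul _ _ _⟩
  one_mem' := ⟨1, IsReflection.one.norm_le, map_one _⟩

theorem mem_playerMonoid {t : Fin r} {T : Ell2 (α t) →L[ℂ] Ell2 (α t)} (hT : ‖T‖ ≤ 1) :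
    playerHom α t T ∈ playerMonoid α t := ⟨T, hT, rfl⟩

/-- The generator with `X` (for `w = 0`) or `Z` (for `w = 1`) at the qubit `t`. -/
def chosenGen (S : XZStabilizer r) (t : Fin r) (w : Fin 2) : Fin S.l :=
  if w = 0 then S.gX t else S.gZ t

theorem ask_chosenGen (S : XZStabilizer r) (t : Fin r) (w : Fin 2) :
    ask (S.pauli (chosenGen S t w) t) = some (Fin.castLE (by norm_num) w) := by
  match w with
  | 0 => simp [chosenGen, S.gX_spec, ask]
  | 1 => simp [chosenGen, S.gZ_spec, ask]

/-- The question `X` or `Z`. -/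
def pauliQuestion (w : Fin 2) : Fin 4 := Fin.castLE (by norm_num) w

theorem question_likely (S : XZStabilizer r) (p : ℝ) (t : Fin r) (w : Fin 2) :
    question S (likelySample S p (chosenGen S t w)) t = pauliQuestion w := by
  have h : query S (likelySample S p (chosenGen S t w)).1 t = some (pauliQuestion w) :=
    ask_chosenGen S t w
  rw [question, h, Option.getD_some]

variable {S : XZStabilizer r} {s : Strategy k n α} {η : ℝ}

/-- All the reflections that occur in the game define strategies for the stabilizer game whose
values are at least `omegaS - η`. -/
structure NearOptimal (S : XZStabilizer r) (p : ℝ) (s : Strategy k n α) (η : ℝ) : Prop where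
  pos : 0 < r
  nonneg : 0 ≤ η
  single : ∀ u, omegaS - η ≤ gameValue S p s.ρ fun i q => s.R i (u, q)
  multi : ∀ (J : KSubset n k) (u : J.1) (t : Fin r) (j : J.1 → Fin S.l),
    omegaS - η ≤ gameValue S p s.ρ
      (multiFamily s J u t fun v => question S (likelySample S p (j v)) t)

/-- The part of the chosen generator that belongs to the players other than `t`, measured on the
qubit `u`. -/
def partner (S : XZStabilizer r) (s : Strategy k n α) (t : Fin r) (u : Fin n) (w : Fin 2) :
    Ell2 ((∀ i, α i) × (∀ i, α i)) →L[ℂ] Ell2 ((∀ i, α i) × (∀ i, α i)) :=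
  shadowHat S (fun i q => s.R i (u, q)) (chosenGen S t w) t

/-- The reflection of player `t` for `X` or `Z` on the qubit `u`, acting on the purification. -/
def pauliRefl (s : Strategy k n α) (t : Fin r) (u : Fin n) (w : Fin 2) :
    Ell2 (α t) →L[ℂ] Ell2 (α t) := s.R t (u, pauliQuestion w)

theorem isReflection_pauliRefl (s : Strategy k n α) (t : Fin r) (u : Fin n) (w : Fin 2) :
    IsReflection (pauliRefl s t u w) := s.isReflection t _

theorem shadow_congr {B B' : ∀ i, Fin 4 → (Ell2 (α i) →L[ℂ] Ell2 (α i))} {t : Fin r}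
    (h : ∀ i ≠ t, B i = B' i) (j : Fin S.l) : shadow S B j t = shadow S B' j t := by
  rw [shadow, shadow]
  congr 2
  funext i
  by_cases hi : i = t
  · subst hi; simp
  · simp [hi, h i hi]

variable {p : ℝ} (h : NearOptimal S p s η)
include h

theorem NearOptimal.stDist_partner (t : Fin r) (u : Fin n) (w : Fin 2) :
    stDist (purify s.isDensity) (playerHom α t (pauliRefl s t u w)) (partner S s t u w) ≤
      √(lossFactor r * η) :=
  stDist_shadow_le s.isDensity (fun i q => s.isReflection i (u, q)) h.pos h.nonneg (h.single u)
    (ask_chosenGen S t w)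

/-- In `multiFamily` the players other than `t` use their ordinary reflections for `u`. The shadow
here is therefore the `partner` that also matches the single-qubit reflection, and it links the two.
-/
theorem NearOptimal.stDist_bit_partner (t : Fin r) (J : KSubset n k) (u : J.1) (w : J.1 → Fin 2) :
    stDist (purify s.isDensity)
      (playerHom α t (bitRefl s t J (fun v => pauliQuestion (w v)) u)) (partner S s t u (w u)) ≤
      √(lossFactor r * η) := by
  have h1 := stDist_shadow_le s.isDensity (isReflection_multiFamily s J u t _) h.pos h.nonneg
    (h.multi J u t fun v => chosenGen S t (w v)) (ask_chosenGen S t (w u))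
  simp only [question_likely] at h1
  have h2 : multiFamily s J u t (fun v => pauliQuestion (w v)) t
      (Fin.castLE (by norm_num) (w u)) = bitRefl s t J (fun v => pauliQuestion (w v)) u := by
    rw [multiFamily, if_pos rfl]
    exact congrArg (fun f => bitRefl s t J f u)
      (Function.update_eq_self u fun v => pauliQuestion (w v))
  have h3 : shadowHat S (multiFamily s J u t fun v => pauliQuestion (w v))
      (chosenGen S t (w u)) t = partner S s t u (w u) := by
    rw [partner, shadowHat, shadowHat]
    congr 1
    refine shadow_congr (fun i hi => ?_) _
    funext q
    rw [multiFamily, if_neg hi]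
  rwa [h2, h3] at h1

theorem NearOptimal.stDist_bit (t : Fin r) (J : KSubset n k) (u : J.1) (w : J.1 → Fin 2) :
    stDist (purify s.isDensity)
      (playerHom α t (bitRefl s t J (fun v => pauliQuestion (w v)) u))
      (playerHom α t (pauliRefl s t u (w u))) ≤ 2 * √(lossFactor r * η) := by
  have h1 := h.stDist_bit_partner t J u w
  have h2 := h.stDist_partner t u (w u)
  rw [stDist_comm] at h2
  linarith [stDist_triangle (Ψ := purify s.isDensity)
    (playerHom α t (bitRefl s t J (fun v => pauliQuestion (w v)) u)) (partner S s t u (w u))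
    (playerHom α t (pauliRefl s t u (w u)))]

theorem NearOptimal.movable (t : Fin r) (u : Fin n) (w : Fin 2) :
    Movable (purify s.isDensity) (playerMonoid α t) (√(lossFactor r * η))
      (playerHom α t (pauliRefl s t u w)) := by
  refine ⟨partner S s t u w, norm_shadowHat_le (fun i q => s.isReflection i (u, q)) _ _, ?_,
    h.stDist_partner t u w⟩
  rintro _ ⟨T, -, rfl⟩
  exact shadowHat_comm _ _ _

/-- As `k ≥ 2`, some `J` contains both `u` and `v`. The two answer bits of one joint measurement on
`J` commute exactly, and each is `2√(lossFactor r * η)` away from the single-qubit reflection. -/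
theorem NearOptimal.stDist_comm (hk : 2 ≤ k) (hkn : k ≤ n) (t : Fin r) {u v : Fin n} (huv : u ≠ v)
    (w w' : Fin 2) :
    stDist (purify s.isDensity)
      (playerHom α t (pauliRefl s t u w) * playerHom α t (pauliRefl s t v w'))
      (playerHom α t (pauliRefl s t v w') * playerHom α t (pauliRefl s t u w)) ≤
        12 * √(lossFactor r * η) := by
  obtain ⟨J, hJs, hJ⟩ := Finset.exists_superset_card_eq (s := {u, v}) (n := k)
    ((Finset.card_le_two).trans hk) (by simpa using hkn)
  have hu : u ∈ J := hJs (by simp)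
  have hv : v ∈ J := hJs (by simp)
  set f : J → Fin 2 := fun x => if x.1 = u then w else w' with hf
  have hfu : f ⟨u, hu⟩ = w := by simp [hf]
  have hfv : f ⟨v, hv⟩ = w' := by simp [hf, huv.symm]
  set m : J → (Ell2 (α t) →L[ℂ] Ell2 (α t)) := fun x =>
    bitRefl s t ⟨J, hJ⟩ (fun v => pauliQuestion (f v)) x with hm
  have hmR : ∀ x, IsReflection (m x) := fun x => isReflection_bitRefl s _ _ _ _
  have d1 := h.stDist_bit t ⟨J, hJ⟩ ⟨u, hu⟩ f
  have d2 := h.stDist_bit t ⟨J, hJ⟩ ⟨v, hv⟩ f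
  rw [hfu] at d1
  rw [hfv] at d2
  have hn : ∀ A ∈ playerMonoid α t, ‖A‖ ≤ 1 := by
    rintro _ ⟨T, hT, rfl⟩
    exact norm_playerHom_le t hT
  -- Replacing the right factor costs `2`; replacing the left one costs `2` plus another `2` for
  -- moving the right factor away, in units of `√(lossFactor r * η)`. Doing this for both orders
  -- gives `12`.
  have gen : ∀ (x y : J) (a b : Ell2 (α t) →L[ℂ] Ell2 (α t)), IsReflection a →
      Movable (purify s.isDensity) (playerMonoid α t) (√(lossFactor r * η)) (playerHom α t b) →
      stDist (purify s.isDensity) (playerHom α t (m x)) (playerHom α t a) ≤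
        2 * √(lossFactor r * η) →
      stDist (purify s.isDensity) (playerHom α t (m y)) (playerHom α t b) ≤
        2 * √(lossFactor r * η) →
      stDist (purify s.isDensity) (playerHom α t (m x) * playerHom α t (m y))
        (playerHom α t a * playerHom α t b) ≤ 6 * √(lossFactor r * η) := by
    intro x y a b ha hb hx hy
    have t1 := (stDist_mul_left (norm_playerHom_le t (hmR x).norm_le) _ _).trans hy
    have t2 := stDist_mul_right hn hb (mem_playerMonoid (hmR x).norm_le)
      (mem_playerMonoid ha.norm_le)
    linarith [stDist_triangle (Ψ := purify s.isDensity)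
      (playerHom α t (m x) * playerHom α t (m y)) (playerHom α t (m x) * playerHom α t b)
      (playerHom α t a * playerHom α t b)]
  have g1 := gen _ _ _ _ (isReflection_pauliRefl s t u w) (h.movable t v w') d1 d2
  have g2 := gen _ _ _ _ (isReflection_pauliRefl s t v w') (h.movable t u w) d2 d1
  have hc : playerHom α t (m ⟨u, hu⟩) * playerHom α t (m ⟨v, hv⟩) =
      playerHom α t (m ⟨v, hv⟩) * playerHom α t (m ⟨u, hu⟩) := by
    rw [← map_mul, ← map_mul]
    congr 1
    simp only [hm, bitRefl]
    rw [← map_mul, ← map_mul, mul_comm]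
  rw [hc, StabilizerGame.stDist_comm] at g1
  linarith [stDist_triangle (Ψ := purify s.isDensity)
    (playerHom α t (pauliRefl s t u w) * playerHom α t (pauliRefl s t v w'))
    (playerHom α t (m ⟨v, hv⟩) * playerHom α t (m ⟨u, hu⟩))
    (playerHom α t (pauliRefl s t v w') * playerHom α t (pauliRefl s t u w))]

theorem NearOptimal.approxPauli (hk : 2 ≤ k) (hkn : k ≤ n) (t : Fin r) :
    ApproxPauli (purify s.isDensity) (playerMonoid α t) (12 * √(lossFactor r * η))
      (fun u w => playerHom α t (pauliRefl s t u w)) where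
  nonneg := by positivity
  norm_le := by
    rintro _ ⟨T, hT, rfl⟩
    exact norm_playerHom_le t hT
  smul_mem := by
    rintro c hc _ ⟨T, hT, rfl⟩
    exact ⟨c • T, by rwa [norm_smul, hc, one_mul], map_smul _ _ _⟩
  mem u w := mem_playerMonoid (isReflection_pauliRefl s t u w).norm_le
  sq u w := by rw [← map_mul, (isReflection_pauliRefl s t u w).2, map_one]
  movable u w := by
    obtain ⟨T, h1, h2, h3⟩ := h.movable t u w
    exact ⟨T, h1, h2, h3.trans (le_mul_of_one_le_left (Real.sqrt_nonneg _) (by norm_num))⟩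
  anti u := by
    have h1 := stDist_anti_le s.isDensity (fun i q => s.isReflection i (u, q)) h.pos h.nonneg
      (h.single u) t
    exact h1.trans (mul_le_mul_of_nonneg_right (by norm_num) (Real.sqrt_nonneg _))
  comm u v huv w w' := h.stDist_comm hk hkn t huv w w'

end Relations

/-! ### Trace estimates for the reflections and the joint measurements -/

section Estimates

variable {r k n : ℕ} {α : Fin r → Type u} {S : XZStabilizer r} {s : Strategy k n α} {η p : ℝ}

theorem map_word {β γ : Type*} (φ : (Ell2 β →L[ℂ] Ell2 β) →⋆ₐ[ℂ] (Ell2 γ →L[ℂ] Ell2 γ))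
    (R : Fin n → Fin 2 → (Ell2 β →L[ℂ] Ell2 β)) (c : Fin n → Fin 2 × Fin 2) :
    φ (word R c) = ((List.finRange n).map fun v => cell (fun w => φ (R v w)) (c v)).prod := by
  rw [word, map_list_prod, List.map_map]
  congr 2
  funext v
  simp [cell]

theorem norm_apply_of_star_mul {H : Type*} [NormedAddCommGroup H] [InnerProductSpace ℂ H]
    [CompleteSpace H] {T : H →L[ℂ] H} (h : star T * T = 1) (x : H) : ‖T x‖ = ‖x‖ := by
  refine (sq_eq_sq₀ (norm_nonneg _) (norm_nonneg _)).1 ?_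
  have h1 : inner ℂ (T x) (T x) = inner ℂ x x := by
    rw [← ContinuousLinearMap.adjoint_inner_right]
    exact congrArg (inner ℂ x) (congrArg (fun S => S x) h)
  rw [inner_self_eq_norm_sq_to_K, inner_self_eq_norm_sq_to_K] at h1
  exact_mod_cast h1

theorem pullback_smul {α β : Type*} (V : Ell2 α →ₗᵢ[ℂ] Ell2 β) (c : ℂ)
    (T : Ell2 β →L[ℂ] Ell2 β) : pullback V (c • T) = c • pullback V T := by
  simp [pullback]

theorem pullback_sum {α β ι : Type*} (V : Ell2 α →ₗᵢ[ℂ] Ell2 β) (s : Finset ι)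
    (T : ι → Ell2 β →L[ℂ] Ell2 β) : pullback V (∑ i ∈ s, T i) = ∑ i ∈ s, pullback V (T i) := by
  refine ContinuousLinearMap.ext fun x => ?_
  simp [pullback, sum_apply, map_sum]

/-- The isometry of player `t`. -/
def playerIso (s : Strategy k n α) (t : Fin r) :
    Ell2 (α t) →ₗᵢ[ℂ] Ell2 (Bits n × (Bits n × α t)) :=
  dilationIso (isReflection_pauliRefl s t)

/-- The trace is the average over `c` of the overlaps of `P_c W Ψ` with the signed shifted word on
`Ψ`. These are unit vectors at distance at most `4 * n ^ 3` times `12√(lossFactor r * η)` by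
`word_shift`, and `1 - Re` of their overlap is half the squared distance. Averaging over `4 ^ n`
words costs nothing, so no exponential factor appears. -/
theorem NearOptimal.re_trAt_letters (h : NearOptimal S p s η) (hk : 2 ≤ k) (hkn : k ≤ n) (t : Fin r)
    (D : Fin n → Option (Fin 2)) {m : Fin n → (Ell2 (α t) →L[ℂ] Ell2 (α t))}
    (hm : ∀ v, ‖m v‖ ≤ 1)
    (hmD : ∀ v, stDist (purify s.isDensity) (playerHom α t (m v))
      (letter (fun w => playerHom α t (pauliRefl s t v w)) (D v)) ≤ 12 * √(lossFactor r * η))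
    {W : Ell2 (α t) →L[ℂ] Ell2 (α t)} (hW : ((List.finRange n).reverse.map m).prod = W)
    (hWr : IsReflection W) :
    1 - (trAt s.ρ (onPlayer t (W * pullback (playerIso s t)
      (ampl (Bits n × α t) (matrixOp (qubitTensor fun v => letterMatrix (D v))))))).re ≤
        (48 * n ^ 3 * √(lossFactor r * η)) ^ 2 / 2 := by
  set Ψ := purify s.isDensity with hΨ
  set π := playerHom α t
  set P := word (pauliRefl s t) with hP
  set Δ := 12 * √(lossFactor r * η)
  set sh : (Fin n → Fin 2 × Fin 2) → (Fin n → Fin 2 × Fin 2) := fun c v => shift (D v) (c v)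
  set sg : (Fin n → Fin 2 × Fin 2) → ℂ := fun c => ∏ v, shiftSign (D v) (c v) with hsg
  have key : ∀ c, (sg c * inner ℂ (π (P c) (π W Ψ)) (π (P (sh c)) Ψ)).re ≥
      1 - (48 * n ^ 3 * √(lossFactor r * η)) ^ 2 / 2 := by
    intro c
    have hap := h.approxPauli hk hkn t
    have h1 := hap.word_shift c D (m := fun v => π (m v)) (fun v => mem_playerMonoid (hm v)) hmD
      (List.finRange n) (List.nodup_finRange n)
    rw [← map_word, ← map_word] at h1
    have h2 : ((List.finRange n).reverse.map fun v => π (m v)).prod = π W := by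
      rw [← hW, map_list_prod, List.map_map]
      rfl
    have h3 : ((List.finRange n).map fun v => shiftSign (D v) (c v)).prod = sg c := by
      simp only [hsg, Fin.prod_univ_def]
    rw [h2, h3, List.length_finRange] at h1
    have hs : ‖sg c‖ = 1 := by
      simp only [hsg, norm_prod, norm_shiftSign, Finset.prod_const_one]
    have hu : ∀ c, star (π (P c)) * π (P c) = 1 := fun c => by
      rw [← map_star, ← map_mul, star_word_mul (isReflection_pauliRefl s t), map_one]
    have hWu : star (π W) * π W = 1 := by
      rw [← map_star, ← map_mul, hWr.1.star_eq, hWr.2, map_one]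
    have hΨ1 : ‖Ψ‖ = 1 := norm_purify _
    have n1 : ‖π (P c) (π W Ψ)‖ = 1 := by
      rw [norm_apply_of_star_mul (hu c), norm_apply_of_star_mul hWu, hΨ1]
    have n2 : ‖sg c • π (P (sh c)) Ψ‖ = 1 := by
      rw [norm_smul, hs, one_mul, norm_apply_of_star_mul (hu _), hΨ1]
    have h4 : ‖π (P c) (π W Ψ) - sg c • π (P (sh c)) Ψ‖ ≤ 4 * n ^ 3 * Δ := h1
    have h5 := norm_sub_sq (𝕜 := ℂ) (π (P c) (π W Ψ)) (sg c • π (P (sh c)) Ψ)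
    rw [n1, n2, inner_smul_right] at h5
    have h6 : RCLike.re (sg c * inner ℂ (π (P c) (π W Ψ)) (π (P (sh c)) Ψ)) =
      (sg c * inner ℂ (π (P c) (π W Ψ)) (π (P (sh c)) Ψ)).re := rfl
    rw [h6] at h5
    have h7 := pow_le_pow_left₀ (norm_nonneg _) h4 2
    have h8 : (4 * (n : ℝ) ^ 3 * Δ) ^ 2 = (48 * n ^ 3 * √(lossFactor r * η)) ^ 2 := by
      simp only [Δ]
      ring
    rw [h8] at h7
    linarith
  have hT : trAt s.ρ (onPlayer t (W * pullback (playerIso s t)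
      (ampl (Bits n × α t) (matrixOp (qubitTensor fun v => letterMatrix (D v)))))) =
      (1 / 4 ^ n : ℂ) * ∑ c, sg c * inner ℂ (π (P c) (π W Ψ)) (π (P (sh c)) Ψ) := by
    rw [playerIso, pullback_dilationIso, trAt_eq s.isDensity]
    change inner ℂ Ψ (π (W * ((1 / 4 ^ n : ℂ) • ∑ c, sg c • (star (P c) * P (sh c)))) Ψ) = _
    rw [mul_smul_comm, map_smul, Finset.mul_sum, map_sum, smul_apply, sum_apply, inner_smul_right,
      inner_sum]
    congr 1
    refine Finset.sum_congr rfl fun c _ => ?_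
    rw [mul_smul_comm, map_smul, smul_apply, inner_smul_right, map_mul, map_mul, map_star]
    congr 1
    change inner ℂ Ψ (π W (ContinuousLinearMap.adjoint (π (P c)) (π (P (sh c)) Ψ))) = _
    rw [← ContinuousLinearMap.adjoint_inner_left, ContinuousLinearMap.adjoint_inner_right,
      ← ContinuousLinearMap.star_eq_adjoint, ← map_star, hWr.1.star_eq]
  have h4n : (1 / 4 ^ n : ℂ) = ((1 / 4 ^ n : ℝ) : ℂ) := by push_cast; rfl
  rw [hT, h4n, Complex.re_ofReal_mul, Complex.re_sum]
  have h9 := Finset.sum_le_sum fun c (_ : c ∈ Finset.univ) => key c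
  have hcard : (Fintype.card (Fin n → Fin 2 × Fin 2) : ℝ) = 4 ^ n := by
    simp
  rw [Finset.sum_const, Finset.card_univ, nsmul_eq_mul, hcard] at h9
  have h10 := mul_le_mul_of_nonneg_left h9 (show (0 : ℝ) ≤ 1 / 4 ^ n by positivity)
  rw [← mul_assoc, one_div_mul_cancel (by positivity), one_mul] at h10
  linarith

theorem prod_single_list {A : Type*} [Monoid A] {ι : Type*} [DecidableEq ι] (u : ι) (a : A)
    (L : List ι) (hL : L.Nodup) :
    (L.map fun v => if v = u then a else 1).prod = if u ∈ L then a else 1 := by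
  induction L with
  | nil => simp
  | cons v L ih =>
    rw [List.nodup_cons] at hL
    rw [List.map_cons, List.prod_cons, ih hL.2]
    by_cases h : v = u
    · subst h
      simp [hL.1]
    · simp [h, Ne.symm h]

theorem honestRefl_eq (γ : Type*) (u : Fin n) (w : Fin 2) :
    honestRefl n γ (u, w) = ampl γ (matrixOp (qubitTensor fun v =>
      letterMatrix (if v = u then some w else none))) := by
  rw [honestRefl, pauliString]
  congr 3
  funext v
  by_cases h : v = u
  · subst h; simp [letterMatrix]
  · simp [h, letterMatrix, Pauli.matrix]

theorem NearOptimal.deficit_refl (h : NearOptimal S p s η) (hk : 2 ≤ k) (hkn : k ≤ n) (t : Fin r)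
    (u : Fin n) (w : Fin 2) :
    1 - (trAt s.ρ (onPlayer t (pauliRefl s t u w *
      pullback (playerIso s t) (honestRefl n _ (u, w))))).re ≤
        (48 * n ^ 3 * √(lossFactor r * η)) ^ 2 / 2 := by
  rw [honestRefl_eq]
  refine h.re_trAt_letters hk hkn t _ (m := fun v => if v = u then pauliRefl s t u w else 1)
    (fun v => ?_) (fun v => ?_) ?_ (isReflection_pauliRefl s t u w)
  · split_ifs
    · exact (isReflection_pauliRefl s t u w).norm_le
    · exact IsReflection.one.norm_le
  · refine le_of_eq_of_le ?_ (show (0 : ℝ) ≤ 12 * √(lossFactor r * η) by positivity)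
    by_cases hv : v = u
    · subst hv
      simp [letter, stDist_self]
    · simp [hv, letter, stDist_self]
  · rw [prod_single_list _ _ _ (List.nodup_reverse.2 (List.nodup_finRange n))]
    simp

theorem NearOptimal.distRefl_le (h : NearOptimal S p s η) (hk : 2 ≤ k) (hkn : k ≤ n) (t : Fin r)
    (u : Fin n) (w : Fin 2) :
    distRefl s.ρ t (pauliRefl s t u w) (pullback (playerIso s t) (honestRefl n _ (u, w))) ≤
      48 * n ^ 3 * √(lossFactor r * η) := by
  refine Real.sqrt_le_iff.2 ⟨by positivity, (h.deficit_refl hk hkn t u w).trans ?_⟩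
  linarith [sq_nonneg (48 * (n : ℝ) ^ 3 * √(lossFactor r * η))]

/-- Matrices as operators. -/
def matrixHom (β : Type*) [Fintype β] [DecidableEq β] :
    Matrix β β ℂ →⋆ₐ[ℂ] (Ell2 β →L[ℂ] Ell2 β) where
  toFun := matrixOp
  map_one' := by
    ext f x
    simp [matrixOp_apply, Matrix.one_apply]
  map_mul' A B := by
    ext f x
    change matrixOp (A * B) f x = matrixOp A (matrixOp B f) x
    simp only [matrixOp_apply, Matrix.mul_apply, Finset.sum_mul, Finset.mul_sum]
    rw [Finset.sum_comm]
    simp only [mul_assoc]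
  map_zero' := by
    ext f x
    simp [matrixOp_apply]
  map_add' A B := by
    ext f x
    change matrixOp (A + B) f x = matrixOp A f x + matrixOp B f x
    simp only [matrixOp_apply, Matrix.add_apply, add_mul, Finset.sum_add_distrib]
  commutes' c := by
    ext f x
    change matrixOp (algebraMap ℂ _ c) f x = c * f x
    rw [matrixOp_apply, Algebra.algebraMap_eq_smul_one]
    simp [Matrix.one_apply]
  map_star' A := by
    change matrixOp (star A) = ContinuousLinearMap.adjoint (matrixOp A)
    refine ext_entries fun x y => ?_
    have hk : ∀ (A : Matrix β β ℂ) (x y : β), matrixOp A (ket x) y = A y x := fun A x y => by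
      simp [matrixOp_apply, ket_apply]
    rw [adjoint_ket_apply, hk, hk]
    rfl

theorem matrixHom_apply {β : Type*} [Fintype β] [DecidableEq β] (A : Matrix β β ℂ) :
    matrixHom β A = matrixOp A := rfl

theorem matrixOp_ket {β : Type*} [Fintype β] [DecidableEq β] (A : Matrix β β ℂ) (x y : β) :
    matrixOp A (ket x) y = A y x := by
  simp [matrixOp_apply, ket_apply]

theorem qubitTensor_sum {B : Type*} [Fintype B] (c : Fin n → B → ℂ)
    (A : Fin n → B → Matrix (Fin 2) (Fin 2) ℂ) :
    qubitTensor (fun v => ∑ b, c v b • A v b) =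
      ∑ e : Fin n → B, (∏ v, c v (e v)) • qubitTensor fun v => A v (e v) := by
  ext x y
  simp only [qubitTensor, Matrix.sum_apply, Matrix.smul_apply, smul_eq_mul,
    ← Finset.prod_mul_distrib]
  rw [Finset.prod_univ_sum, Fintype.piFinset_univ]

/-- The sign `(-1) ^ (b v * e v)` for `v ∈ J`, and `1` otherwise. -/
def outcomeSign (J : Finset (Fin n)) (b : J → ZMod 2) (v : Fin n) (e : Fin 2) : ℂ :=
  if h : v ∈ J then (-1) ^ ((b ⟨v, h⟩).val * e.val) else 1

/-- The letter `w v` for `v ∈ J` and `e v = 1`, and no letter otherwise. -/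
def outcomeLetter (J : Finset (Fin n)) (w : J → Fin 2) (e : Fin n → Fin 2) (v : Fin n) :
    Option (Fin 2) :=
  if h : v ∈ J then (if e v = 1 then some (w ⟨v, h⟩) else none) else none

/-- The Fourier expansion of the projections. The factor `1` at a qubit outside `J` is written as
`(1 + 1)/2`, so that the sum runs over all of `Fin n → Fin 2`, irrespective of `J`. -/
theorem honestMeas_eq (γ : Type*) (J : Finset (Fin n)) (w : J → Fin 2) (b : J → ZMod 2) :
    honestMeas n γ J w b = (1 / 2 ^ n : ℂ) • ∑ e : Fin n → Fin 2,
      (∏ v, outcomeSign J b v (e v)) •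
        ampl γ (matrixOp (qubitTensor fun v => letterMatrix (outcomeLetter J w e v))) := by
  have h1 : (fun v => if h : v ∈ J then
      (1 / 2 : ℂ) • (1 + (-1 : ℂ) ^ (b ⟨v, h⟩).val • (honestPauli (w ⟨v, h⟩)).matrix) else 1) =
      fun v => ∑ e : Fin 2, (1 / 2 * outcomeSign J b v e) •
        letterMatrix (outcomeLetter J w (fun _ => e) v) := by
    funext v
    rw [Fin.sum_univ_two]
    by_cases h : v ∈ J
    · simp [h, outcomeSign, outcomeLetter, letterMatrix, smul_smul]
    · simp only [h, outcomeSign, outcomeLetter, letterMatrix, dif_neg, not_false_eq_true,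
        ← add_smul, Option.elim_none]
      norm_num
  rw [honestMeas, h1, qubitTensor_sum, ← matrixHom_apply, map_sum, ← amplHom_apply, map_sum,
    Finset.smul_sum]
  refine Finset.sum_congr rfl fun e _ => ?_
  rw [map_smul, map_smul, Finset.prod_mul_distrib, mul_smul, Finset.prod_const, Finset.card_univ,
    Fintype.card_fin, one_div_pow]
  rfl

theorem NearOptimal.distMeas_le (h : NearOptimal S p s η) (hk : 2 ≤ k) (hkn : k ≤ n) (t : Fin r)
    (J : KSubset n k) (w : J.1 → Fin 2) :
    distMeas s.ρ t (s.M t J fun v => pauliQuestion (w v))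
      (fun b => pullback (playerIso s t) (honestMeas n _ J.1 w b)) ≤
        48 * n ^ 3 * √(lossFactor r * η) := by
  set M := s.M t J fun v => pauliQuestion (w v) with hM
  set N : (Fin n → Fin 2) → (Ell2 (α t) →L[ℂ] Ell2 (α t)) := fun e =>
    pullback (playerIso s t) (ampl (Bits n × α t)
      (matrixOp (qubitTensor fun v => letterMatrix (outcomeLetter J.1 w e v)))) with hN
  set H := pvmHom (s.isProj t J fun v => pauliQuestion (w v))
    (s.sum_M t J fun v => pauliQuestion (w v)) with hH
  -- The character sums of the strategy's own measurement. They are reflections and factor into bit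
  -- reflections, each close to its letter on `Ψ`.
  set W : (Fin n → Fin 2) → (Ell2 (α t) →L[ℂ] Ell2 (α t)) := fun e =>
    H fun b => ∏ v, outcomeSign J.1 b v (e v) with hW
  have hsgn : ∀ b v e, outcomeSign J.1 b v e = 1 ∨ outcomeSign J.1 b v e = -1 := by
    intro b v e
    rw [outcomeSign]
    split_ifs
    · exact neg_one_pow_cases _
    · exact Or.inl rfl
  have hprod : ∀ (f : Fin n → ℂ), (∀ v, f v = 1 ∨ f v = -1) → ∏ v, f v = 1 ∨ ∏ v, f v = -1 := by
    intro f hf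
    refine Finset.prod_induction f (fun x => x = 1 ∨ x = -1) ?_ (Or.inl rfl) fun v _ => hf v
    rintro a b (rfl | rfl) (rfl | rfl) <;> simp
  have key : ∀ e, 1 - (trAt s.ρ (onPlayer t (W e * N e))).re ≤
      (48 * n ^ 3 * √(lossFactor r * η)) ^ 2 / 2 := by
    intro e
    refine h.re_trAt_letters hk hkn t _
      (m := fun v => H fun b => outcomeSign J.1 b v (e v)) (fun v => ?_) (fun v => ?_) ?_
      (isReflection_pvmHom _ _ fun b => hprod _ fun v => hsgn b v _)
    · exact (isReflection_pvmHom _ _ fun b => hsgn b v _).norm_le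
    · have hone : H (fun _ => 1) = 1 := map_one H
      by_cases hv : v ∈ J.1
      · by_cases he : e v = 1
        · have h1 := h.stDist_bit t J ⟨v, hv⟩ w
          simp only [outcomeSign, outcomeLetter, hv, he, dif_pos, if_true, letter, Option.elim_some,
            Fin.val_one, mul_one]
          exact h1.trans (mul_le_mul_of_nonneg_right (by norm_num) (Real.sqrt_nonneg _))
        · have he0 : e v = 0 := by
            lia
          simp only [outcomeSign, outcomeLetter, hv, he0, dif_pos, letter, Fin.val_zero, mul_zero,
            pow_zero, hone, map_one, zero_ne_one, if_false, Option.elim_none, stDist_self]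
          positivity
      · simp only [outcomeSign, outcomeLetter, hv, dif_neg, not_false_eq_true, hone, map_one,
          letter, Option.elim_none, stDist_self]
        positivity
    · have h1 : (fun v => H fun b => outcomeSign J.1 b v (e v)) =
          H ∘ fun v b => outcomeSign J.1 b v (e v) := rfl
      rw [h1, ← List.map_map, ← map_list_prod, hW]
      congr 1
      rw [((List.reverse_perm (List.finRange n)).map _).prod_eq, ← Fin.prod_univ_def]
      funext b
      rw [Finset.prod_apply]
  -- Exchanging the sums over outcomes and characters leaves a uniform average over `e`, so the
  -- bound `key` passes to the average without loss.
  have hexp : ∑ b, M b * pullback (playerIso s t) (honestMeas n (Bits n × α t) J.1 w b) =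
      (1 / 2 ^ n : ℂ) • ∑ e, W e * N e := by
    simp only [honestMeas_eq, pullback_smul, pullback_sum, mul_smul_comm, Finset.mul_sum,
      ← Finset.smul_sum]
    rw [Finset.sum_comm]
    congr 1
    refine Finset.sum_congr rfl fun e _ => ?_
    rw [hW, hH]
    simp only [pvmHom_apply, Finset.sum_mul, smul_mul_assoc]
    rfl
  have hre : (∑ b, trAt s.ρ (onPlayer t (M b *
      pullback (playerIso s t) (honestMeas n (Bits n × α t) J.1 w b)))).re =
      1 / 2 ^ n * ∑ e, (trAt s.ρ (onPlayer t (W e * N e))).re := by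
    have h1 := congrArg (fun T => (trAt s.ρ (onPlayerHom α t T)).re) hexp
    simp only [map_sum, map_smul, trAt_sum s.isDensity, trAt_smul s.isDensity] at h1
    rw [show (1 / 2 ^ n : ℂ) = ((1 / 2 ^ n : ℝ) : ℂ) by push_cast; rfl, Complex.re_ofReal_mul,
      Complex.re_sum (f := fun e => trAt s.ρ (onPlayerHom α t (W e * N e)))] at h1
    exact h1
  have hsum := Finset.sum_le_sum fun e (_ : e ∈ Finset.univ) => key e
  have hcard : (Fintype.card (Fin n → Fin 2) : ℝ) = 2 ^ n := by simp
  rw [Finset.sum_sub_distrib, Finset.sum_const, Finset.sum_const, Finset.card_univ, nsmul_eq_mul,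
    nsmul_eq_mul, hcard] at hsum
  have h2 := mul_le_mul_of_nonneg_left hsum (show (0 : ℝ) ≤ 1 / 2 ^ n by positivity)
  rw [mul_sub, ← mul_assoc, ← mul_assoc, one_div_mul_cancel (by positivity), one_mul, one_mul] at h2
  refine Real.sqrt_le_iff.2 ⟨by positivity, ?_⟩
  rw [hre]
  linarith

end Estimates

/-! ### The code space -/

section Qubits

variable {m : ℕ}

theorem qubitTensor_mul (A B : Fin m → Matrix (Fin 2) (Fin 2) ℂ) :
    qubitTensor A * qubitTensor B = qubitTensor fun v => A v * B v := by
  ext x y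
  simp only [Matrix.mul_apply, qubitTensor]
  rw [Finset.prod_univ_sum, Fintype.piFinset_univ]
  simp only [Finset.prod_mul_distrib]

theorem qubitTensor_one : qubitTensor (fun _ : Fin m => (1 : Matrix (Fin 2) (Fin 2) ℂ)) = 1 := by
  ext x y
  simp only [qubitTensor, Matrix.one_apply, Finset.prod_ite_zero, funext_iff]
  simp

theorem star_qubitTensor (A : Fin m → Matrix (Fin 2) (Fin 2) ℂ) :
    star (qubitTensor A) = qubitTensor fun v => star (A v) := by
  ext x y
  simp only [Matrix.star_apply, qubitTensor, star_prod]

theorem Pauli.matrix_mul_self (P : Pauli) : P.matrix * P.matrix = 1 := by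
  ext i j
  cases P <;> fin_cases i <;> fin_cases j <;> simp [Pauli.matrix, Matrix.mul_apply]

theorem Pauli.star_matrix (P : Pauli) : star P.matrix = P.matrix := by
  ext i j
  cases P <;> fin_cases i <;> fin_cases j <;> simp [Pauli.matrix, Matrix.star_apply]

theorem pauliString_mul_self (P : Fin m → Pauli) : pauliString P * pauliString P = 1 := by
  rw [pauliString, qubitTensor_mul]
  simp only [Pauli.matrix_mul_self, qubitTensor_one]

theorem star_pauliString (P : Fin m → Pauli) : star (pauliString P) = pauliString P := by
  rw [pauliString, star_qubitTensor]
  simp only [Pauli.star_matrix]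

end Qubits

/-! ### Generators and the code projection of one block of qubits -/

section Code

variable {r : ℕ} (S : XZStabilizer r)

/-- The matrix of a generator. -/
def genMatrix (j : Fin S.l) : Matrix (Bits r) (Bits r) ℂ :=
  (-1 : ℂ) ^ (S.sign j).val • pauliString (S.pauli j)

theorem genMatrix_mul_self (j : Fin S.l) : genMatrix S j * genMatrix S j = 1 := by
  rw [genMatrix, smul_mul_smul_comm, pauliString_mul_self, ← mul_pow]
  simp

theorem star_genMatrix (j : Fin S.l) : star (genMatrix S j) = genMatrix S j := by
  rw [genMatrix, star_smul, star_pauliString]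
  simp

/-- A generator as an element of the unit group. -/
def genUnit (j : Fin S.l) : (Matrix (Bits r) (Bits r) ℂ)ˣ :=
  ⟨genMatrix S j, genMatrix S j, genMatrix_mul_self S j, genMatrix_mul_self S j⟩

theorem genUnit_mem (j : Fin S.l) : genUnit S j ∈ S.group := by
  rw [← S.closure_eq]
  exact Subgroup.subset_closure ⟨j, rfl⟩

theorem genMatrix_comm (i j : Fin S.l) : Commute (genMatrix S i) (genMatrix S j) :=
  congrArg Units.val (S.comm _ (genUnit_mem S i) _ (genUnit_mem S j))

/-- The projection onto the `+1` eigenspace of a generator. -/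
def genProj (j : Fin S.l) : Matrix (Bits r) (Bits r) ℂ := (1 / 2 : ℂ) • (1 + genMatrix S j)

theorem genMatrix_mul_genProj (j : Fin S.l) : genMatrix S j * genProj S j = genProj S j := by
  rw [genProj, mul_smul_comm, mul_add, mul_one, genMatrix_mul_self, add_comm]

theorem isStarProjection_genProj (j : Fin S.l) : IsStarProjection (genProj S j) := by
  constructor
  · change genProj S j * genProj S j = genProj S j
    nth_rewrite 1 [genProj]
    rw [smul_mul_assoc, add_mul, one_mul, genMatrix_mul_genProj, ← two_smul ℂ, smul_smul]
    norm_num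
  · rw [isSelfAdjoint_iff, genProj, star_smul, star_add, star_one, star_genMatrix]
    simp

/-- The product of the projections for all generators. -/
def genProd : Matrix (Bits r) (Bits r) ℂ := ((List.finRange S.l).map (genProj S)).prod

/-- Generators commute, so `genMatrix S j` can be moved to its own factor, which absorbs it. -/
theorem genMatrix_mul_genProd (j : Fin S.l) : genMatrix S j * genProd S = genProd S := by
  obtain ⟨L₁, L₂, h⟩ := List.append_of_mem (List.mem_finRange j)
  have hc : Commute (genMatrix S j) (L₁.map (genProj S)).prod := by
    refine Commute.list_prod_right _ _ fun x hx => ?_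
    obtain ⟨i, -, rfl⟩ := List.mem_map.1 hx
    exact ((Commute.one_right _).add_right (genMatrix_comm S j i)).smul_right _
  rw [genProd, h, List.map_append, List.prod_append, List.map_cons, List.prod_cons, ← mul_assoc,
    hc.eq, mul_assoc, ← mul_assoc (genMatrix S j), genMatrix_mul_genProj]

theorem group_mul_genProd {U : (Matrix (Bits r) (Bits r) ℂ)ˣ} (hU : U ∈ S.group) :
    (U : Matrix (Bits r) (Bits r) ℂ) * genProd S = genProd S := by
  rw [← S.closure_eq] at hU
  induction hU using Subgroup.closure_induction with
  | mem U hU =>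
    obtain ⟨j, hj⟩ := hU
    rw [hj]
    exact genMatrix_mul_genProd S j
  | one => exact one_mul _
  | mul U U' _ _ h h' => rw [Units.val_mul, mul_assoc, h', h]
  | inv U _ h =>
    nth_rewrite 1 [← h]
    rw [← mul_assoc, Units.inv_mul, one_mul]

/-- The range of `genProd` is fixed by the whole group, hence lies in the code space. Only this
inclusion is needed to bound the distance to the code space. -/
theorem codeProj_mul_genProd : codeProj S * genProd S = genProd S := by
  refine (Matrix.toEuclideanCLM (n := Bits r) (𝕜 := ℂ)).injective ?_
  change Matrix.toEuclideanCLM (n := Bits r) (𝕜 := ℂ) (codeProj S * genProd S) =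
    Matrix.toEuclideanCLM (n := Bits r) (𝕜 := ℂ) (genProd S)
  rw [map_mul, codeProj, StarAlgEquiv.apply_symm_apply]
  refine ContinuousLinearMap.ext fun ψ => ?_
  refine Submodule.starProjection_eq_self_iff.2 fun U hU => ?_
  change (Matrix.toEuclideanCLM (n := Bits r) (𝕜 := ℂ) (U : Matrix (Bits r) (Bits r) ℂ) *
    Matrix.toEuclideanCLM (n := Bits r) (𝕜 := ℂ) (genProd S)) ψ = _
  rw [← map_mul, group_mul_genProd S hU]
  rfl

theorem isStarProjection_map {A B F : Type*} [Mul A] [Star A] [Mul B] [Star B] [FunLike F A B]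
    [MulHomClass F A B] [StarHomClass F A B] (φ : F) {P : A} (hP : IsStarProjection P) :
    IsStarProjection (φ P) :=
  ⟨by rw [IsIdempotentElem, ← map_mul, hP.isIdempotentElem.eq], hP.isSelfAdjoint.map φ⟩

theorem isStarProjection_codeProj : IsStarProjection (codeProj S) :=
  isStarProjection_map (A := EuclideanSpace ℂ (Bits r) →L[ℂ] EuclideanSpace ℂ (Bits r))
    (B := Matrix (Bits r) (Bits r) ℂ) (Matrix.toEuclideanCLM (n := Bits r) (𝕜 := ℂ)).symm
    isStarProjection_starProjection

end Code

/-! ### Operators on the qubits of all players with a common index -/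

section Columns

variable {r n : ℕ}

/-- The tensor product of matrices on the `v`-th qubits of all players. -/
def colTensor (A : Fin n → Matrix (Bits r) (Bits r) ℂ) :
    Matrix (Fin r → Bits n) (Fin r → Bits n) ℂ :=
  fun x y => ∏ v, A v (fun i => x i v) (fun i => y i v)

theorem colTensor_mul (A B : Fin n → Matrix (Bits r) (Bits r) ℂ) :
    colTensor A * colTensor B = colTensor fun v => A v * B v := by
  ext x y
  simp only [Matrix.mul_apply, colTensor]
  rw [Finset.prod_univ_sum, Fintype.piFinset_univ]
  refine Fintype.sum_equiv (Equiv.piComm fun (_ : Fin r) (_ : Fin n) => Fin 2) _ _ fun z => ?_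
  rw [← Finset.prod_mul_distrib]
  rfl

theorem colTensor_one : colTensor (fun _ : Fin n => (1 : Matrix (Bits r) (Bits r) ℂ)) = 1 := by
  ext x y
  simp only [colTensor, Matrix.one_apply, Finset.prod_ite_zero, funext_iff, Finset.mem_univ,
    true_implies, Finset.prod_const_one]
  congr 1
  exact propext forall_comm

theorem star_colTensor (A : Fin n → Matrix (Bits r) (Bits r) ℂ) :
    star (colTensor A) = colTensor fun v => star (A v) := by
  ext x y
  simp only [Matrix.star_apply, colTensor, star_prod]

theorem colTensor_update (A : Fin n → Matrix (Bits r) (Bits r) ℂ) (u : Fin n)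
    (T : Matrix (Bits r) (Bits r) ℂ) (x y : Fin r → Bits n) :
    colTensor (Function.update A u T) x y = T (fun i => x i u) (fun i => y i u) *
      ∏ v ∈ {u}ᶜ, A v (fun i => x i v) (fun i => y i v) := by
  rw [colTensor, Fintype.prod_eq_mul_prod_compl u, Function.update_self]
  congr 1
  exact Finset.prod_congr rfl fun v hv => by rw [Function.update_of_ne (by simpa using hv)]

/-- Matrices acting on the `u`-th qubits of all players. -/
def colHom (r : ℕ) (u : Fin n) :
    Matrix (Bits r) (Bits r) ℂ →⋆ₐ[ℂ] Matrix (Fin r → Bits n) (Fin r → Bits n) ℂ where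
  toFun T := colTensor (Function.update (fun _ => 1) u T)
  map_one' := by
    rw [Function.update_eq_self_iff.2 rfl, colTensor_one]
  map_mul' A B := by
    rw [colTensor_mul]
    congr 1
    funext v
    by_cases h : v = u
    · subst h; simp
    · simp [h]
  map_zero' := by
    ext x y
    rw [colTensor_update]
    simp
  map_add' A B := by
    ext x y
    rw [Matrix.add_apply, colTensor_update, colTensor_update, colTensor_update, Matrix.add_apply,
      add_mul]
  commutes' c := by
    ext x y
    rw [colTensor_update, Algebra.algebraMap_eq_smul_one, Algebra.algebraMap_eq_smul_one,
      Matrix.smul_apply, Matrix.smul_apply, ← colTensor_one, smul_eq_mul, smul_eq_mul, mul_assoc,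
      colTensor, Fintype.prod_eq_mul_prod_compl u]
  map_star' A := by
    rw [star_colTensor]
    congr 1
    funext v
    by_cases h : v = u
    · subst h; simp
    · simp [h]

theorem colHom_apply (u : Fin n) (T : Matrix (Bits r) (Bits r) ℂ) :
    colHom r u T = colTensor (Function.update (fun _ => 1) u T) := rfl

end Columns

/-! ### Distance to the code space of a vector nearly fixed by the generators -/

section Deficit

variable {r n : ℕ} {K : Type*} [NormedAddCommGroup K] [InnerProductSpace ℂ K] [CompleteSpace K]

omit [CompleteSpace K] in
theorem norm_sub_mul_le {E F : K →L[ℂ] K} (hE : ‖E‖ ≤ 1) (Φ : K) :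
    ‖Φ - (E * F) Φ‖ ≤ ‖Φ - E Φ‖ + ‖Φ - F Φ‖ := by
  have h1 := E.le_of_opNorm_le hE (Φ - F Φ)
  rw [one_mul, map_sub] at h1
  have h2 : Φ - (E * F) Φ = (Φ - E Φ) + (E Φ - E (F Φ)) := by
    rw [sub_add_sub_cancel]
    rfl
  rw [h2]
  exact (norm_add_le _ _).trans (by linarith)

theorem norm_sub_genProd_le (S : XZStabilizer r)
    (θ : Matrix (Bits r) (Bits r) ℂ →⋆ₐ[ℂ] (K →L[ℂ] K)) {Φ : K} {τ : ℝ}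
    (hτ : ∀ j, ‖Φ - θ (genMatrix S j) Φ‖ ≤ 2 * τ) : ‖Φ - θ (genProd S) Φ‖ ≤ S.l * τ := by
  have h : ∀ L : List (Fin S.l), ‖Φ - θ ((L.map (genProj S)).prod) Φ‖ ≤ L.length * τ := by
    intro L
    induction L with
    | nil => simp
    | cons j L ih =>
      rw [List.map_cons, List.prod_cons, map_mul, List.length_cons]
      have h1 : ‖Φ - θ (genProj S j) Φ‖ ≤ τ := by
        have h2 : Φ - θ (genProj S j) Φ = (1 / 2 : ℂ) • (Φ - θ (genMatrix S j) Φ) := by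
          rw [genProj, map_smul, map_add, map_one, smul_apply, add_apply, one_apply_eq_self,
            smul_add, smul_sub]
          have h3 : Φ = (1 / 2 : ℂ) • Φ + (1 / 2 : ℂ) • Φ := by
            rw [← add_smul]
            norm_num
          nth_rewrite 1 [h3]
          abel
        rw [h2, norm_smul]
        have := hτ j
        norm_num
        linarith
      have h4 := norm_sub_mul_le (F := θ (L.map (genProj S)).prod)
        (isStarProjection_map θ (isStarProjection_genProj S j)).norm_le Φ
      rw [Nat.cast_succ]
      linarith
  have h1 := h (List.finRange S.l)
  rwa [List.length_finRange] at h1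

theorem norm_sub_codeProj_le (S : XZStabilizer r)
    (θ : Matrix (Bits r) (Bits r) ℂ →⋆ₐ[ℂ] (K →L[ℂ] K)) {Φ : K} {τ : ℝ}
    (hτ : ∀ j, ‖Φ - θ (genMatrix S j) Φ‖ ≤ 2 * τ) : ‖Φ - θ (codeProj S) Φ‖ ≤ S.l * τ := by
  have h1 : θ (codeProj S) * θ (genProd S) = θ (genProd S) := by
    rw [← map_mul, codeProj_mul_genProd]
  -- Since `codeProj` absorbs `genProd`, the distance to the code space is at most the distance to
  -- the vector `genProd Φ`.
  have h2 : Φ - θ (codeProj S) Φ =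
      (1 - θ (codeProj S)) (Φ - θ (genProd S) Φ) := by
    have h3 := congrArg (fun T => T Φ) h1
    change θ (codeProj S) (θ (genProd S) Φ) = θ (genProd S) Φ at h3
    rw [map_sub]
    change _ = Φ - θ (codeProj S) Φ - (θ (genProd S) Φ - θ (codeProj S) (θ (genProd S) Φ))
    rw [h3, sub_self, sub_zero]
  have h4 := (1 - θ (codeProj S)).le_of_opNorm_le
    (isStarProjection_map θ (isStarProjection_codeProj S)).one_sub.norm_le (Φ - θ (genProd S) Φ)
  rw [h2]
  rw [one_mul] at h4
  exact h4.trans (norm_sub_genProd_le S θ hτ)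

theorem norm_sub_codeProjPow_le (S : XZStabilizer r)
    (θ : Matrix (Fin r → Bits n) (Fin r → Bits n) ℂ →⋆ₐ[ℂ] (K →L[ℂ] K)) {Φ : K} {τ : ℝ}
    (hτ : ∀ u j, ‖Φ - θ (colHom r u (genMatrix S j)) Φ‖ ≤ 2 * τ) :
    ‖Φ - θ (codeProjPow S n) Φ‖ ≤ n * (S.l * τ) := by
  have h : ∀ s : Finset (Fin n), ‖Φ - θ (colTensor fun v => if v ∈ s then codeProj S else 1) Φ‖ ≤
      s.card * (S.l * τ) := by
    intro s
    induction s using Finset.induction_on with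
    | empty => simp [colTensor_one]
    | insert u s hu ih =>
      have h1 : (colTensor fun v => if v ∈ insert u s then codeProj S else 1) =
          colHom r u (codeProj S) * colTensor fun v => if v ∈ s then codeProj S else 1 := by
        rw [colHom_apply, colTensor_mul]
        congr 1
        funext v
        by_cases h : v = u
        · subst h; simp [hu]
        · simp [h]
      have h2 := norm_sub_codeProj_le S (θ.comp (colHom r u)) (hτ u)
      have h3 := norm_sub_mul_le (F := θ (colTensor fun v => if v ∈ s then codeProj S else 1))
        (isStarProjection_map (θ.comp (colHom r u)) (isStarProjection_codeProj S)).norm_le Φ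
      rw [h1, map_mul, Finset.card_insert_of_notMem hu]
      push_cast
      change ‖Φ - (θ.comp (colHom r u) (codeProj S) * _) Φ‖ ≤ _
      linarith
  have h1 := h Finset.univ
  simp only [Finset.mem_univ, if_true, Finset.card_univ, Fintype.card_fin] at h1
  exact h1

/-- A vector that is nearly fixed by the generators on all qubits is nearly in the code space. -/
theorem code_deficit (S : XZStabilizer r)
    (θ : Matrix (Fin r → Bits n) (Fin r → Bits n) ℂ →⋆ₐ[ℂ] (K →L[ℂ] K)) {Φ : K} (hΦ : ‖Φ‖ = 1)
    {τ : ℝ} (hτ : ∀ u j, 1 - τ ≤ (inner ℂ Φ (θ (colHom r u (genMatrix S j)) Φ)).re) :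
    1 - (n * S.l) ^ 2 * (τ / 2) ≤ (inner ℂ Φ (θ (codeProjPow S n) Φ)).re := by
  -- Nonnegativity of `τ` can be read off only from an actual pair `(u, j)`; the cases `n = 0` and
  -- `S.l = 0` are separated below for this reason.
  have hτ0 : ∀ (u : Fin n) (j : Fin S.l), 0 ≤ τ := by
    intro u j
    have h1 : star (θ (colHom r u (genMatrix S j))) * θ (colHom r u (genMatrix S j)) = 1 := by
      rw [← map_star, ← map_star, star_genMatrix, ← map_mul, ← map_mul, genMatrix_mul_self, map_one,
        map_one]
    have h2 := (Complex.re_le_norm _).trans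
      (norm_inner_le_norm (𝕜 := ℂ) Φ (θ (colHom r u (genMatrix S j)) Φ))
    rw [norm_apply_of_star_mul h1, hΦ] at h2
    linarith [hτ u j]
  have h1 : ∀ u j, ‖Φ - θ (colHom r u (genMatrix S j)) Φ‖ ≤ 2 * √(τ / 2) := by
    intro u j
    have h1 : star (θ (colHom r u (genMatrix S j))) * θ (colHom r u (genMatrix S j)) = 1 := by
      rw [← map_star, ← map_star, star_genMatrix, ← map_mul, ← map_mul, genMatrix_mul_self, map_one,
        map_one]
    have h2 := norm_sub_sq_le hΦ.le ((norm_apply_of_star_mul h1 Φ).trans hΦ).le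
    have h3 : (2 * √(τ / 2)) ^ 2 = 2 * τ := by
      rw [mul_pow, Real.sq_sqrt (by linarith [hτ0 u j])]
      ring
    refine (sq_le_sq₀ (norm_nonneg _) (by positivity)).1 ?_
    rw [h3]
    linarith [hτ u j]
  have h2 := norm_sub_codeProjPow_le S θ h1
  have hP : codeProjPow S n = colTensor fun _ => codeProj S := rfl
  have hproj : IsStarProjection (codeProjPow S n) := by
    rw [hP]
    constructor
    · rw [IsIdempotentElem, colTensor_mul]
      simp only [(isStarProjection_codeProj S).isIdempotentElem.eq]
    · rw [isSelfAdjoint_iff, star_colTensor]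
      simp only [(isStarProjection_codeProj S).isSelfAdjoint.star_eq]
  have hE := isStarProjection_map θ hproj
  set E := θ (codeProjPow S n)
  have h3 : inner ℂ (E Φ) (E Φ) = inner ℂ Φ (E Φ) := by
    rw [← ContinuousLinearMap.adjoint_inner_right, ← ContinuousLinearMap.star_eq_adjoint,
      hE.isSelfAdjoint.star_eq]
    exact congrArg (inner ℂ Φ) (congrArg (fun T => T Φ) hE.isIdempotentElem.eq)
  have h4 : (inner ℂ Φ (E Φ)).re = ‖E Φ‖ ^ 2 := by
    rw [← h3]
    exact inner_self_eq_norm_sq (𝕜 := ℂ) _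
  -- For a projection `E` and a unit vector, `1 - Re ⟨Φ, EΦ⟩` equals `‖Φ - EΦ‖²`, so the deficit is
  -- quadratic in the distance.
  have h5 := norm_sub_sq (𝕜 := ℂ) Φ (E Φ)
  have h6 : RCLike.re (inner ℂ Φ (E Φ)) = (inner ℂ Φ (E Φ)).re := rfl
  rw [hΦ, h6] at h5
  have h7 := pow_le_pow_left₀ (norm_nonneg _) h2 2
  have h8 : ((n : ℝ) * (S.l * √(τ / 2))) ^ 2 = (n * S.l) ^ 2 * (τ / 2) ∨ n = 0 ∨ S.l = 0 := by
    by_cases hn : n = 0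
    · exact Or.inr (Or.inl hn)
    by_cases hl : S.l = 0
    · exact Or.inr (Or.inr hl)
    left
    rw [mul_pow, mul_pow, Real.sq_sqrt (by
      linarith [hτ0 ⟨0, Nat.pos_of_ne_zero hn⟩ ⟨0, Nat.pos_of_ne_zero hl⟩])]
    ring
  rcases h8 with h8 | h8 | h8
  · rw [h8] at h7
    linarith
  · simp only [h8, Nat.cast_zero, zero_mul] at h7 ⊢
    linarith
  · simp only [h8, Nat.cast_zero, zero_mul, mul_zero] at h7 ⊢
    linarith

end Deficit

/-! ### The code space of the extracted qubits -/

section Extraction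

variable {r k n : ℕ} {α : Fin r → Type u}

/-- Matrices acting on the qubits of all players. -/
def qubitHom (n : ℕ) (γ : Fin r → Type u) :
    Matrix (Fin r → Bits n) (Fin r → Bits n) ℂ →⋆ₐ[ℂ]
      (Ell2 (∀ i, Bits n × γ i) →L[ℂ] Ell2 (∀ i, Bits n × γ i)) where
  toFun A := reindex (splitQubits n γ).symm ∘L ampl (∀ i, γ i) (matrixOp A) ∘L
    reindex (splitQubits n γ)
  map_one' := by
    rw [← matrixHom_apply, map_one, ampl_one]
    exact reindex_symm_comp _
  map_mul' A B := by
    have h := reindex_comp_symm (splitQubits n γ)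
    calc reindex (splitQubits n γ).symm ∘L ampl (∀ i, γ i) (matrixOp (A * B)) ∘L
          reindex (splitQubits n γ)
        = reindex (splitQubits n γ).symm ∘L (ampl (∀ i, γ i) (matrixOp A) ∘L
          (reindex (splitQubits n γ) ∘L reindex (splitQubits n γ).symm) ∘L
            ampl (∀ i, γ i) (matrixOp B)) ∘L reindex (splitQubits n γ) := by
          rw [h, ← matrixHom_apply, map_mul]
          rfl
      _ = _ := rfl
  map_zero' := by
    rw [← matrixHom_apply, map_zero]
    rfl
  map_add' A B := by
    rw [← matrixHom_apply, map_add]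
    rfl
  commutes' c := by
    rw [← matrixHom_apply, AlgHomClass.commutes]
    refine ContinuousLinearMap.ext fun f => ?_
    rfl
  map_star' A := by
    rw [ContinuousLinearMap.star_eq_adjoint, ContinuousLinearMap.adjoint_comp,
      ContinuousLinearMap.adjoint_comp, adjoint_reindex, adjoint_reindex, adjoint_ampl,
      ← matrixHom_apply, map_star]
    rfl

/-- The letter of a Pauli operator. -/
def pauliLetter : Pauli → Option (Fin 2)
  | .X => some 0
  | .Z => some 1
  | _ => none

theorem matrix_eq_letterMatrix {P : Pauli} (hP : P ≠ .Y) :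
    P.matrix = letterMatrix (pauliLetter P) := by
  cases P with
  | I => rfl
  | X => rfl
  | Y => exact absurd rfl hP
  | Z => rfl

theorem ask_eq_map (P : Pauli) : ask P = (pauliLetter P).map pauliQuestion := by
  cases P <;> rfl

/-- A Pauli string on the `u`-th qubits of the players is a tensor product of operators of the
players. -/
theorem qubitHom_colHom (γ : Fin r → Type u) (u : Fin n) {P : Fin r → Pauli}
    (hP : ∀ i, P i ≠ .Y) :
    qubitHom n γ (colHom r u (pauliString P)) = tensorOp fun i => ampl (γ i)
      (matrixOp (qubitTensor fun v => letterMatrix (if v = u then pauliLetter (P i) else none))) := by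
  classical
  refine ext_entries fun x y => ?_
  have h1 : qubitHom n γ (colHom r u (pauliString P)) (ket x) y =
      ampl (∀ i, γ i) (matrixOp (colHom r u (pauliString P))) (ket (splitQubits n γ x))
        (splitQubits n γ y) := by
    rw [← reindex_ket]
    rfl
  have h2 : (∏ i, if (y i).2 = (x i).2 then (1 : ℂ) else 0) =
      if (splitQubits n γ y).2 = (splitQubits n γ x).2 then 1 else 0 := by
    rw [Finset.prod_ite_zero]
    simp [splitQubits, funext_iff]
  rw [h1, ampl_ket, matrixOp_ket, tensorOp_ket]
  simp only [ampl_ket, matrixOp_ket]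
  rw [Finset.prod_mul_distrib, h2]
  congr 1
  swap
  · congr
  change colTensor _ _ _ = _
  simp only [colTensor, qubitTensor]
  rw [Finset.prod_comm (f := fun i v => letterMatrix (if v = u then pauliLetter (P i) else none)
    ((y i).1 v) ((x i).1 v))]
  refine Finset.prod_congr rfl fun v _ => ?_
  by_cases h : v = u
  · subst h
    simp only [Function.update_self, if_true, pauliString, qubitTensor,
      matrix_eq_letterMatrix (hP _)]
    rfl
  · rw [Function.update_of_ne h, ← qubitTensor_one]
    simp only [h, if_false]
    rfl

theorem norm_pullback_le {β γ : Type*} (V : Ell2 β →ₗᵢ[ℂ] Ell2 γ) {T : Ell2 γ →L[ℂ] Ell2 γ}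
    (hT : ‖T‖ ≤ 1) : ‖pullback V T‖ ≤ 1 := by
  have hV := V.norm_toContinuousLinearMap_le
  have hV' : ‖ContinuousLinearMap.adjoint V.toContinuousLinearMap‖ ≤ 1 := by
    rwa [LinearIsometryEquiv.norm_map]
  exact (norm_comp_le_mul hV' (norm_comp_le_mul hT hV)).trans_eq (by norm_num)

theorem pullback_one {β γ : Type*} (V : Ell2 β →ₗᵢ[ℂ] Ell2 γ) : pullback V 1 = 1 := by
  refine ContinuousLinearMap.ext fun x => ext_inner_left ℂ fun y => ?_
  change inner ℂ y (ContinuousLinearMap.adjoint V.toContinuousLinearMap (V x)) = inner ℂ y x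
  rw [ContinuousLinearMap.adjoint_inner_right]
  exact V.inner_map_map y x

theorem norm_honestRefl_le (γ : Type*) (u : Fin n) (w : Fin 2) :
    ‖honestRefl n γ (u, w)‖ ≤ 1 := by
  refine (norm_ampl_le _).trans (norm_le_one_of_star_mul ?_)
  rw [← matrixHom_apply, ← map_star, ← map_mul, star_pauliString, pauliString_mul_self, map_one]

/-- Replacing the factors of a tensor product one after the other. -/
theorem norm_tensorOp_sub_le {ρ : Ell2 (∀ i, α i) →L[ℂ] Ell2 (∀ i, α i)} (hρ : IsDensity ρ)
    {A B : ∀ i, Ell2 (α i) →L[ℂ] Ell2 (α i)} (hA : ∀ i, ‖A i‖ ≤ 1) (hB : ∀ i, ‖B i‖ ≤ 1) {e : ℝ}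
    (he : ∀ i, stDist (purify hρ) (playerHom α i (A i)) (playerHom α i (B i)) ≤ e) :
    stDist (purify hρ) (ampl (∀ i, α i) (tensorOp A)) (ampl (∀ i, α i) (tensorOp B)) ≤ r * e := by
  have h : ∀ s : Finset (Fin r), stDist (purify hρ) (ampl (∀ i, α i) (tensorOp A))
      (ampl (∀ i, α i) (tensorOp fun i => if i ∈ s then B i else A i)) ≤ s.card * e := by
    intro s
    induction s using Finset.induction_on with
    | empty => simp [stDist_self]
    | insert t s ht ih =>
      set C : ∀ i, Ell2 (α i) →L[ℂ] Ell2 (α i) := fun i => if i ∈ s then B i else A i with hC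
      have h1 : tensorOp (fun i => if i ∈ insert t s then B i else A i) =
          tensorOp (Function.update C t 1) * onPlayer t (B t) := by
        rw [← tensorOp_update]
        congr 1
        funext i
        by_cases h : i = t
        · subst h; simp
        · simp [h, hC]
      have h2 : tensorOp C = tensorOp (Function.update C t 1) * onPlayer t (A t) := by
        rw [tensorOp_update_mul C t]
        simp [hC, ht]
      have h3 : ‖ampl (∀ i, α i) (tensorOp (Function.update C t 1))‖ ≤ 1 := by
        refine (norm_ampl_le _).trans (norm_tensorOp_le _ fun i => ?_)
        by_cases h : i = t
        · subst h
          rw [Function.update_self]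
          exact IsReflection.one.norm_le
        · rw [Function.update_of_ne h, hC]
          dsimp only
          split_ifs
          · exact hB i
          · exact hA i
      have h4 := (stDist_mul_left h3 (playerHom α t (A t)) (playerHom α t (B t))).trans (he t)
      have h5 := stDist_triangle (Ψ := purify hρ) (ampl (∀ i, α i) (tensorOp A))
        (ampl (∀ i, α i) (tensorOp C)) (ampl (∀ i, α i) (tensorOp (Function.update C t 1)) *
          playerHom α t (B t))
      rw [h1, Finset.card_insert_of_notMem ht, Nat.cast_succ]
      rw [h2] at h5 ih
      change stDist _ _ (ampl (∀ i, α i) (tensorOp (Function.update C t 1)) *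
        playerHom α t (A t)) ≤ _ at ih
      change _ ≤ stDist _ _ (ampl (∀ i, α i) (tensorOp (Function.update C t 1)) *
        playerHom α t (A t)) + stDist _ (ampl (∀ i, α i) (tensorOp (Function.update C t 1)) *
        playerHom α t (A t)) _ at h5
      change stDist _ _ (ampl (∀ i, α i) (tensorOp (Function.update C t 1)) *
        playerHom α t (B t)) ≤ _
      linarith
  have h1 := h Finset.univ
  simpa using h1

variable {S : XZStabilizer r} {s : Strategy k n α} {η p : ℝ}

theorem NearOptimal.stDist_pullback (h : NearOptimal S p s η) (hk : 2 ≤ k) (hkn : k ≤ n) (t : Fin r)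
    (u : Fin n) (w : Fin 2) :
    stDist (purify s.isDensity) (playerHom α t (pauliRefl s t u w))
      (playerHom α t (pullback (playerIso s t) (honestRefl n _ (u, w)))) ≤
        48 * n ^ 3 * √(lossFactor r * η) := by
  have h1 := h.deficit_refl hk hkn t u w
  have hN := norm_pullback_le (playerIso s t) (norm_honestRefl_le (Bits n × α t) u w)
  have hR := isReflection_pauliRefl s t u w
  set N := pullback (playerIso s t) (honestRefl n (Bits n × α t) (u, w))
  have h2 : ‖playerHom α t N (purify s.isDensity)‖ ≤ 1 := by
    have h3 := (playerHom α t N).le_of_opNorm_le (norm_playerHom_le t hN) (purify s.isDensity)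
    rwa [norm_purify, one_mul] at h3
  have h4 := norm_sub_sq_le (norm_player_le s.isDensity t hR) h2
  have h5 : trAt s.ρ (onPlayer t (pauliRefl s t u w * N)) =
      inner ℂ (playerHom α t (pauliRefl s t u w) (purify s.isDensity))
        (playerHom α t N (purify s.isDensity)) := by
    rw [trAt_eq s.isDensity]
    change inner ℂ _ (playerHom α t (pauliRefl s t u w * N) _) = _
    rw [map_mul, ← ContinuousLinearMap.adjoint_inner_right, ← ContinuousLinearMap.star_eq_adjoint,
      (hR.map (playerHom α t)).1.star_eq]
    rfl
  rw [h5] at h1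
  refine (sq_le_sq₀ (norm_nonneg _) (by positivity)).1 ?_
  linarith

/-- Pulled back along the isometries, a generator on the `u`-th qubits is a tensor product of
operators of the players. Replacing these by the reflections of the strategy costs `r` single-player
errors, and what remains is the correlation of a generator round, whose deficit is at most
`lossFactor r * η`. -/
theorem NearOptimal.re_inner_generator (h : NearOptimal S p s η) (hk : 2 ≤ k) (hkn : k ≤ n)
    (u : Fin n) (j : Fin S.l) :
    1 - (r * (48 * n ^ 3 * √(lossFactor r * η)) + lossFactor r * η) ≤
      (inner ℂ (ampl (∀ i, α i) (tensorOp fun i => (playerIso s i).toContinuousLinearMap)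
        (purify s.isDensity)) (ampl (∀ i, α i) (qubitHom n _ (colHom r u (genMatrix S j)))
          (ampl (∀ i, α i) (tensorOp fun i => (playerIso s i).toContinuousLinearMap)
            (purify s.isDensity)))).re := by
  set Ψ := purify s.isDensity
  set N : ∀ i, Ell2 (α i) →L[ℂ] Ell2 (α i) := fun i => pullback (playerIso s i)
    (ampl _ (matrixOp (qubitTensor fun v =>
      letterMatrix (if v = u then pauliLetter (S.pauli j i) else none)))) with hN
  set A : ∀ i, Ell2 (α i) →L[ℂ] Ell2 (α i) := fun i =>
    (ask (S.pauli j i)).elim 1 fun q => s.R i (u, q) with hA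
  set c : ℂ := (-1) ^ (S.sign j).val with hc
  have hc1 : ‖c‖ = 1 := by simp [hc]
  have h1 : inner ℂ (ampl (∀ i, α i) (tensorOp fun i => (playerIso s i).toContinuousLinearMap) Ψ)
      (ampl (∀ i, α i) (qubitHom n _ (colHom r u (genMatrix S j)))
        (ampl (∀ i, α i) (tensorOp fun i => (playerIso s i).toContinuousLinearMap) Ψ)) =
      c * inner ℂ Ψ (ampl (∀ i, α i) (tensorOp N) Ψ) := by
    rw [genMatrix, map_smul, map_smul, qubitHom_colHom _ _ (S.xz_form j), ← amplHom_apply, map_smul,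
      smul_apply, inner_smul_right, ← ContinuousLinearMap.adjoint_inner_right, adjoint_ampl,
      adjoint_tensorOp]
    congr 2
    simp only [hN, pullback]
    rw [tensorOp_comp, tensorOp_comp]
    rfl
  -- A player with factor `I` contributes the identity on both sides, because her null question is
  -- ignored and the isometry pulls `1` back to `1`.
  have h2 : ∀ i, (∃ w, A i = pauliRefl s i u w ∧
      N i = pullback (playerIso s i) (honestRefl n _ (u, w))) ∨ (A i = 1 ∧ N i = 1) := by
    intro i
    simp only [hA, hN, ask_eq_map]
    cases pauliLetter (S.pauli j i) with
    | none =>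
      right
      refine ⟨rfl, ?_⟩
      have h3 : (fun v : Fin n => letterMatrix (if v = u then none else none)) = fun _ => 1 := by
        funext v
        simp [letterMatrix]
      rw [h3, qubitTensor_one, ← matrixHom_apply, map_one, ampl_one, pullback_one]
    | some w =>
      left
      exact ⟨w, rfl, by rw [honestRefl_eq]⟩
  have hAn : ∀ i, ‖A i‖ ≤ 1 := by
    intro i
    rcases h2 i with ⟨w, h3, -⟩ | ⟨h3, -⟩
    · rw [h3]
      exact (isReflection_pauliRefl s i u w).norm_le
    · rw [h3]
      exact IsReflection.one.norm_le
  have hNn : ∀ i, ‖N i‖ ≤ 1 := by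
    intro i
    rcases h2 i with ⟨w, -, h3⟩ | ⟨-, h3⟩
    · rw [h3]
      exact norm_pullback_le _ (norm_honestRefl_le _ _ _)
    · rw [h3]
      exact IsReflection.one.norm_le
  have hd : ∀ i, stDist Ψ (playerHom α i (A i)) (playerHom α i (N i)) ≤
      48 * n ^ 3 * √(lossFactor r * η) := by
    intro i
    rcases h2 i with ⟨w, h3, h4⟩ | ⟨h3, h4⟩
    · rw [h3, h4]
      exact h.stDist_pullback hk hkn i u w
    · rw [h3, h4, stDist_self]
      positivity
  have h5 := norm_tensorOp_sub_le s.isDensity hAn hNn hd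
  have h6 : (c * inner ℂ Ψ (ampl (∀ i, α i) (tensorOp A) Ψ)).re =
      corr S s.ρ (fun i q => s.R i (u, q)) (.inl j) := by
    rw [corr, roundOp, trAt_smul s.isDensity, trAt_eq s.isDensity]
    rfl
  have h7 := deficit_inl_le s.isDensity (fun i q => s.isReflection i (u, q)) h.pos (h.single u) j
  have h8 : (4 : ℝ) * S.l * η ≤ lossFactor r * η := by
    refine mul_le_mul_of_nonneg_right ?_ h.nonneg
    have := lossFactor_bound S
    have h9 : (0 : ℝ) ≤ 4 * S.l + 32 * r := by positivity
    linarith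
  have h9 : (c * inner ℂ Ψ (ampl (∀ i, α i) (tensorOp A) Ψ)).re -
      (c * inner ℂ Ψ (ampl (∀ i, α i) (tensorOp N) Ψ)).re ≤
        r * (48 * n ^ 3 * √(lossFactor r * η)) := by
    rw [← Complex.sub_re, ← mul_sub, ← inner_sub_right]
    refine (Complex.re_le_norm _).trans ?_
    rw [norm_mul, hc1, one_mul]
    refine (norm_inner_le_norm _ _).trans ?_
    rw [norm_purify, one_mul]
    exact h5
  rw [h1]
  linarith

theorem NearOptimal.re_trace_codeOp (h : NearOptimal S p s η) (hk : 2 ≤ k) (hkn : k ≤ n) :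
    1 - (n * S.l) ^ 2 * ((r * (48 * n ^ 3 * √(lossFactor r * η)) + lossFactor r * η) / 2) ≤
      (trace (codeOp S n (fun i => Bits n × α i) ∘L
        tensorOp (fun i => (playerIso s i).toContinuousLinearMap) ∘L s.ρ ∘L
          ContinuousLinearMap.adjoint
            (tensorOp fun i => (playerIso s i).toContinuousLinearMap))).re := by
  set V := tensorOp fun i => (playerIso s i).toContinuousLinearMap with hV
  have h1 := trace_density s.isDensity (codeOp S n (fun i => Bits n × α i) ∘L V) V
  have h2 : trace (codeOp S n (fun i => Bits n × α i) ∘L V ∘L s.ρ ∘L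
      ContinuousLinearMap.adjoint V) = inner ℂ (ampl _ V (purify s.isDensity))
        (ampl _ (codeOp S n (fun i => Bits n × α i)) (ampl _ V (purify s.isDensity))) := h1
  have h3 : ‖ampl (∀ i, α i) V (purify s.isDensity)‖ = 1 := by
    have h4 : ContinuousLinearMap.adjoint (ampl (∀ i, α i) V) ∘L ampl (∀ i, α i) V = 1 := by
      have h5 : ∀ i, ContinuousLinearMap.adjoint (playerIso s i).toContinuousLinearMap ∘L
          (playerIso s i).toContinuousLinearMap = 1 := fun i => pullback_one (playerIso s i)
      rw [adjoint_ampl, ← ampl_comp, hV, adjoint_tensorOp, ← tensorOp_comp]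
      simp only [h5]
      rw [tensorOp_one, ampl_one]
    have h6 : inner ℂ (ampl (∀ i, α i) V (purify s.isDensity))
        (ampl (∀ i, α i) V (purify s.isDensity)) =
          inner ℂ (purify s.isDensity) (purify s.isDensity) := by
      rw [← ContinuousLinearMap.adjoint_inner_right]
      exact congrArg (inner ℂ _) (congrArg (fun T => T (purify s.isDensity)) h4)
    rw [inner_self_eq_norm_sq_to_K, inner_self_eq_norm_sq_to_K, norm_purify] at h6
    have h7 : ‖ampl (∀ i, α i) V (purify s.isDensity)‖ ^ 2 = 1 ^ 2 := by exact_mod_cast h6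
    exact (sq_eq_sq₀ (norm_nonneg _) zero_le_one).1 h7
  rw [h2]
  exact code_deficit S ((amplHom _ (∀ i, α i)).comp (qubitHom n fun i => Bits n × α i)) h3
    (h.re_inner_generator hk hkn)

end Extraction

/-! ### Powers of `ε` and the constants -/

section Constants

/-- Both `√(A * (x * ε))` and `A * (x * ε)` are at most `A * x * ε ^ (1 / κ)`. -/
theorem sqrt_and_self_le {A x ε κ : ℝ} (hA : 1 ≤ A) (hx : 1 ≤ x) (hε : 0 ≤ ε) (hε1 : ε ≤ 1)
    (hκ : 2 ≤ κ) : √(A * (x * ε)) ≤ A * x * ε ^ (1 / κ) ∧ A * (x * ε) ≤ A * x * ε ^ (1 / κ) := by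
  have hAx : 1 ≤ A * x := one_le_mul_of_one_le_of_one_le hA hx
  have h1 : √ε ≤ ε ^ (1 / κ) := by
    rw [Real.sqrt_eq_rpow]
    rcases hε.eq_or_lt with rfl | h0
    · rw [Real.zero_rpow (by norm_num), Real.zero_rpow (by positivity)]
    · exact Real.rpow_le_rpow_of_exponent_ge h0 hε1
        (one_div_le_one_div_of_le (by norm_num) hκ)
  have h2 : ε ≤ √ε := Real.le_sqrt_of_sq_le (by nlinarith)
  constructor
  · rw [← mul_assoc, Real.sqrt_mul (by linarith)]
    refine mul_le_mul ?_ h1 (Real.sqrt_nonneg _) (by linarith)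
    exact Real.sqrt_le_iff.2 ⟨by linarith, by nlinarith⟩
  · rw [← mul_assoc]
    exact mul_le_mul_of_nonneg_left (h2.trans h1) (by linarith)

theorem one_le_lossFactor_mul {r k : ℕ} (hr : 0 < r) (hk : 0 < k) :
    1 ≤ lossFactor r * multiLoss r k := by
  have hr1 : (1 : ℝ) ≤ r := by exact_mod_cast hr
  have hk1 : (1 : ℝ) ≤ k := by exact_mod_cast hk
  refine one_le_mul_of_one_le_of_one_le ?_ ?_
  · rw [lossFactor]
    have : (0 : ℝ) ≤ 16 * 4 ^ r := by positivity
    linarith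
  · rw [multiLoss]
    have h8 : (1 : ℝ) ≤ (4 * 8 ^ r) ^ k :=
      one_le_pow₀ (by linarith [one_le_pow₀ (M₀ := ℝ) (a := 8) (n := r) (by norm_num)])
    have h9 : (1 : ℝ) ≤ k * r * (4 * 8 ^ r) ^ k :=
      one_le_mul_of_one_le_of_one_le (one_le_mul_of_one_le_of_one_le hk1 hr1) h8
    linarith

end Constants

end

end StabilizerGame

open StabilizerGame in
theorem mainTheorem5 (k : ℕ) (hk : 2 ≤ k) :
    ∃ κ : ℝ, 0 < κ ∧ ∀ r : ℕ, 0 < r → ∃ C : ℝ, 0 < C ∧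
      ∀ (S : XZStabilizer r) (n : ℕ), k ≤ n → ∀ p ∈ Set.Icc (0 : ℝ) 1,
      ∀ (α : Fin r → Type u) (s : Strategy k n α) (ε : ℝ), 0 ≤ ε →
        omegaS - ε ≤ value S p s →
        ∃ (γ : Fin r → Type u) (V : ∀ i, Ell2 (α i) →ₗᵢ[ℂ] Ell2 (Bits n × γ i)),
          (∀ (i : Fin r) (u : Fin n) (w : Fin 2),
            distRefl s.ρ i (s.R i (u, Fin.castLE (by norm_num) w))
              (pullback (V i) (honestRefl n (γ i) (u, w))) ≤ C * ((n : ℝ) ^ κ * ε ^ (1 / κ))) ∧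
          (∀ (i : Fin r) (J : KSubset n k) (w : J.1 → Fin 2),
            distMeas s.ρ i (s.M i J fun v => Fin.castLE (by norm_num) (w v))
              (fun b => pullback (V i) (honestMeas n (γ i) J.1 w b)) ≤
                C * ((n : ℝ) ^ κ * ε ^ (1 / κ))) ∧
          1 - C * ((n : ℝ) ^ κ * ε ^ (1 / κ)) ≤
            (trace (codeOp S n γ ∘L tensorOp (fun i => (V i).toContinuousLinearMap) ∘L s.ρ ∘L
              ContinuousLinearMap.adjoint
                (tensorOp fun i => (V i).toContinuousLinearMap))).re := by
  have hk0 : 0 < k := by lia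
  -- The exponent is `k` from the choice of `J`, `3` from rearranging words, and `2` from the
  -- squared number of projections in the code space estimate.
  refine ⟨k + 5, by positivity, fun r hr => ?_⟩
  set A := lossFactor r * multiLoss r k with hA
  have hA1 : 1 ≤ A := one_le_lossFactor_mul hr hk0
  set Q : ℝ := 4 * 16 ^ r * (48 * r + 1) with hQ
  have hQ0 : 0 ≤ Q := by positivity
  refine ⟨(48 + Q) * A, by positivity, fun S n hkn p hp α s ε hε hval => ?_⟩
  -- Comparing powers of `ε` needs `ε ≤ 1`. For larger `ε` the hypothesis holds with `1` in its
  -- place, since `omegaS ≤ 1` and values are nonnegative.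
  set ε' := min ε 1
  have hε'0 : 0 ≤ ε' := le_min hε zero_le_one
  have hval' : omegaS - ε' ≤ value S p s := by
    rcases min_choice ε 1 with h | h
    · simpa only [ε', h] using hval
    · have h1 : omegaS ≤ 1 := by
        have : √2 ≤ 2 := Real.sqrt_le_iff.2 ⟨by norm_num, by norm_num⟩
        rw [omegaS]
        linarith
      have h2 := value_nonneg (S := S) (s := s) hr hp
      simp only [ε', h]
      linarith
  set η := multiLoss r k * n ^ k * ε'
  have hη0 : 0 ≤ η := by
    have : 0 ≤ multiLoss r k := by
      rw [multiLoss]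
      positivity
    positivity
  have hopt : NearOptimal S p s η :=
    ⟨hr, hη0, single_deficit hr hk0 hkn hp hε'0 hval', multi_deficit hr hk0 hkn hp hε'0 hval'⟩
  have hn1 : (1 : ℝ) ≤ n := by exact_mod_cast (show 1 ≤ n by lia)
  set κ : ℝ := (k : ℝ) + 5
  set e := ε ^ (1 / κ)
  have he0 : 0 ≤ e := Real.rpow_nonneg hε _
  have hee : ε' ^ (1 / κ) ≤ e :=
    Real.rpow_le_rpow hε'0 (min_le_left _ _) (by positivity)
  -- The square root is kept only on `ε'`; that of `A * n ^ k` is dropped, as this quantity is at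
  -- least `1`. One bound then serves both the linear and the square-root error.
  obtain ⟨hb1, hb2⟩ := sqrt_and_self_le (κ := κ) hA1 (one_le_pow₀ (n := k) hn1) hε'0
    (min_le_right _ _) (by simp only [κ]; linarith [(Nat.cast_nonneg k : (0 : ℝ) ≤ k)])
  have hηA : A * ((n : ℝ) ^ k * ε') = lossFactor r * η := by
    simp only [hA, η]
    ring
  rw [hηA] at hb1 hb2
  have hAk : 0 ≤ A * (n : ℝ) ^ k := by positivity
  have hc1 : √(lossFactor r * η) ≤ A * n ^ k * e :=
    hb1.trans (mul_le_mul_of_nonneg_left hee hAk)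
  have hc2 : lossFactor r * η ≤ A * n ^ k * e := hb2.trans (mul_le_mul_of_nonneg_left hee hAk)
  have hnκ : (n : ℝ) ^ κ = n ^ (k + 5) := by
    rw [← Real.rpow_natCast]
    simp [κ]
  have hdist : 48 * n ^ 3 * √(lossFactor r * η) ≤ (48 + Q) * A * ((n : ℝ) ^ κ * e) := by
    rw [hnκ]
    calc 48 * n ^ 3 * √(lossFactor r * η) ≤ 48 * n ^ 3 * (A * n ^ k * e) :=
          mul_le_mul_of_nonneg_left hc1 (by positivity)
      _ = 48 * A * (n ^ (k + 3) * e) := by ring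
      _ ≤ (48 + Q) * A * (n ^ (k + 5) * e) := by
          refine mul_le_mul ?_ ?_ (by positivity) (by positivity)
          · nlinarith
          · exact mul_le_mul_of_nonneg_right (pow_le_pow_right₀ hn1 (by lia)) he0
  refine ⟨fun i => Bits n × α i, playerIso s, fun i u w => ?_, fun i J w => ?_, ?_⟩
  · exact (hopt.distRefl_le hk hkn i u w).trans hdist
  · exact (hopt.distMeas_le hk hkn i J w).trans hdist
  · refine le_trans ?_ (hopt.re_trace_codeOp hk hkn)
    -- This removes the number of generators from the code space bound and is the origin of the
    -- factor `4 * 16 ^ r` in `Q`.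
    have hl : (S.l : ℝ) ^ 2 ≤ 4 * 16 ^ r := by
      have h1 : (S.l : ℝ) ≤ 2 * 4 ^ r := by exact_mod_cast card_generators_le S
      calc (S.l : ℝ) ^ 2 ≤ (2 * 4 ^ r) ^ 2 := pow_le_pow_left₀ (Nat.cast_nonneg _) h1 2
        _ = 4 * 16 ^ r := by
          rw [mul_pow, ← pow_mul, mul_comm r 2, pow_mul]
          norm_num
    have h3 : r * (48 * n ^ 3 * √(lossFactor r * η)) + lossFactor r * η ≤
        (48 * r + 1) * (A * n ^ (k + 3) * e) := by
      have h4 : r * (48 * n ^ 3 * √(lossFactor r * η)) ≤ r * (48 * n ^ 3 * (A * n ^ k * e)) := by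
        gcongr
      have h5 : A * (n : ℝ) ^ k * e ≤ A * n ^ (k + 3) * e := by
        gcongr
        lia
      calc _ ≤ r * (48 * n ^ 3 * (A * n ^ k * e)) + A * n ^ (k + 3) * e :=
            add_le_add h4 (hc2.trans h5)
        _ = _ := by ring
    have h6 : (n * S.l : ℝ) ^ 2 *
        ((r * (48 * n ^ 3 * √(lossFactor r * η)) + lossFactor r * η) / 2) ≤
          (48 + Q) * A * ((n : ℝ) ^ κ * e) := by
      rw [hnκ]
      have h7 : 0 ≤ (48 * r + 1) * (A * (n : ℝ) ^ (k + 3) * e) := by positivity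
      calc (n * S.l : ℝ) ^ 2 *
          ((r * (48 * n ^ 3 * √(lossFactor r * η)) + lossFactor r * η) / 2)
          ≤ (n * S.l : ℝ) ^ 2 * ((48 * r + 1) * (A * n ^ (k + 3) * e)) :=
            mul_le_mul_of_nonneg_left (by linarith) (by positivity)
        _ = (S.l : ℝ) ^ 2 * ((48 * r + 1) * (A * (n ^ (k + 5) * e))) := by ring
        _ ≤ 4 * 16 ^ r * ((48 * r + 1) * (A * (n ^ (k + 5) * e))) :=
            mul_le_mul_of_nonneg_right hl (by positivity)
        _ = Q * A * (n ^ (k + 5) * e) := by rw [hQ]; ring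
        _ ≤ (48 + Q) * A * (n ^ (k + 5) * e) :=
            mul_le_mul_of_nonneg_right (by nlinarith) (by positivity)
    linarith
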